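/- **Model.** A primary and a secondary ad-hoc network occupy a disk $A$ of radius $\rho>0$. Their nodes form independent homogeneous Poisson point processes on $A$ with densities $\lambda^{(p)}=\lambda\to\infty$ and $\lambda^{(s)}=\lambda^{\beta}$, $\beta>1$. For $i\in\{p,s\}$ the transmission and interference ranges are $R_r^{(i)}=K_i\sqrt{\log\lambda^{(i)}/\lambda^{(i)}}$ and $R_I^{(i)}=\sqrt{1+l^{(i)}}\,R_r^{(i)}$, with constants $K_i>0$, $l^{(i)}\ge 0$. The primary-to-secondary and secondary-to-primary interference ranges are $R_I^{(ps)}=c_{ps}R_I^{(p)}$ with a constant $0<c_{ps}\le 1$, and $R_I^{(sp)}=c_{sp}R_I^{(s)}$ with a constant $c_{sp}\ge1$. In a time slot every primary node transmits with probability $q^{(p)}$, independently of everything else. A secondary node transmits with probability $q^{(s)}$ if there is no primary transmitter within the detection range $R_D=R_D(\lambda)\ge 0$ of it, and otherwise stays silent. The packet at the head of the queue of a node has a destination that is uniform among all other nodes of the same network. The next relay is the destination, if it is within $R_r^{(s)}$; otherwise it is uniform among the other nodes in the half-disk of radius $R_r^{(s)}$ centered at the node and oriented towards the destination (no progress is made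 if there is none). A secondary transmission from a node $X$ to its next relay $X'$ succeeds if $X$ transmits, no other secondary node within $R_I^{(s)}$ of $X'$ ($X'$ included) transmits, and there is no primary transmitter within $R_I^{(ps)}$ of $X'$. The progress of a packet is the decrease of its distance to the destination over the hop. The throughput $C^{(s)}_{\{\beta>1\}}$ is the expected total progress of all successfully transmitted secondary packets in a slot; $C^{(s)}$ is the same quantity for the secondary network alone (no primary nodes). If a throughput $C$ satisfies $C=\Theta(f)$, its asymptotic multiplexing gain (AMG) with respect to $f$ is $\chi=\lim_{\lambda\to\infty} C/f$. Throughout, $f=\sqrt{\lambda^{(s)}/\log\lambda^{(s)}}$. The detection range is *admissible* if, for all large $\lambda$, $R_D\le R_I^{(ps)}-R_I^{(s)}$ or $R_D\le R_I^{(sp)}+R_r^{(p)}$. **Theorem.** Let $\beta>1$, let $R_D$ be admissible, $q^{(s)}=\Theta(1/\log\lambda^{(s)})$ and $q^{(p)}=O(1/\log\lambda^{(p)})$. Then $$C^{(s)}_{\{\beta>1\}}=\Theta\Big(\sqrt{\lambda^{(s)}/\log\lambda^{(s)}}\Big).$$ Suppose in addition that $q^{(p)}\sim 1/\big(\lambda^{(p)}\pi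 (R_I^{(p)})^2\big)$, and for $a\ge0$ put $$U_\lambda(a)=\left[e^{-\left(R_I^{(ps)}/R_I^{(p)}\right)^2}+e^{-\left(\left(R_I^{(ps)}/R_I^{(p)}\right)^2-a\right)^+}\right]e^{1-2a}\;\frac{1-\exp\left(-\frac{\lambda^{(s)}(1-q^{(s)}e^{-a})\pi (R_r^{(s)})^2}{2}\right)}{1-\exp\left(-\frac{\lambda^{(s)}(1-q^{(s)})\pi (R_r^{(s)})^2}{2}\right)} .$$ 1. If $R_D\le R_I^{(ps)}-R_I^{(s)}$ for all large $\lambda$, then $\lim_{\lambda\to\infty} C^{(s)}_{\{\beta>1\}}/C^{(s)}=e^{-(R_I^{(ps)}/R_I^{(p)})^2}$. 2. If $R_D> R_I^{(ps)}-R_I^{(s)}$ for all large $\lambda$, then, with $a_2(\lambda)=(R_D/R_I^{(p)})^2$, for every $\varepsilon>0$ and all sufficiently large $\lambda$, $$e^{-a_2(\lambda)}-\varepsilon\le C^{(s)}_{\{\beta>1\}}/C^{(s)}\le U_\lambda(a_2(\lambda))+\varepsilon .$$ 3. If moreover $q^{(s)}\log\lambda^{(s)}$ converges to a positive limit (for example,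 if $q^{(s)}\sim1/(\lambda^{(s)}\pi(R_I^{(s)})^2)$), then the AMG $\chi>0$ of the stand-alone secondary network exists. In case 1 the AMG $\chi^{(s)}_{\{\beta>1\}}$ of the secondary network in the presence of the primary network exists and $\chi^{(s)}_{\{\beta>1\}}/\chi=e^{-(R_I^{(ps)}/R_I^{(p)})^2}$. In case 2, if $R_D/R_I^{(p)}$ converges and $a_2$ denotes the square of its limit, then $\chi^{(s)}_{\{\beta>1\}}$ exists, and for all sufficiently large $\lambda$ $$e^{-a_2}\le\chi^{(s)}_{\{\beta>1\}}/\chi\le U_\lambda(a_2).$$ -/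

import Mathlib

open MeasureTheory ProbabilityTheory Filter Asymptotics
open scoped Topology

noncomputable section

namespace AdHoc

/-! ## One slotted-ALOHA network on a disk -/

/-- The Euclidean plane. -/
abbrev Plane : Type := EuclideanSpace ℝ (Fin 2)

/-- A realization of a network in one time slot: the number `N` of nodes and, for every index
`i`, a location and the ALOHA coin of node `i`. The nodes of the network are the indices
`i < N`; the entries with index at least `N` are not used. -/
abbrev Network : Type := ℕ × (ℕ → Plane × Bool)

namespace Network

/-- The (indices of the) nodes. -/
def nodes (φ : Network) : Finset ℕ := Finset.range φ.1

/-- The location of node `i`. -/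
def loc (φ : Network) (i : ℕ) : Plane := (φ.2 i).1

/-- The ALOHA coin of node `i` allows node `i` to transmit. -/
def coin (φ : Network) (i : ℕ) : Prop := (φ.2 i).2 = true

end Network

/-- The circular area `A` with radius `ρ`. -/
def area (ρ : ℝ) : Set Plane := Metric.closedBall 0 ρ

/-- The law of location and coin of one node: the location is uniform on `A`, and the coin
is independent of it and allows a transmission with probability `q`. -/
def nodeLaw (ρ : ℝ) (q : unitInterval) : Measure (Plane × Bool) :=
  (cond volume (area ρ)).prod (bernoulliMeasure true false q)

/-- The law of a homogeneous Poisson point process of density `l` on `A`, with independent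
ALOHA coins: a Poisson number (of mean `l * |A|`) of independent uniform points. -/
def networkLaw (ρ l : ℝ) (q : unitInterval) : Measure Network :=
  (poissonMeasure (l * volume.real (area ρ)).toNNReal).prod
    (Measure.infinitePi fun _ : ℕ => nodeLaw ρ q)

/-! ## Random half-disk routing and progress -/

/-- The half-disk with radius `R` centered at `x` and oriented towards `d`. -/
def halfDisk (R : ℝ) (x d : Plane) : Set Plane :=
  {z | dist z x ≤ R ∧ 0 ≤ inner ℝ (z - x) (d - x)}

open scoped Classical in
/-- The possible next relays for a packet at node `i` with destination node `d`: the
destination itself if it is within the transmission range, and otherwise all other nodes in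
the transmission half-disk of node `i`. -/
def relays (R : ℝ) (φ : Network) (i d : ℕ) : Finset ℕ :=
  if dist (φ.loc i) (φ.loc d) ≤ R then {d}
  else (φ.nodes.erase i).filter fun j => φ.loc j ∈ halfDisk R (φ.loc i) (φ.loc d)

/-- The progress of a packet with destination `d` that moves from node `i` to node `j`: the
decrease of the distance to the destination. -/
def progress (φ : Network) (i d j : ℕ) : ℝ :=
  dist (φ.loc i) (φ.loc d) - dist (φ.loc j) (φ.loc d)

open scoped Classical in
/-- The total progress, over all nodes `i`, of the packets that are at the head of the queues
and are successfully transmitted, where `success i j` says that a transmission from `i` to the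
next relay `j` succeeds. The expectation over the destination of the packet (uniform among all
other nodes) and over the next relay (uniform among the possible relays), which are chosen
independently of the coins, is taken here; if there is no relay, there is no progress. -/
def totalProgress (R : ℝ) (φ : Network) (success : ℕ → ℕ → Prop) : ℝ :=
  ∑ i ∈ φ.nodes, ((φ.nodes.erase i).card : ℝ)⁻¹ * ∑ d ∈ φ.nodes.erase i,
    ((relays R φ i d).card : ℝ)⁻¹ * ∑ j ∈ relays R φ i d,
      if success i j then progress φ i d j else 0

/-- If `T` is the set of nodes which initiate a transmission, then `i` transmits, and neither
`j` nor any other node within the interference range `RI` of `j`, apart from `i`, does. -/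
def HopSuccess (RI : ℝ) (φ : Network) (T : Set ℕ) (i j : ℕ) : Prop :=
  i ∈ T ∧ ∀ k ∈ φ.nodes, k ≠ i → dist (φ.loc k) (φ.loc j) ≤ RI → k ∉ T

/-- The nodes that initiate a transmission under plain slotted ALOHA. -/
def alohaTransmitters (φ : Network) : Set ℕ := {i | i ∈ φ.nodes ∧ φ.coin i}

/-- The plane region `B` contains no transmitter of the (primary) network `ψ`. -/
def VoidOfTransmitters (ψ : Network) (B : Set Plane) : Prop :=
  ∀ k ∈ alohaTransmitters ψ, ψ.loc k ∉ B

/-- The nodes of the secondary network `φ` that initiate a transmission: the coin allows it,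
and no transmitter of the primary network `ψ` is detected within radius `RD`. -/
def sensingTransmitters (RD : ℝ) (ψ φ : Network) : Set ℕ :=
  {i | i ∈ alohaTransmitters φ ∧ VoidOfTransmitters ψ (Metric.closedBall (φ.loc i) RD)}

/-- Successful transmission from `i` to `j` in the secondary network `φ` in the presence of the
primary network `ψ`. -/
def OverlaidSuccess (RI RIps RD : ℝ) (ψ φ : Network) (i j : ℕ) : Prop :=
  HopSuccess RI φ (sensingTransmitters RD ψ φ) i j ∧
    VoidOfTransmitters ψ (Metric.closedBall (φ.loc j) RIps)

/-! ## The asymptotic model -/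

/-- The parameters of two overlaid networks. Densities, ranges and access probabilities are
functions of the primary density, which tends to infinity. -/
structure OverlaidNetworks where
  /-- radius of the circular area -/
  ρ : ℝ
  ρ_pos : 0 < ρ
  /-- the secondary density is the primary density to the power `β` -/
  β : ℝ
  β_pos : 0 < β
  /-- constants of the transmission ranges `K * √(log l / l)` -/
  Kp : ℝ
  Ks : ℝ
  Kp_pos : 0 < Kp
  Ks_pos : 0 < Ks
  /-- interference range `= √(1 + margin) *` transmission range -/
  marginP : ℝ
  marginS : ℝ
  marginP_nonneg : 0 ≤ marginP
  marginS_nonneg : 0 ≤ marginS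
  /-- ratio of the primary-to-secondary and the primary interference ranges -/
  cps : ℝ
  cps_pos : 0 < cps
  cps_le_one : cps ≤ 1
  /-- ratio of the secondary-to-primary and the secondary interference ranges -/
  csp : ℝ
  one_le_csp : 1 ≤ csp
  /-- ALOHA access probabilities -/
  qp : ℝ → unitInterval
  qs : ℝ → unitInterval
  /-- detection range of the secondary nodes -/
  RD : ℝ → ℝ
  RD_nonneg : ∀ l, 0 ≤ RD l

namespace OverlaidNetworks

variable (M : OverlaidNetworks) (l : ℝ)

/-- secondary density -/
def densS : ℝ := l ^ M.β

/-- primary transmission range -/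
def RrP : ℝ := M.Kp * √(Real.log l / l)

/-- secondary transmission range -/
def RrS : ℝ := M.Ks * √(Real.log (M.densS l) / M.densS l)

/-- primary interference range -/
def RIp : ℝ := √(1 + M.marginP) * M.RrP l

/-- secondary interference range -/
def RIs : ℝ := √(1 + M.marginS) * M.RrS l

/-- interference range from primary transmitters to secondary receivers -/
def RIps : ℝ := M.cps * M.RIp l

/-- interference range from secondary transmitters to primary receivers -/
def RIsp : ℝ := M.csp * M.RIs l

/-- Spatial throughput of the stand-alone secondary network. -/
def singleThroughput : ℝ :=
  ∫ φ, totalProgress (M.RrS l) φ (HopSuccess (M.RIs l) φ (alohaTransmitters φ))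
    ∂(networkLaw M.ρ (M.densS l) (M.qs l))

/-- Spatial throughput of the secondary network in the presence of the primary network; the
two networks are independent. -/
def overlaidThroughput : ℝ :=
  ∫ ω, totalProgress (M.RrS l) ω.2 (OverlaidSuccess (M.RIs l) (M.RIps l) (M.RD l) ω.1 ω.2)
    ∂((networkLaw M.ρ l (M.qp l)).prod (networkLaw M.ρ (M.densS l) (M.qs l)))

/-- The throughput scaling `√(λ / log λ)` at the secondary density. -/
def scale : ℝ := √(M.densS l / Real.log (M.densS l))

/-- The detection range is admissible: either it is at most `RIps - RIs`, or it does not exceed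
`RIsp + RrP`, beyond which a larger value is of no use for the primary network. -/
def Admissible : Prop :=
  ∀ᶠ l in atTop, M.RD l ≤ M.RIps l - M.RIs l ∨ M.RD l ≤ M.RIsp l + M.RrP l

/-- The upper bound for the ratio of the gains, where `a₂` stands for `(RD / RIp) ^ 2`, so that
`max ((RIps / RIp) ^ 2 - a₂) 0` is the positive part of `RIps ^ 2 - RD ^ 2` over `RIp ^ 2`. -/
def upperBound (a₂ : ℝ) : ℝ :=
  (Real.exp (-(M.RIps l / M.RIp l) ^ 2)
      + Real.exp (-max ((M.RIps l / M.RIp l) ^ 2 - a₂) 0))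
    * Real.exp (1 - 2 * a₂)
    * ((1 - Real.exp (-(M.densS l * (1 - M.qs l * Real.exp (-a₂)) * Real.pi * M.RrS l ^ 2 / 2)))
      / (1 - Real.exp (-(M.densS l * (1 - M.qs l) * Real.pi * M.RrS l ^ 2 / 2))))

end OverlaidNetworks

/-- `χ` is the asymptotic multiplexing gain of a network whose throughput `C` scales as `f`. -/
def IsAMG (C f : ℝ → ℝ) (χ : ℝ) : Prop :=
  C =Θ[atTop] f ∧ Tendsto (fun l => C l / f l) atTop (𝓝 χ)

end AdHoc

end

/-! A secondary hop lives on the length scale `RIs`, and for β > 1 this is negligible against the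
scale `RIp` of the primary network. Fix a secondary realization and a hop to a relay X'. If the disk
of radius max(RIps, RD + RIs) around X' is free of primary transmitters, then nothing relevant is
silenced or jammed, and the hop succeeds exactly when it succeeds in the stand-alone network.
Conversely a success forces the disk of radius max(RIps, RD - RrS) to be free. The two void
probabilities differ by O((RIs + RrS) / RIp), so in expectation the primary network multiplies every
hop by one and the same factor, whatever the secondary configuration is. Hops close to the boundary
of the area form a vanishing fraction. This is `abs_measureReal_overlaidSuccess_sub_le` and, after
integration, `abs_sharedThroughput_sub_le`.

When l·qp·π·RIp² → 1, the factor is exp(-max(cps, RD/RIp)²) + o(1) (`tendsto_thinning_sub`). In the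
first case the maximum is cps. In the second it is RD/RIp up to RIs/RIp, so the lower bound of the
theorem is the true asymptotic value, and the upper bound only has to be compared with it. Writing P
for the positive part of cps² - a, this follows from e^{-P} e^{1-2a} = e^{-a} e^{1-a-P} ≥ e^{-a}(2 -
a - P): admissibility gives a ≤ 1 + o(1), and the second case gives P = o(1)
(`eventually_le_upperBound`, `eventually_exp_sub_le_upperBound`).

The stand-alone throughput must be known to first order. It is a sum over triples (node,
destination, relay), in which a relay is chosen with probability 1/(1+N), where N counts the other
nodes in the half-disk. The identity 1/(1+N) = ∫₀¹ t^N dt turns this weight, together with the event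
that no interferer transmits, into a product over the remaining independent nodes
(`inv_card_eq_integral`), and the Poisson number of nodes is then summed explicitly
(`GoodWeight.integral_hopSum_bounds`). The progress is replaced by the projection of the hop on the
direction of the destination, whose integral over the half-disk is R³κ/2
(`setIntegral_halfDisk_inner`, `abs_aloneThroughput_sub_le`). The outcome is throughput = `ideal` ·
(κ/π · e^{-load} + o(1)), see `tendsto_single_div_ideal`, and `ideal` is a constant times (qs log
n)·√(n / log n) for the secondary density n. This gives both the order of growth and the gains. -/

noncomputable section

namespace AdHoc

/-! ## Product measures -/

section InfiniteProduct

variable {X : Type*} [MeasurableSpace X] (ν : Measure X) [IsProbabilityMeasure ν]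

/-- Redrawing one coordinate of an i.i.d. sequence does not change its law. -/
lemma measurePreserving_update (i : ℕ) :
    MeasurePreserving (fun p : X × (ℕ → X) => Function.update p.2 i p.1)
      (ν.prod (Measure.infinitePi fun _ : ℕ => ν)) (Measure.infinitePi fun _ : ℕ => ν) := by
  have hm : Measurable (fun p : X × (ℕ → X) => Function.update p.2 i p.1) := by
    refine measurable_pi_lambda _ fun j => ?_
    by_cases h : j = i
    · subst h; simpa using measurable_fst
    · simp only [Function.update_of_ne h]; fun_prop
  refine ⟨hm, Measure.eq_infinitePi _ fun s t ht => ?_⟩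
  rw [Measure.map_apply hm (MeasurableSet.pi s.countable_toSet fun i _ => ht i)]
  by_cases hi : i ∈ s
  · have : (fun p : X × (ℕ → X) => Function.update p.2 i p.1) ⁻¹' Set.pi s t
        = t i ×ˢ Set.pi (s.erase i : Finset ℕ) t := by
      ext ⟨a, ω⟩
      simp only [Set.mem_preimage, Set.mem_pi, Set.mem_prod, Finset.mem_coe, Finset.mem_erase]
      constructor
      · intro h
        refine ⟨by simpa using h i hi, fun j hj => ?_⟩
        simpa [Function.update_of_ne hj.1] using h j hj.2
      · rintro ⟨h1, h2⟩ j hj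
        by_cases hji : j = i
        · subst hji; simpa using h1
        · simpa [Function.update_of_ne hji] using h2 j ⟨hji, hj⟩
    rw [this, Measure.prod_prod, Measure.infinitePi_pi _ (fun i _ => ht i),
      Finset.mul_prod_erase s (fun i => ν (t i)) hi]
  · have : (fun p : X × (ℕ → X) => Function.update p.2 i p.1) ⁻¹' Set.pi s t
        = Set.univ ×ˢ Set.pi s t := by
      ext ⟨a, ω⟩
      simp only [Set.mem_preimage, Set.mem_pi, Set.mem_prod, Finset.mem_coe, Set.mem_univ,
        true_and]
      refine forall₂_congr fun j hj => ?_
      rw [Function.update_of_ne (by rintro rfl; exact hi hj)]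
    rw [this, Measure.prod_prod, Measure.infinitePi_pi _ (fun i _ => ht i)]
    simp

/-- Conditioning on the mark of one node: the mark becomes a parameter while the integrand may still
look at the whole sequence. -/
lemma integral_infinitePi_update (i : ℕ) {f : (ℕ → X) → ℝ}
    (hf : Integrable f (Measure.infinitePi fun _ : ℕ => ν)) :
    ∫ ω, f ω ∂(Measure.infinitePi fun _ : ℕ => ν)
      = ∫ a, ∫ ω, f (Function.update ω i a) ∂(Measure.infinitePi fun _ : ℕ => ν) ∂ν := by
  have hp := measurePreserving_update ν i
  have h1 := integral_prod _ (hp.integrable_comp_of_integrable hf)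
  have h2 := integral_map (f := f) hp.measurable.aemeasurable
    (by rw [hp.map_eq]; exact hf.aestronglyMeasurable)
  rw [hp.map_eq] at h2
  rw [h2]
  exact h1

lemma integral_prod_infinitePi (s : Finset ℕ) {h : X → ℝ} (hh : Measurable h) :
    ∫ ω, ∏ m ∈ s, h (ω m) ∂(Measure.infinitePi fun _ : ℕ => ν) = (∫ x, h x ∂ν) ^ s.card := by
  have := integral_restrict_infinitePi (μ := fun _ : ℕ => ν) (s := s)
    (f := fun y => ∏ m, h (y m)) (Measurable.aestronglyMeasurable
      (Finset.measurable_fun_prod _ fun m _ => hh.comp (measurable_pi_apply m)))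
  rw [integral_fintype_prod_eq_pow (ι := s) h] at this
  rw [Fintype.card_coe] at this
  rw [← this]
  congr with ω
  rw [← Finset.prod_coe_sort]
  rfl

lemma integral_infinitePi_eval_pair {i j : ℕ} (hij : i ≠ j) {e : X × X → ℝ}
    (he : Measurable e) :
    ∫ ω, e (ω i, ω j) ∂(Measure.infinitePi fun _ : ℕ => ν) = ∫ p, e p ∂(ν.prod ν) := by
  rw [← integral_map (φ := fun ω : ℕ → X => (ω i, ω j)) (by fun_prop) (by fun_prop),
    Measure.infinitePi_map_eval_prod hij]

end InfiniteProduct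

/-! ## Poisson sums -/

/-- This is the derivative in u of the Poisson generating function. It is needed because the hop
sums of k exchangeable nodes are bounded by multiples of k·u^(k-1). -/
lemma hasSum_poisson_mul_pow (r : NNReal) (u : ℝ) :
    HasSum (fun k : ℕ => Real.exp (-r) * r ^ k / k.factorial * (k * u ^ (k - 1)))
      (r * Real.exp (-(r * (1 - u)))) := by
  -- The term k = 0 vanishes despite the truncated exponent, because of the factor k. Shifting the
  -- index cancels k + 1 against the factorial.
  rw [← hasSum_nat_add_iff' 1]
  have h := ((NormedSpace.expSeries_div_hasSum_exp ((r : ℝ) * u)).mul_left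
    (Real.exp (-r) * r))
  rw [← Real.exp_eq_exp_ℝ] at h
  convert! h using 1
  · ext k
    have : ((k + 1).factorial : ℝ) = (k + 1) * k.factorial := by
      rw [Nat.factorial_succ]; push_cast; ring
    rw [this]
    have h1 : (k + 1 : ℝ) ≠ 0 := by positivity
    have h2 : (k.factorial : ℝ) ≠ 0 := by positivity
    push_cast
    field_simp
    ring
  · have : -((r : ℝ) * (1 - u)) = -r + r * u := by ring
    rw [this, Real.exp_add]; simp; ring

lemma hasSum_poisson_pow (r : NNReal) (u : ℝ) :
    HasSum (fun k : ℕ => Real.exp (-r) * r ^ k / k.factorial * u ^ k)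
      (Real.exp (-(r * (1 - u)))) := by
  have h := ((NormedSpace.expSeries_div_hasSum_exp ((r : ℝ) * u)).mul_left (Real.exp (-r)))
  rw [← Real.exp_eq_exp_ℝ] at h
  convert! h using 1
  · ext k; rw [mul_pow]; ring
  · rw [← Real.exp_add]; congr 1; ring

lemma integral_poisson_pow (r : NNReal) (u : ℝ) :
    ∫ k : ℕ, u ^ k ∂(poissonMeasure r) = Real.exp (-(r * (1 - u))) := by
  rw [integral_poissonMeasure]; simpa using (hasSum_poisson_pow r u).tsum_eq

lemma integral_poisson_mul_pow (r : NNReal) (u : ℝ) :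
    ∫ k : ℕ, (k * u ^ (k - 1) : ℝ) ∂(poissonMeasure r) = r * Real.exp (-(r * (1 - u))) := by
  rw [integral_poissonMeasure]; simpa using (hasSum_poisson_mul_pow r u).tsum_eq

lemma integrable_poisson_natCast (r : NNReal) :
    Integrable (fun k : ℕ => (k : ℝ)) (poissonMeasure r) := by
  rw [integrable_poissonMeasure_iff]
  simpa using (hasSum_poisson_mul_pow r 1).summable

lemma integral_poisson_natCast (r : NNReal) :
    ∫ k : ℕ, (k : ℝ) ∂(poissonMeasure r) = r := by
  simpa using integral_poisson_mul_pow r 1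

lemma integrable_poisson_of_le {r : NNReal} {f : ℕ → ℝ} {C : ℝ} (hf : ∀ k, |f k| ≤ C * k) :
    Integrable f (poissonMeasure r) :=
  ((integrable_poisson_natCast r).const_mul C).mono' (Measurable.of_discrete).aestronglyMeasurable
    (ae_of_all _ hf)

/-! ## The law of a network -/

lemma measurableSet_area (ρ : ℝ) : MeasurableSet (area ρ) := Metric.isClosed_closedBall.measurableSet

lemma volume_real_closedBall (x : Plane) {r : ℝ} (hr : 0 ≤ r) :
    volume.real (Metric.closedBall x r) = Real.pi * r ^ 2 := by
  rw [measureReal_def, EuclideanSpace.volume_closedBall_fin_two, ENNReal.toReal_mul,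
    ENNReal.toReal_pow, ENNReal.toReal_ofReal hr]
  simp [mul_comm, Real.pi_nonneg]

lemma volume_real_area {ρ : ℝ} (hρ : 0 < ρ) : volume.real (area ρ) = Real.pi * ρ ^ 2 :=
  volume_real_closedBall 0 hρ.le

lemma isProbabilityMeasure_cond_area {ρ : ℝ} (hρ : 0 < ρ) :
    IsProbabilityMeasure (cond (volume : Measure Plane) (area ρ)) := by
  have h := volume_real_area hρ
  refine cond_isProbabilityMeasure_of_finite ?_ ?_
  · intro h0
    rw [measureReal_def, h0] at h
    have : 0 < Real.pi * ρ ^ 2 := by positivity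
    rw [← h] at this
    simp at this
  · exact measure_closedBall_lt_top.ne

lemma cond_area_real {ρ : ℝ} (s : Set Plane) :
    (cond (volume : Measure Plane) (area ρ)).real s
      = (volume.real (area ρ))⁻¹ * volume.real (area ρ ∩ s) :=
  by rw [measureReal_def, cond_apply (measurableSet_area ρ), ENNReal.toReal_mul, ENNReal.toReal_inv]; rfl

section NodeLaw

variable {ρ : ℝ} (q : unitInterval)

lemma isProbabilityMeasure_nodeLaw (hρ : 0 < ρ) : IsProbabilityMeasure (nodeLaw ρ q) := by
  have := isProbabilityMeasure_cond_area hρ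
  unfold nodeLaw
  infer_instance

lemma integral_nodeLaw (hρ : 0 < ρ) {f : Plane × Bool → ℝ} (hf : Integrable f (nodeLaw ρ q)) :
    ∫ a, f a ∂(nodeLaw ρ q)
      = ∫ x, (q * f (x, true) + (1 - q) * f (x, false)) ∂(cond volume (area ρ)) := by
  have := isProbabilityMeasure_cond_area hρ
  unfold nodeLaw at hf ⊢
  rw [integral_prod _ hf]
  congr with x
  rw [integral_bernoulliMeasure]; simp

lemma isProbabilityMeasure_networkLaw (hρ : 0 < ρ) (l : ℝ) :
    IsProbabilityMeasure (networkLaw ρ l q) := by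
  have := isProbabilityMeasure_nodeLaw q hρ
  unfold networkLaw
  infer_instance

lemma integrable_networkLaw (hρ : 0 < ρ) (l : ℝ) {f : Network → ℝ} (hf : Measurable f) {C : ℝ}
    (hC : ∀ φ, |f φ| ≤ C * φ.1) : Integrable f (networkLaw ρ l q) := by
  have := isProbabilityMeasure_nodeLaw q hρ
  unfold networkLaw
  have h1 : Integrable (fun φ : Network => (φ.1 : ℝ))
      ((poissonMeasure (l * volume.real (area ρ)).toNNReal).prod
        (Measure.infinitePi fun _ : ℕ => nodeLaw ρ q)) :=
    (integrable_poisson_natCast _).comp_fst _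
  exact (h1.const_mul C).mono' hf.aestronglyMeasurable (ae_of_all _ hC)

lemma integral_networkLaw (hρ : 0 < ρ) (l : ℝ) {f : Network → ℝ}
    (hf : Integrable f (networkLaw ρ l q)) :
    ∫ φ, f φ ∂(networkLaw ρ l q) = ∫ k, ∫ ω, f (k, ω) ∂(Measure.infinitePi fun _ : ℕ => nodeLaw ρ q)
      ∂(poissonMeasure (l * volume.real (area ρ)).toNNReal) := by
  have := isProbabilityMeasure_nodeLaw q hρ
  unfold networkLaw at *
  exact integral_prod _ hf

end NodeLaw

/-! ## Weighted sums over hops -/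

open scoped Classical in
/-- The sum of `totalProgress` with a general weight `w i d j` of the hop from `i` to `j` of a packet
with destination `d`. -/
def hopSum (R : ℝ) (φ : Network) (w : ℕ → ℕ → ℕ → ℝ) : ℝ :=
  ∑ i ∈ φ.nodes, ((φ.nodes.erase i).card : ℝ)⁻¹ * ∑ d ∈ φ.nodes.erase i,
    ((relays R φ i d).card : ℝ)⁻¹ * ∑ j ∈ relays R φ i d, w i d j

/-- The sum over all nodes of the average of `e` over the possible destinations. -/
def pairSum (φ : Network) (e : ℕ → ℕ → ℝ) : ℝ :=
  ∑ i ∈ φ.nodes, ((φ.nodes.erase i).card : ℝ)⁻¹ * ∑ d ∈ φ.nodes.erase i, e i d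

lemma hopSum_sub (R : ℝ) (φ : Network) (w w' : ℕ → ℕ → ℕ → ℝ) :
    hopSum R φ w - hopSum R φ w' = hopSum R φ fun i d j => w i d j - w' i d j := by
  simp only [hopSum, Finset.sum_sub_distrib, mul_sub]

lemma hopSum_const_mul (R : ℝ) (φ : Network) (c : ℝ) (w : ℕ → ℕ → ℕ → ℝ) :
    hopSum R φ (fun i d j => c * w i d j) = c * hopSum R φ w := by
  simp only [hopSum, Finset.mul_sum]
  refine Finset.sum_congr rfl fun i _ => Finset.sum_congr rfl fun d _ =>
    Finset.sum_congr rfl fun j _ => ?_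
  ring

lemma inv_card_mul_sum_le {ι : Type*} (s : Finset ι) {f : ι → ℝ} {c : ℝ} (hc : 0 ≤ c)
    (hf : ∀ j ∈ s, f j ≤ c) : (s.card : ℝ)⁻¹ * ∑ j ∈ s, f j ≤ c := by
  rcases s.eq_empty_or_nonempty with rfl | hs
  · simpa using hc
  · have hpos : (0 : ℝ) < s.card := by exact_mod_cast hs.card_pos
    rw [inv_mul_le_iff₀ hpos]
    simpa using Finset.sum_le_card_nsmul s f c hf

/-- The choice of the relay is an average, so a bound that is uniform over relays survives it. An
empty set of relays contributes 0, which is why `e` has to be nonnegative. -/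
lemma abs_hopSum_le {R : ℝ} {φ : Network} {w : ℕ → ℕ → ℕ → ℝ} {e : ℕ → ℕ → ℝ}
    (he : ∀ i d, 0 ≤ e i d)
    (h : ∀ i ∈ φ.nodes, ∀ d ∈ φ.nodes.erase i, ∀ j ∈ relays R φ i d, |w i d j| ≤ e i d) :
    |hopSum R φ w| ≤ pairSum φ e := by
  refine (Finset.abs_sum_le_sum_abs _ _).trans (Finset.sum_le_sum fun i hi => ?_)
  rw [abs_mul, abs_of_nonneg (by positivity)]
  refine mul_le_mul_of_nonneg_left ?_ (by positivity)
  refine (Finset.abs_sum_le_sum_abs _ _).trans (Finset.sum_le_sum fun d hd => ?_)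
  rw [abs_mul, abs_of_nonneg (by positivity)]
  calc _ ≤ ((relays R φ i d).card : ℝ)⁻¹ * ∑ j ∈ relays R φ i d, |w i d j| :=
        mul_le_mul_of_nonneg_left (Finset.abs_sum_le_sum_abs _ _) (by positivity)
    _ ≤ e i d := inv_card_mul_sum_le _ (he i d) (h i hi d hd)

lemma pairSum_le {φ : Network} {e : ℕ → ℕ → ℝ} {c : ℝ} (hc : 0 ≤ c) (h : ∀ i d, e i d ≤ c) :
    pairSum φ e ≤ c * φ.1 := by
  have : pairSum φ e ≤ ∑ i ∈ φ.nodes, c :=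
    Finset.sum_le_sum fun i _ => inv_card_mul_sum_le _ hc fun d _ => h i d
  simpa [Network.nodes, mul_comm] using this

lemma pairSum_nonneg {φ : Network} {e : ℕ → ℕ → ℝ} (h : ∀ i d, 0 ≤ e i d) :
    0 ≤ pairSum φ e :=
  Finset.sum_nonneg fun i _ => mul_nonneg (by positivity) (Finset.sum_nonneg fun d _ => h i d)

lemma mem_relays {R : ℝ} {φ : Network} {i d j : ℕ} :
    j ∈ relays R φ i d ↔ (dist (φ.loc i) (φ.loc d) ≤ R ∧ j = d) ∨
      (¬ dist (φ.loc i) (φ.loc d) ≤ R ∧ (j ≠ i ∧ j < φ.1) ∧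
        φ.loc j ∈ halfDisk R (φ.loc i) (φ.loc d)) := by
  unfold relays
  split_ifs with h <;> simp [h, Network.nodes]

lemma dist_le_of_mem_relays {R : ℝ} {φ : Network} {i d j : ℕ} (h : j ∈ relays R φ i d) :
    dist (φ.loc i) (φ.loc j) ≤ R := by
  rcases mem_relays.1 h with ⟨h, rfl⟩ | ⟨-, -, h⟩
  · exact h
  · rw [dist_comm]; exact h.1

lemma mem_nodes_of_mem_relays {R : ℝ} {φ : Network} {i d j : ℕ} (hd : d ∈ φ.nodes)
    (h : j ∈ relays R φ i d) : j ∈ φ.nodes := by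
  rcases mem_relays.1 h with ⟨h, rfl⟩ | ⟨-, h, -⟩
  · exact hd
  · simpa [Network.nodes] using h.2

lemma ne_of_mem_relays {R : ℝ} {φ : Network} {i d j : ℕ} (hd : d ≠ i)
    (h : j ∈ relays R φ i d) : j ≠ i := by
  rcases mem_relays.1 h with ⟨h, rfl⟩ | ⟨-, h, -⟩
  · exact hd
  · exact h.1

lemma abs_progress_le {R : ℝ} {φ : Network} {i d j : ℕ} (h : j ∈ relays R φ i d) :
    |progress φ i d j| ≤ R :=
  (abs_dist_sub_le _ _ _).trans (dist_le_of_mem_relays h)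

/-! ## Measurability -/

section Measurability

variable {Ω : Type*} [MeasurableSpace Ω] {f : Ω → Network}

@[fun_prop]
lemma measurable_loc (i : ℕ) : Measurable fun φ : Network => φ.loc i := by
  unfold Network.loc; fun_prop

lemma measurableSet_coin (i : ℕ) : MeasurableSet {φ : Network | φ.coin i} := by
  unfold Network.coin
  exact (measurable_snd.comp ((measurable_pi_apply i).comp measurable_snd))
    (MeasurableSet.singleton true)

lemma measurableSet_lt_fst (k : ℕ) : MeasurableSet {φ : Network | k < φ.1} :=
  measurable_fst (MeasurableSet.of_discrete (s := {n : ℕ | k < n}))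

/-- Ranges of summation depend on the random number of nodes. Splitting over its countably many
values leaves sums over fixed index sets. -/
lemma measurable_of_nat {α : Type*} [MeasurableSpace α] {g : Ω → α} {N : Ω → ℕ}
    (hN : Measurable N) (G : ℕ → Ω → α) (hG : ∀ n, Measurable (G n))
    (h : ∀ ω, g ω = G (N ω) ω) : Measurable g := by
  intro t ht
  have : g ⁻¹' t = ⋃ n, (N ⁻¹' {n} ∩ (G n) ⁻¹' t) := by
    ext ω; simp [h]
  rw [this]
  exact MeasurableSet.iUnion fun n => (hN (MeasurableSet.singleton n)).inter (hG n ht)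

lemma measurableSet_mem_halfDisk (R : ℝ) :
    MeasurableSet {p : Plane × Plane × Plane | p.2.2 ∈ halfDisk R p.1 p.2.1} := by
  have h1 : IsClosed {p : Plane × Plane × Plane | dist p.2.2 p.1 ≤ R} :=
    isClosed_le (by fun_prop) (by fun_prop)
  have h2 : IsClosed {p : Plane × Plane × Plane | 0 ≤ inner ℝ (p.2.2 - p.1) (p.2.1 - p.1)} :=
    isClosed_le (by fun_prop) (by fun_prop)
  exact (h1.inter h2).measurableSet

lemma measurableSet_halfDisk (R : ℝ) (x d : Plane) : MeasurableSet (halfDisk R x d) :=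
  (measurable_const.prodMk (measurable_const.prodMk measurable_id) :
    Measurable fun z : Plane => (x, d, z)) (measurableSet_mem_halfDisk R)

lemma measurableSet_mem_relays (hf : Measurable f) (R : ℝ) (i d j : ℕ) :
    MeasurableSet {ω | j ∈ relays R (f ω) i d} := by
  simp only [mem_relays]
  have h1 : MeasurableSet {ω | dist ((f ω).loc i) ((f ω).loc d) ≤ R} :=
    measurableSet_le (by fun_prop) measurable_const
  have h2 : MeasurableSet {ω | (f ω).loc j ∈ halfDisk R ((f ω).loc i) ((f ω).loc d)} :=
    (by fun_prop : Measurable fun ω => ((f ω).loc i, (f ω).loc d, (f ω).loc j))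
      (measurableSet_mem_halfDisk R)
  exact (h1.inter (MeasurableSet.const _)).union
    (h1.compl.inter (((MeasurableSet.const _).inter (hf (measurableSet_lt_fst j))).inter h2))

lemma measurable_sum_relays (hf : Measurable f) (R : ℝ) (i d : ℕ) {w : Ω → ℕ → ℝ}
    (hw : ∀ j, Measurable fun ω => w ω j) :
    Measurable fun ω => ∑ j ∈ relays R (f ω) i d, w ω j := by
  classical
  refine measurable_of_nat (measurable_fst.comp hf)
    -- For n nodes every relay lies in this deterministic set. The index `d` is inserted because
    -- `relays` returns `{d}` even when `d` is not a node.
    (fun n ω => ∑ j ∈ insert d (Finset.range n), if j ∈ relays R (f ω) i d then w ω j else 0)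
    (fun n => Finset.measurable_fun_sum _ fun j _ =>
      Measurable.ite (measurableSet_mem_relays hf R i d j) (hw j) measurable_const) fun ω => ?_
  rw [Finset.sum_ite_mem, Finset.inter_eq_right.2]
  intro j hj
  rcases mem_relays.1 hj with ⟨-, rfl⟩ | ⟨-, h, -⟩
  · simp
  · simpa using Or.inr h.2

lemma measurable_hopSum (hf : Measurable f) (R : ℝ) {w : Ω → ℕ → ℕ → ℕ → ℝ}
    (hw : ∀ i d j, Measurable fun ω => w ω i d j) :
    Measurable fun ω => hopSum R (f ω) (w ω) := by
  refine measurable_of_nat (measurable_fst.comp hf)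
    (fun n ω => ∑ i ∈ Finset.range n, (((Finset.range n).erase i).card : ℝ)⁻¹ *
      ∑ d ∈ (Finset.range n).erase i,
        ((relays R (f ω) i d).card : ℝ)⁻¹ * ∑ j ∈ relays R (f ω) i d, w ω i d j)
    (fun _ => Finset.measurable_fun_sum _ fun i _ => (Finset.measurable_fun_sum _ fun d _ =>
      Measurable.mul (Measurable.inv ?_)
        (measurable_sum_relays hf R i d (hw i d))).const_mul _) fun _ => rfl
  simpa using measurable_sum_relays hf R i d (w := fun _ _ => (1 : ℝ)) fun _ => measurable_const

lemma measurable_pairSum (hf : Measurable f) {e : Ω → ℕ → ℕ → ℝ}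
    (he : ∀ i d, Measurable fun ω => e ω i d) :
    Measurable fun ω => pairSum (f ω) (e ω) :=
  measurable_of_nat (measurable_fst.comp hf)
    (fun n ω => ∑ i ∈ Finset.range n, (((Finset.range n).erase i).card : ℝ)⁻¹ *
      ∑ d ∈ (Finset.range n).erase i, e ω i d)
    (fun _ => Finset.measurable_fun_sum _ fun i _ =>
      (Finset.measurable_fun_sum _ fun d _ => he i d).const_mul _) fun _ => rfl

lemma measurable_progress (hf : Measurable f) (i d j : ℕ) :
    Measurable fun ω => progress (f ω) i d j := by
  unfold progress; fun_prop

lemma measurableSet_alohaTransmitters (hf : Measurable f) (i : ℕ) :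
    MeasurableSet {ω | i ∈ alohaTransmitters (f ω)} := by
  simp only [alohaTransmitters, Set.mem_ofPred_eq, Network.nodes, Finset.mem_range]
  exact (hf (measurableSet_lt_fst i)).inter (hf (measurableSet_coin i))

lemma measurableSet_hopSuccess (hf : Measurable f) (RI : ℝ) {T : Ω → Set ℕ}
    (hT : ∀ i, MeasurableSet {ω | i ∈ T ω}) (i j : ℕ) :
    MeasurableSet {ω | HopSuccess RI (f ω) (T ω) i j} := by
  simp only [HopSuccess, Network.nodes, Finset.mem_range]
  suffices h : MeasurableSet {ω | ∀ k, k < (f ω).1 → k ≠ i →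
      dist ((f ω).loc k) ((f ω).loc j) ≤ RI → k ∉ T ω} from (hT i).inter h
  simp only [Set.ofPred_forall]
  refine MeasurableSet.iInter fun k => ?_
  simp only [imp_iff_not_or]
  have h1 : MeasurableSet {ω | dist ((f ω).loc k) ((f ω).loc j) ≤ RI} :=
    measurableSet_le (by fun_prop) measurable_const
  exact (hf (measurableSet_lt_fst k)).compl.union
    ((MeasurableSet.const _).union (h1.compl.union (hT k).compl))

lemma measurableSet_voidOfTransmitters {g : Ω → Network} {c : Ω → Plane} (hg : Measurable g)
    (hc : Measurable c) (r : ℝ) :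
    MeasurableSet {ω | VoidOfTransmitters (g ω) (Metric.closedBall (c ω) r)} := by
  simp only [VoidOfTransmitters, Set.ofPred_forall, Metric.mem_closedBall]
  refine MeasurableSet.iInter fun k => ?_
  simp only [imp_iff_not_or, Set.ofPred_or]
  have h1 : MeasurableSet {ω | dist ((g ω).loc k) (c ω) ≤ r} :=
    measurableSet_le (by fun_prop) measurable_const
  exact (measurableSet_alohaTransmitters hg k).compl.union h1.compl

lemma measurableSet_overlaidSuccess {g : Ω → Network} (hg : Measurable g) (hf : Measurable f)
    (RI RIps RD : ℝ) (i j : ℕ) :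
    MeasurableSet {ω | OverlaidSuccess RI RIps RD (g ω) (f ω) i j} := by
  refine (measurableSet_hopSuccess hf RI (fun k => ?_) i j).inter
    (measurableSet_voidOfTransmitters hg (by fun_prop) RIps)
  exact (measurableSet_alohaTransmitters hf k).inter
    (measurableSet_voidOfTransmitters hg (by fun_prop) RD)

end Measurability

/-! ## Expectations of sums over pairs of nodes -/

lemma nodes_card_erase {k i : ℕ} (hi : i ∈ Finset.range k) :
    (((Finset.range k).erase i).card : ℝ) = k - 1 := by
  have : 0 < k := by have := Finset.mem_range.1 hi; omega
  rw [Finset.card_erase_of_mem hi, Finset.card_range, Nat.cast_sub (by omega)]; simp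

lemma integrable_of_bounded {α : Type*} [MeasurableSpace α] {μ : Measure α} [IsFiniteMeasure μ]
    {f : α → ℝ} (hf : Measurable f) {C : ℝ} (hC : ∀ a, |f a| ≤ C) : Integrable f μ :=
  Integrable.of_bound hf.aestronglyMeasurable C (ae_of_all _ hC)

/-- Every node contributes at most the expectation of `e` over an independent pair, and the mean
number of nodes is l·|A|. Equality fails only because a lone node has no destination. -/
lemma integral_pairSum_le {ρ : ℝ} (hρ : 0 < ρ) {l : ℝ} (hl : 0 ≤ l) (q : unitInterval)
    {e : (Plane × Bool) × (Plane × Bool) → ℝ} (he : Measurable e) (he0 : ∀ p, 0 ≤ e p) {C : ℝ}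
    (hC : ∀ p, e p ≤ C) :
    ∫ φ, pairSum φ (fun i d => e (φ.2 i, φ.2 d)) ∂(networkLaw ρ l q)
      ≤ l * volume.real (area ρ) * ∫ p, e p ∂((nodeLaw ρ q).prod (nodeLaw ρ q)) := by
  have := isProbabilityMeasure_nodeLaw q hρ
  have hC0 : 0 ≤ C := (he0 ((0, true), (0, true))).trans (hC _)
  have hmeas : Measurable fun φ : Network => pairSum φ (fun i d => e (φ.2 i, φ.2 d)) :=
    measurable_pairSum measurable_id fun i d => by fun_prop
  have hint : Integrable (fun φ : Network => pairSum φ (fun i d => e (φ.2 i, φ.2 d)))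
      (networkLaw ρ l q) := by
    refine integrable_networkLaw q hρ l hmeas (C := C) fun φ => ?_
    rw [abs_of_nonneg (pairSum_nonneg fun i d => he0 _)]
    exact pairSum_le hC0 fun i d => hC _
  rw [integral_networkLaw q hρ l hint]
  set I := ∫ p, e p ∂((nodeLaw ρ q).prod (nodeLaw ρ q)) with hI
  have hI0 : 0 ≤ I := integral_nonneg he0
  have hk : ∀ k : ℕ, ∫ ω, pairSum ((k, ω) : Network) (fun i d => e (ω i, ω d))
      ∂(Measure.infinitePi fun _ : ℕ => nodeLaw ρ q) ≤ I * k := by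
    intro k
    simp only [pairSum, Network.nodes]
    have hei : ∀ i d : ℕ, Integrable (fun ω : ℕ → Plane × Bool => e (ω i, ω d))
        (Measure.infinitePi fun _ : ℕ => nodeLaw ρ q) := fun i d =>
      integrable_of_bounded (by fun_prop) (C := C) fun ω => by
        rw [abs_of_nonneg (he0 _)]; exact hC _
    rw [integral_finsetSum _ fun i _ => (integrable_finsetSum _ fun d _ => hei i d).const_mul _]
    have : ∀ i ∈ Finset.range k, ∫ ω : ℕ → Plane × Bool, (((Finset.range k).erase i).card : ℝ)⁻¹ *
        ∑ d ∈ (Finset.range k).erase i, e (ω i, ω d)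
          ∂(Measure.infinitePi fun _ : ℕ => nodeLaw ρ q) ≤ I := by
      intro i hi
      rw [integral_const_mul, integral_finsetSum _ fun d _ => hei i d]
      refine inv_card_mul_sum_le _ hI0 fun d hd => ?_
      rw [integral_infinitePi_eval_pair (nodeLaw ρ q) (Finset.ne_of_mem_erase hd).symm he]
    simpa [mul_comm] using Finset.sum_le_sum this
  have hr : ((l * volume.real (area ρ)).toNNReal : ℝ) = l * volume.real (area ρ) :=
    Real.coe_toNNReal _ (mul_nonneg hl measureReal_nonneg)
  calc _ ≤ ∫ k : ℕ, I * k ∂(poissonMeasure (l * volume.real (area ρ)).toNNReal) := by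
        refine integral_mono_of_nonneg (ae_of_all _ fun k => ?_)
          ((integrable_poisson_natCast _).const_mul I) (ae_of_all _ hk)
        exact integral_nonneg fun ω => pairSum_nonneg fun i d => he0 _
    _ = _ := by rw [integral_const_mul, integral_poisson_natCast, hr]; ring

/-! ## The expected reciprocal number of relays -/

open scoped Classical in
/-- The factor of one node in the probability generating function of the number of nodes in `H`
on the event that no node in `B` is allowed to transmit. -/
def pgfFactor (H B : Set Plane) (t : ℝ) (a : Plane × Bool) : ℝ :=
  (if a.1 ∈ H then t else 1) * (if a.1 ∈ B ∧ a.2 = true then 0 else 1)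

lemma measurable_pgfFactor {H B : Set Plane} (hH : MeasurableSet H) (hB : MeasurableSet B) :
    Measurable fun p : ℝ × (Plane × Bool) => pgfFactor H B p.1 p.2 := by
  unfold pgfFactor
  refine Measurable.mul (Measurable.ite ?_ measurable_fst measurable_const)
    (Measurable.ite (MeasurableSet.inter ?_ ?_) measurable_const measurable_const)
  · exact measurable_fst.comp measurable_snd hH
  · exact measurable_fst.comp measurable_snd hB
  · exact measurable_snd.comp measurable_snd (MeasurableSet.singleton true)

lemma abs_pgfFactor_le {H B : Set Plane} {t : ℝ} (ht : t ∈ Set.Icc (0 : ℝ) 1)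
    (a : Plane × Bool) : |pgfFactor H B t a| ≤ 1 := by
  unfold pgfFactor
  split_ifs <;> simp [abs_of_nonneg ht.1, ht.2]

-- The identity 1/(n+1) = ∫₀¹ tⁿ dt linearizes the reciprocal of the random number of relays. Both
-- the resulting power and the indicator are products over nodes, so independence becomes
-- applicable.
open scoped Classical in
lemma inv_card_eq_integral (s : Finset ℕ) (H B : Set Plane) (ω : ℕ → Plane × Bool) :
    (1 + ((s.filter fun m => (ω m).1 ∈ H).card : ℝ))⁻¹ *
        (if ∀ m ∈ s, (ω m).1 ∈ B → ¬ (ω m).2 = true then 1 else 0)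
      = ∫ t in (0 : ℝ)..1, ∏ m ∈ s, pgfFactor H B t (ω m) := by
  simp only [pgfFactor, Finset.prod_mul_distrib]
  have h1 : ∀ t : ℝ, ∏ m ∈ s, (if (ω m).1 ∈ H then t else 1)
      = t ^ (s.filter fun m => (ω m).1 ∈ H).card := by
    intro t; rw [Finset.prod_ite]; simp
  have h2 : ∏ m ∈ s, (if (ω m).1 ∈ B ∧ (ω m).2 = true then (0 : ℝ) else 1)
      = if ∀ m ∈ s, (ω m).1 ∈ B → ¬ (ω m).2 = true then 1 else 0 := by
    split_ifs with h
    · refine Finset.prod_eq_one fun m hm => if_neg fun h' => h m hm h'.1 h'.2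
    · push Not at h
      obtain ⟨m, hm, h3, h4⟩ := h
      exact Finset.prod_eq_zero hm (if_pos ⟨h3, h4⟩)
  simp only [h1, h2]
  rw [intervalIntegral.integral_mul_const, integral_pow]
  simp [add_comm]

section Inner

variable {ρ : ℝ} (q : unitInterval) {H B : Set Plane}

open scoped Classical in
lemma integral_inv_card (hρ : 0 < ρ) (s : Finset ℕ) (hH : MeasurableSet H) (hB : MeasurableSet B) :
    ∫ ω : ℕ → Plane × Bool, (1 + ((s.filter fun m => (ω m).1 ∈ H).card : ℝ))⁻¹ *
        (if ∀ m ∈ s, (ω m).1 ∈ B → ¬ (ω m).2 = true then 1 else 0)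
        ∂(Measure.infinitePi fun _ : ℕ => nodeLaw ρ q)
      = ∫ t in (0 : ℝ)..1, (∫ a, pgfFactor H B t a ∂(nodeLaw ρ q)) ^ s.card := by
  have := isProbabilityMeasure_nodeLaw q hρ
  simp only [inv_card_eq_integral, intervalIntegral.integral_of_le zero_le_one]
  rw [integral_integral_swap]
  · congr with t
    exact integral_prod_infinitePi _ s
      ((measurable_pgfFactor hH hB).comp (measurable_const.prodMk measurable_id))
  · refine Integrable.of_bound (C := 1) (Measurable.aestronglyMeasurable ?_) ?_
    · refine Finset.measurable_fun_prod _ fun m _ => ?_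
      exact (measurable_pgfFactor hH hB).comp (by fun_prop :
        Measurable fun p : (ℕ → Plane × Bool) × ℝ => (p.2, p.1 m))
    · have : ∀ᵐ t ∂(volume.restrict (Set.Ioc (0 : ℝ) 1)), t ∈ Set.Ioc (0 : ℝ) 1 :=
        ae_restrict_mem measurableSet_Ioc
      filter_upwards [Measure.quasiMeasurePreserving_snd.ae this] with p hp
      simp only [Function.uncurry, Real.norm_eq_abs, Finset.abs_prod]
      exact Finset.prod_le_one (fun _ _ => abs_nonneg _) fun m _ =>
        abs_pgfFactor_le ⟨hp.1.le, hp.2⟩ _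

/-- Integrating (1 - (1-t)·1_H)(1 - q·1_B) gives exactly 1 - qb - (1-t)h + q(1-t)|H ∩ B|, with |·|
the uniform probability. Since |H ∩ B| lies between 0 and h, the geometry of the overlap of
half-disk and interference disk never has to be computed. The price is a factor 1 - q, which tends
to 1. -/
lemma integral_pgfFactor_bounds (hρ : 0 < ρ) (hH : MeasurableSet H) (hB : MeasurableSet B) {t : ℝ}
    (ht : t ∈ Set.Icc (0 : ℝ) 1) {h b : ℝ}
    (hh : (cond (volume : Measure Plane) (area ρ)).real H = h)
    (hb : (cond (volume : Measure Plane) (area ρ)).real B = b) :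
    1 - q * b - (1 - t) * h ≤ ∫ a, pgfFactor H B t a ∂(nodeLaw ρ q) ∧
      ∫ a, pgfFactor H B t a ∂(nodeLaw ρ q) ≤ 1 - q * b - (1 - t) * ((1 - q) * h) := by
  have := isProbabilityMeasure_nodeLaw q hρ
  have := isProbabilityMeasure_cond_area hρ
  have hm : Measurable (pgfFactor H B t) :=
    (measurable_pgfFactor hH hB).comp (measurable_const.prodMk measurable_id)
  rw [integral_nodeLaw q hρ (integrable_of_bounded hm (abs_pgfFactor_le ht))]
  have hq0 : (0 : ℝ) ≤ q := q.2.1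
  have hq1 : (q : ℝ) ≤ 1 := q.2.2
  have hlin : ∀ c : ℝ, ∫ x, (1 - q * B.indicator 1 x - (1 - t) * (c * H.indicator 1 x))
      ∂(cond (volume : Measure Plane) (area ρ)) = 1 - q * b - (1 - t) * (c * h) := by
    intro c
    have i1 : Integrable (B.indicator (1 : Plane → ℝ)) (cond volume (area ρ)) :=
      (integrable_const 1).indicator hB
    have i2 : Integrable (H.indicator (1 : Plane → ℝ)) (cond volume (area ρ)) :=
      (integrable_const 1).indicator hH
    have i3 : Integrable (fun x => 1 - q * B.indicator 1 x : Plane → ℝ) (cond volume (area ρ)) :=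
      (integrable_const _).sub (i1.const_mul _)
    rw [integral_sub i3 ((i2.const_mul _).const_mul _),
      integral_sub (integrable_const _) (i1.const_mul _), integral_const_mul, integral_const_mul,
      integral_const_mul, integral_indicator_one hB, integral_indicator_one hH, hh, hb]
    simp
  have hint : ∀ c : ℝ, Integrable (fun x => (1 - q * B.indicator 1 x -
      (1 - t) * (c * H.indicator 1 x) : ℝ)) (cond (volume : Measure Plane) (area ρ)) := fun c =>
    ((integrable_const _).sub (((integrable_const (1 : ℝ)).indicator hB).const_mul _)).sub
      ((((integrable_const (1 : ℝ)).indicator hH).const_mul _).const_mul _)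
  have hf : Integrable (fun x => q * pgfFactor H B t (x, true) + (1 - q) * pgfFactor H B t (x, false))
      (cond (volume : Measure Plane) (area ρ)) := by
    refine Integrable.add ?_ ?_ <;>
    exact (integrable_of_bounded (hm.comp (by fun_prop)) fun x => abs_pgfFactor_le ht _).const_mul _
  have h1t : 0 ≤ 1 - t := by linarith [ht.2]
  constructor
  · have := hlin 1
    rw [one_mul] at this
    rw [← this]
    refine integral_mono (hint 1) hf fun x => ?_
    by_cases h1 : x ∈ H <;> by_cases h2 : x ∈ B <;> simp [pgfFactor, h1, h2] <;>
      nlinarith [mul_nonneg h1t hq0]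
  · rw [← hlin]
    refine integral_mono hf (hint _) fun x => ?_
    by_cases h1 : x ∈ H <;> by_cases h2 : x ∈ B <;> simp [pgfFactor, h1, h2] <;>
      nlinarith [mul_nonneg h1t hq0]

lemma integral_affine_pow (r : ℕ) (u : ℝ) {h : ℝ} (hh : h ≠ 0) :
    ∫ t in (0 : ℝ)..1, (u - (1 - t) * h) ^ r = (u ^ (r + 1) - (u - h) ^ (r + 1)) / ((r + 1) * h) := by
  have : ∀ t : ℝ, u - (1 - t) * h = h * t + (u - h) := fun t => by ring
  simp only [this]
  rw [intervalIntegral.integral_comp_mul_add (fun x => x ^ r) hh, integral_pow]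
  have h2 : (r : ℝ) + 1 ≠ 0 := by positivity
  simp only [smul_eq_mul]
  field_simp
  ring

open scoped Classical in
lemma integral_inv_card_bounds (hρ : 0 < ρ) (s : Finset ℕ) (hH : MeasurableSet H) (hB : MeasurableSet B)
    (hq : (q : ℝ) < 1) {h b : ℝ} (h0 : 0 < h)
    (hh : (cond (volume : Measure Plane) (area ρ)).real H = h)
    (hb : (cond (volume : Measure Plane) (area ρ)).real B = b) (hu : 0 ≤ 1 - q * b - h) :
    ((1 - q * b) ^ (s.card + 1) - (1 - q * b - h) ^ (s.card + 1)) / ((s.card + 1) * h)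
      ≤ ∫ ω : ℕ → Plane × Bool, (1 + ((s.filter fun m => (ω m).1 ∈ H).card : ℝ))⁻¹ *
        (if ∀ m ∈ s, (ω m).1 ∈ B → ¬ (ω m).2 = true then 1 else 0)
        ∂(Measure.infinitePi fun _ : ℕ => nodeLaw ρ q) ∧
    ∫ ω : ℕ → Plane × Bool, (1 + ((s.filter fun m => (ω m).1 ∈ H).card : ℝ))⁻¹ *
        (if ∀ m ∈ s, (ω m).1 ∈ B → ¬ (ω m).2 = true then 1 else 0)
        ∂(Measure.infinitePi fun _ : ℕ => nodeLaw ρ q)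
      ≤ (1 - q * b) ^ (s.card + 1) / ((s.card + 1) * ((1 - q) * h)) := by
  rw [integral_inv_card q hρ s hH hB]
  have hq0 : (0 : ℝ) ≤ q := q.2.1
  have hq1 : 0 < (1 - q : ℝ) * h := mul_pos (by linarith) h0
  have hbd := fun t (ht : t ∈ Set.Icc (0 : ℝ) 1) => integral_pgfFactor_bounds q hρ hH hB ht hh hb
  have hpos : ∀ t ∈ Set.Icc (0 : ℝ) 1, 0 ≤ 1 - q * b - (1 - t) * h := fun t ht => by
    nlinarith [ht.1]
  have hsm : StronglyMeasurable fun t : ℝ => ∫ a, pgfFactor H B t a ∂(nodeLaw ρ q) := by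
    have := isProbabilityMeasure_nodeLaw q hρ
    exact (measurable_pgfFactor hH hB).stronglyMeasurable.integral_prod_right
  have hint : IntervalIntegrable (fun t => (∫ a, pgfFactor H B t a ∂(nodeLaw ρ q)) ^ s.card)
      volume 0 1 := by
    rw [intervalIntegrable_iff_integrableOn_Ioc_of_le zero_le_one]
    refine Integrable.of_bound (C := 1) (hsm.pow _).aestronglyMeasurable ?_
    filter_upwards [ae_restrict_mem measurableSet_Ioc] with t ht
    have := isProbabilityMeasure_nodeLaw q hρ
    rw [norm_pow]
    refine pow_le_one₀ (norm_nonneg _) ?_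
    refine (norm_integral_le_of_norm_le_const (C := 1)
      (ae_of_all _ fun a => abs_pgfFactor_le ⟨ht.1.le, ht.2⟩ a)).trans ?_
    simp
  constructor
  · rw [← integral_affine_pow _ _ h0.ne']
    refine intervalIntegral.integral_mono_on zero_le_one
      (Continuous.intervalIntegrable (by fun_prop) _ _) hint fun t ht => ?_
    exact pow_le_pow_left₀ (hpos t ht) (hbd t ht).1 _
  · calc _ ≤ ∫ t in (0 : ℝ)..1, (1 - q * b - (1 - t) * ((1 - q) * h)) ^ s.card := by
          refine intervalIntegral.integral_mono_on zero_le_one hint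
            (Continuous.intervalIntegrable (by fun_prop) _ _) fun t ht => ?_
          exact pow_le_pow_left₀ ((hpos t ht).trans (hbd t ht).1) (hbd t ht).2 _
      _ ≤ _ := by
          rw [integral_affine_pow _ _ hq1.ne']
          refine div_le_div_of_nonneg_right ?_ (by positivity)
          have : 0 ≤ 1 - q * b - (1 - q) * h := by nlinarith
          -- The second power in the exact integral is dropped in the upper bound. In the lower
          -- bound it is kept, and it is negligible there once the half-disk contains many nodes.
          linarith [pow_nonneg this (s.card + 1)]

end Inner

/-! ## Conditioning on a node, its destination and its relay -/

/-- The remaining dependence of F on the sequence only involves coordinates in `s`. Redrawing the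
coordinates i, d and j one after another therefore leaves it unchanged and makes the three marks
independent of it. -/
lemma integral_infinitePi_three {X : Type*} [MeasurableSpace X] (ν : Measure X)
    [IsProbabilityMeasure ν] {i d j : ℕ} {s : Finset ℕ} (hid : i ≠ d) (hij : i ≠ j) (hdj : d ≠ j)
    (hi : i ∉ s) (hd : d ∉ s) (hj : j ∉ s) {F : X × X × X → (ℕ → X) → ℝ}
    (hF : Measurable (Function.uncurry F)) {C : ℝ} (hC : ∀ p ω, |F p ω| ≤ C)
    (hs : ∀ p ω ω', (∀ m ∈ s, ω m = ω' m) → F p ω = F p ω') :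
    ∫ ω, F (ω i, ω d, ω j) ω ∂(Measure.infinitePi fun _ : ℕ => ν)
      = ∫ p, ∫ ω, F p ω ∂(Measure.infinitePi fun _ : ℕ => ν) ∂(ν.prod (ν.prod ν)) := by
  set Q := Measure.infinitePi fun _ : ℕ => ν
  have hbd : ∀ G : (ℕ → X) → X × X × X, Measurable G → Integrable (fun ω => F (G ω) ω) Q :=
    fun G hG => integrable_of_bounded (hF.comp (hG.prodMk measurable_id)) fun ω => hC _ _
  have hJm : StronglyMeasurable fun p => ∫ ω, F p ω ∂Q := hF.stronglyMeasurable.integral_prod_right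
  have hJb : ∀ p, |∫ ω, F p ω ∂Q| ≤ C := fun p => by
    simpa using norm_integral_le_of_norm_le_const (μ := Q) (f := F p) (C := C)
      (ae_of_all _ (hC p))
  rw [integral_prod _ (integrable_of_bounded hJm.measurable hJb),
    integral_infinitePi_update ν i (hbd _ (by fun_prop))]
  congr with a
  rw [integral_prod (fun r => ∫ ω, F (a, r) ω ∂Q) (integrable_of_bounded
    (hJm.measurable.comp (by fun_prop)) fun r => hJb (a, r))]
  have e1 : ∀ ω : ℕ → X, F (Function.update ω i a i, Function.update ω i a d,
      Function.update ω i a j) (Function.update ω i a) = F (a, ω d, ω j) ω := by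
    intro ω
    rw [Function.update_self, Function.update_of_ne hid.symm, Function.update_of_ne hij.symm]
    exact hs _ _ _ fun m hm => Function.update_of_ne (by rintro rfl; exact hi hm) _ _
  simp only [e1]
  rw [integral_infinitePi_update ν d (hbd _ (by fun_prop))]
  congr with b
  have e2 : ∀ ω : ℕ → X, F (a, Function.update ω d b d,
      Function.update ω d b j) (Function.update ω d b) = F (a, b, ω j) ω := by
    intro ω
    rw [Function.update_self, Function.update_of_ne hdj.symm]
    exact hs _ _ _ fun m hm => Function.update_of_ne (by rintro rfl; exact hd hm) _ _
  simp only [e2]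
  rw [integral_infinitePi_update ν j (hbd _ (by fun_prop))]
  congr with c
  congr with ω
  rw [Function.update_self]
  exact hs _ _ _ fun m hm => Function.update_of_ne (by rintro rfl; exact hj hm) _ _

/-- The uniform law on the area. -/
abbrev unif (ρ : ℝ) : Measure Plane := cond volume (area ρ)

lemma integral_nodeLaw_mul {ρ : ℝ} (hρ : 0 < ρ) (q : unitInterval) (α : Bool → ℝ) (f : Plane → ℝ) :
    ∫ a, α a.2 * f a.1 ∂(nodeLaw ρ q) = (q * α true + (1 - q) * α false) * ∫ x, f x ∂(unif ρ) := by
  have := isProbabilityMeasure_cond_area hρ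
  have h := integral_prod_mul (μ := unif ρ) (ν := bernoulliMeasure true false q) f α
  rw [integral_bernoulliMeasure] at h
  simp only [nodeLaw, mul_comm (α _)]
  rw [h, mul_comm]
  simp

lemma integral_nodeLaw_three {ρ : ℝ} (hρ : 0 < ρ) (q : unitInterval) (α β γ : Bool → ℝ)
    {g : Plane × Plane × Plane → ℝ} (hg : Measurable g) {C : ℝ} (hC : ∀ p, |g p| ≤ C) :
    ∫ p : (Plane × Bool) × (Plane × Bool) × (Plane × Bool),
        α p.1.2 * (β p.2.1.2 * (γ p.2.2.2 * g (p.1.1, p.2.1.1, p.2.2.1)))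
        ∂((nodeLaw ρ q).prod ((nodeLaw ρ q).prod (nodeLaw ρ q)))
      = (q * α true + (1 - q) * α false) * ((q * β true + (1 - q) * β false) *
        ((q * γ true + (1 - q) * γ false) *
        ∫ x, ∫ y, ∫ z, g (x, y, z) ∂(unif ρ) ∂(unif ρ) ∂(unif ρ))) := by
  have := isProbabilityMeasure_nodeLaw q hρ
  have := isProbabilityMeasure_cond_area hρ
  obtain ⟨A, hA⟩ : ∃ A, ∀ x, |α x| ≤ A := ⟨max |α true| |α false|, by rintro (_ | _) <;> simp⟩
  obtain ⟨B, hB⟩ : ∃ A, ∀ x, |β x| ≤ A := ⟨max |β true| |β false|, by rintro (_ | _) <;> simp⟩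
  obtain ⟨D, hD⟩ : ∃ A, ∀ x, |γ x| ≤ A := ⟨max |γ true| |γ false|, by rintro (_ | _) <;> simp⟩
  have hA0 : 0 ≤ A := (abs_nonneg _).trans (hA true)
  have hB0 : 0 ≤ B := (abs_nonneg _).trans (hB true)
  have hD0 : 0 ≤ D := (abs_nonneg _).trans (hD true)
  have hα : Measurable α := .of_discrete
  have hβ : Measurable β := .of_discrete
  have hγ : Measurable γ := .of_discrete
  have hm : Measurable fun p : (Plane × Bool) × (Plane × Bool) × (Plane × Bool) =>
      α p.1.2 * (β p.2.1.2 * (γ p.2.2.2 * g (p.1.1, p.2.1.1, p.2.2.1))) := by fun_prop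
  have hb : ∀ p : (Plane × Bool) × (Plane × Bool) × (Plane × Bool),
      |α p.1.2 * (β p.2.1.2 * (γ p.2.2.2 * g (p.1.1, p.2.1.1, p.2.2.1)))| ≤
        A * (B * (D * C)) := fun p => by
    simp only [abs_mul]
    gcongr
    exacts [hA _, hB _, hD _, hC _]
  rw [integral_prod _ (integrable_of_bounded hm hb)]
  have e : ∀ a : Plane × Bool, ∫ r : (Plane × Bool) × (Plane × Bool),
      α a.2 * (β r.1.2 * (γ r.2.2 * g (a.1, r.1.1, r.2.1))) ∂((nodeLaw ρ q).prod (nodeLaw ρ q))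
      = α a.2 * ((q * β true + (1 - q) * β false) * ((q * γ true + (1 - q) * γ false) *
        ∫ y, ∫ z, g (a.1, y, z) ∂(unif ρ) ∂(unif ρ))) := by
    intro a
    rw [integral_prod (fun r : (Plane × Bool) × (Plane × Bool) =>
      α a.2 * (β r.1.2 * (γ r.2.2 * g (a.1, r.1.1, r.2.1)))) (integrable_of_bounded
      (hm.comp (by fun_prop : Measurable fun r => (a, r))) fun r => hb (a, r))]
    simp only [integral_const_mul]
    have e' : ∀ b : Plane × Bool, ∫ c : Plane × Bool, γ c.2 * g (a.1, b.1, c.1) ∂(nodeLaw ρ q) =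
      (q * γ true + (1 - q) * γ false) * ∫ z, g (a.1, b.1, z) ∂(unif ρ) := fun b =>
      integral_nodeLaw_mul hρ q γ fun z => g (a.1, b.1, z)
    simp only [e']
    congr 1
    rw [integral_nodeLaw_mul hρ q β fun y => (q * γ true + (1 - q) * γ false) *
      ∫ z, g (a.1, y, z) ∂(unif ρ), integral_const_mul]
  simp only [e]
  rw [integral_nodeLaw_mul hρ q α fun x => (q * β true + (1 - q) * β false) *
    ((q * γ true + (1 - q) * γ false) * ∫ y, ∫ z, g (x, y, z) ∂(unif ρ) ∂(unif ρ)),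
    integral_const_mul, integral_const_mul]

/-! ## Expectation of a hop sum with weights supported on good triples -/

/-- A nonnegative bounded weight of a node `x`, destination `y` and relay `z`, supported on
configurations for which the relay is chosen from the half-disk, whose area is a fraction `h` of the
total area, and the interference disk of the relay has a fraction `b` of the total area. -/
structure GoodWeight (ρ R RI h b C : ℝ) (g : Plane × Plane × Plane → ℝ) : Prop where
  measurable : Measurable g
  nonneg : ∀ p, 0 ≤ g p
  le : ∀ p, g p ≤ C
  lt_dist : ∀ {x y z}, g (x, y, z) ≠ 0 → R < dist x y
  mem_halfDisk : ∀ {x y z}, g (x, y, z) ≠ 0 → z ∈ halfDisk R x y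
  halfDisk_real : ∀ {x y z}, g (x, y, z) ≠ 0 → (unif ρ).real (halfDisk R x y) = h
  ball_real : ∀ {x y z}, g (x, y, z) ≠ 0 → (unif ρ).real (Metric.closedBall z RI) = b

open scoped Classical in
/-- The success indicator of the hop from `i` to `j`, weighted by `g`. -/
def hopWeight (RI : ℝ) (g : Plane × Plane × Plane → ℝ) (φ : Network) (i d j : ℕ) : ℝ :=
  if HopSuccess RI φ (alohaTransmitters φ) i j then g (φ.loc i, φ.loc d, φ.loc j) else 0

open scoped Classical in
/-- The number of nodes in `s` in the half-disk, other than the relay, inverted, on the event that no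
node of `s` close to the relay is allowed to transmit. -/
def relayFactor (R RI : ℝ) (s : Finset ℕ) (x y z : Plane) (ω : ℕ → Plane × Bool) : ℝ :=
  (1 + ((s.filter fun m => (ω m).1 ∈ halfDisk R x y).card : ℝ))⁻¹ *
    (if ∀ m ∈ s, (ω m).1 ∈ Metric.closedBall z RI → ¬ (ω m).2 = true then 1 else 0)

open scoped Classical in
/-- The indicator that the coins of node, destination and relay permit a success. -/
def coinFactor (RI : ℝ) (p : (Plane × Bool) × (Plane × Bool) × (Plane × Bool)) : ℝ :=
  if p.1.2 = true ∧ (dist p.2.1.1 p.2.2.1 ≤ RI → ¬ p.2.1.2 = true) ∧ ¬ p.2.2.2 = true then 1 else 0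

/-- The contribution of one triple to the hop sum, as a function of the marks of the triple and of
the other nodes. -/
def tripleTerm (R RI : ℝ) (g : Plane × Plane × Plane → ℝ) (s : Finset ℕ)
    (p : (Plane × Bool) × (Plane × Bool) × (Plane × Bool)) (ω : ℕ → Plane × Bool) : ℝ :=
  coinFactor RI p * g (p.1.1, p.2.1.1, p.2.2.1) * relayFactor R RI s p.1.1 p.2.1.1 p.2.2.1 ω

lemma relayFactor_nonneg {R RI : ℝ} {s : Finset ℕ} {x y z : Plane} {ω : ℕ → Plane × Bool} :
    0 ≤ relayFactor R RI s x y z ω := by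
  unfold relayFactor
  refine mul_nonneg (by positivity) ?_
  split_ifs <;> norm_num

lemma relayFactor_le_one {R RI : ℝ} {s : Finset ℕ} {x y z : Plane} {ω : ℕ → Plane × Bool} :
    relayFactor R RI s x y z ω ≤ 1 := by
  classical
  unfold relayFactor
  refine mul_le_one₀ (inv_le_one_of_one_le₀ ?_) ?_ ?_
  · exact le_add_of_nonneg_right (Nat.cast_nonneg _)
  all_goals split_ifs <;> norm_num

lemma coinFactor_nonneg {RI : ℝ} (p) : 0 ≤ coinFactor RI p := by
  unfold coinFactor; split_ifs <;> norm_num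

lemma coinFactor_le_one {RI : ℝ} (p) : coinFactor RI p ≤ 1 := by
  unfold coinFactor; split_ifs <;> norm_num

lemma measurable_coinFactor (RI : ℝ) : Measurable (coinFactor RI) := by
  have h1 : MeasurableSet {p : (Plane × Bool) × (Plane × Bool) × (Plane × Bool) | p.1.2 = true} :=
    (by fun_prop : Measurable fun p : (Plane × Bool) × (Plane × Bool) × (Plane × Bool) => p.1.2)
      (MeasurableSet.singleton true)
  have h2 : MeasurableSet {p : (Plane × Bool) × (Plane × Bool) × (Plane × Bool) | p.2.1.2 = true} :=
    (by fun_prop : Measurable fun p : (Plane × Bool) × (Plane × Bool) × (Plane × Bool) => p.2.1.2)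
      (MeasurableSet.singleton true)
  have h3 : MeasurableSet {p : (Plane × Bool) × (Plane × Bool) × (Plane × Bool) | p.2.2.2 = true} :=
    (by fun_prop : Measurable fun p : (Plane × Bool) × (Plane × Bool) × (Plane × Bool) => p.2.2.2)
      (MeasurableSet.singleton true)
  have h4 : MeasurableSet {p : (Plane × Bool) × (Plane × Bool) × (Plane × Bool) |
      dist p.2.1.1 p.2.2.1 ≤ RI} := measurableSet_le (by fun_prop) measurable_const
  unfold coinFactor
  refine Measurable.ite ?_ measurable_const measurable_const
  simp only [imp_iff_not_or]
  exact h1.inter ((h4.compl.union h2.compl).inter h3.compl)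

lemma measurable_relayFactor (R RI : ℝ) (s : Finset ℕ) :
    Measurable fun t : ((Plane × Bool) × (Plane × Bool) × (Plane × Bool)) × (ℕ → Plane × Bool) =>
      relayFactor R RI s t.1.1.1 t.1.2.1.1 t.1.2.2.1 t.2 := by
  unfold relayFactor
  simp only [Finset.card_filter, Nat.cast_sum]
  refine Measurable.mul (Measurable.inv (measurable_const.add (Finset.measurable_fun_sum _
    fun m _ => ?_))) (Measurable.ite ?_ measurable_const measurable_const)
  · push_cast
    refine Measurable.ite ?_ measurable_const measurable_const
    exact (by fun_prop : Measurable fun t : ((Plane × Bool) × (Plane × Bool) × (Plane × Bool)) ×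
      (ℕ → Plane × Bool) => (t.1.1.1, t.1.2.1.1, (t.2 m).1)) (measurableSet_mem_halfDisk R)
  · simp only [imp_iff_not_or, Set.ofPred_forall]
    refine MeasurableSet.iInter fun m => ?_
    refine (MeasurableSet.const _).union (MeasurableSet.union (MeasurableSet.compl ?_)
      (MeasurableSet.compl ?_))
    · exact measurableSet_le (by fun_prop) measurable_const
    · exact (by fun_prop : Measurable fun t : ((Plane × Bool) × (Plane × Bool) × (Plane × Bool)) ×
        (ℕ → Plane × Bool) => (t.2 m).2) (MeasurableSet.singleton true)

lemma measurable_tripleTerm (R RI : ℝ) (s : Finset ℕ) {g : Plane × Plane × Plane → ℝ}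
    (hg : Measurable g) : Measurable (Function.uncurry (tripleTerm R RI g s)) := by
  unfold tripleTerm
  refine Measurable.mul (Measurable.mul ((measurable_coinFactor RI).comp measurable_fst) ?_)
    (measurable_relayFactor R RI s)
  fun_prop

section GoodWeight

variable {ρ R RI h b C : ℝ} {g : Plane × Plane × Plane → ℝ}

lemma GoodWeight.abs_le (hg : GoodWeight ρ R RI h b C g) (p) : |g p| ≤ C := by
  rw [abs_of_nonneg (hg.nonneg p)]; exact hg.le p

lemma GoodWeight.abs_tripleTerm_le (hg : GoodWeight ρ R RI h b C g) (s : Finset ℕ) (p ω) :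
    |tripleTerm R RI g s p ω| ≤ C := by
  have h1 := mul_le_of_le_one_left (hg.nonneg (p.1.1, p.2.1.1, p.2.2.1)) (coinFactor_le_one (RI := RI) p)
  have h2 : 0 ≤ coinFactor RI p * g (p.1.1, p.2.1.1, p.2.2.1) :=
    mul_nonneg (coinFactor_nonneg _) (hg.nonneg _)
  unfold tripleTerm
  rw [abs_of_nonneg (mul_nonneg h2 relayFactor_nonneg)]
  exact (mul_le_of_le_one_right h2 relayFactor_le_one).trans (h1.trans (hg.le _))

/-- The coin of the destination matters only if the destination is within `RI` of the relay. This
case distinction is avoided by sandwiching `coinFactor` between the indicator that only the sender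
is allowed to transmit and the indicator that the sender is. The bounds differ by (1-q)², again
harmless. The factor of the other nodes depends on the triple only through h and b, so it leaves the
integral. -/
lemma GoodWeight.integral_tripleTerm (hg : GoodWeight ρ R RI h b C g) (hρ : 0 < ρ)
    (q : unitInterval) {i d j : ℕ} {s : Finset ℕ} (hid : i ≠ d) (hij : i ≠ j) (hdj : d ≠ j)
    (hi : i ∉ s) (hd : d ∉ s) (hj : j ∉ s) (hq : (q : ℝ) < 1) (h0 : 0 < h)
    (hu : 0 ≤ 1 - q * b - h) :
    q * (1 - q) ^ 2 * (((1 - q * b) ^ (s.card + 1) - (1 - q * b - h) ^ (s.card + 1))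
        / ((s.card + 1) * h)) * (∫ x, ∫ y, ∫ z, g (x, y, z) ∂(unif ρ) ∂(unif ρ) ∂(unif ρ))
      ≤ ∫ ω, tripleTerm R RI g s (ω i, ω d, ω j) ω ∂(Measure.infinitePi fun _ : ℕ => nodeLaw ρ q) ∧
    ∫ ω, tripleTerm R RI g s (ω i, ω d, ω j) ω ∂(Measure.infinitePi fun _ : ℕ => nodeLaw ρ q)
      ≤ q * ((1 - q * b) ^ (s.card + 1) / ((s.card + 1) * ((1 - q) * h))) *
        (∫ x, ∫ y, ∫ z, g (x, y, z) ∂(unif ρ) ∂(unif ρ) ∂(unif ρ)) := by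
  classical
  have := isProbabilityMeasure_nodeLaw q hρ
  have := isProbabilityMeasure_cond_area hρ
  have hq0 : (0 : ℝ) ≤ q := q.2.1
  rw [integral_infinitePi_three (nodeLaw ρ q) hid hij hdj hi hd hj
    (measurable_tripleTerm R RI s hg.measurable) (hg.abs_tripleTerm_le s) ?_]
  swap
  · intro p ω ω' hω
    unfold tripleTerm relayFactor
    congr 2
    · congr 3
      exact congrArg Finset.card (Finset.filter_congr fun m hm => by rw [hω m hm])
    · congr 1
      exact propext (forall₂_congr fun m hm => by rw [hω m hm])
  set Klo := ((1 - q * b) ^ (s.card + 1) - (1 - q * b - h) ^ (s.card + 1)) / ((s.card + 1) * h)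
    with hKlo
  set Khi := (1 - q * b) ^ (s.card + 1) / ((s.card + 1) * ((1 - q) * h)) with hKhi
  set G := ∫ x, ∫ y, ∫ z, g (x, y, z) ∂(unif ρ) ∂(unif ρ) ∂(unif ρ)
  have hKlo0 : 0 ≤ Klo := by
    refine div_nonneg (sub_nonneg.2 (pow_le_pow_left₀ hu (by linarith) _)) (by positivity)
  have hK : ∀ p : (Plane × Bool) × (Plane × Bool) × (Plane × Bool),
      g (p.1.1, p.2.1.1, p.2.2.1) ≠ 0 →
      Klo ≤ ∫ ω, relayFactor R RI s p.1.1 p.2.1.1 p.2.2.1 ω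
        ∂(Measure.infinitePi fun _ : ℕ => nodeLaw ρ q) ∧
      ∫ ω, relayFactor R RI s p.1.1 p.2.1.1 p.2.2.1 ω
        ∂(Measure.infinitePi fun _ : ℕ => nodeLaw ρ q) ≤ Khi := fun p hp =>
    integral_inv_card_bounds q hρ s (measurableSet_halfDisk R _ _)
      Metric.isClosed_closedBall.measurableSet hq h0 (hg.halfDisk_real hp) (hg.ball_real hp) hu
  set α : Bool → ℝ := fun ε => if ε then 1 else 0 with hα
  set β : Bool → ℝ := fun ε => if ε then 0 else 1 with hβ
  set J : (Plane × Bool) × (Plane × Bool) × (Plane × Bool) → ℝ := fun p =>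
    ∫ ω, tripleTerm R RI g s p ω ∂(Measure.infinitePi fun _ : ℕ => nodeLaw ρ q) with hJ
  have hJe : ∀ p, J p = coinFactor RI p * g (p.1.1, p.2.1.1, p.2.2.1) *
      ∫ ω, relayFactor R RI s p.1.1 p.2.1.1 p.2.2.1 ω
        ∂(Measure.infinitePi fun _ : ℕ => nodeLaw ρ q) := fun p => by
    simp only [hJ, tripleTerm, integral_const_mul]
  have hJi : Integrable J ((nodeLaw ρ q).prod ((nodeLaw ρ q).prod (nodeLaw ρ q))) := by
    refine integrable_of_bounded (C := C) (measurable_tripleTerm R RI s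
      hg.measurable).stronglyMeasurable.integral_prod_right.measurable fun p => ?_
    simpa using norm_integral_le_of_norm_le_const (f := tripleTerm R RI g s p) (C := C)
      (μ := Measure.infinitePi fun _ : ℕ => nodeLaw ρ q) (ae_of_all _ (hg.abs_tripleTerm_le s p))
  have hprod : ∀ β' : Bool → ℝ, (∀ ε, 0 ≤ β' ε ∧ β' ε ≤ 1) → Integrable (fun p => α p.1.2 *
      (β' p.2.1.2 * (β' p.2.2.2 * g (p.1.1, p.2.1.1, p.2.2.1))))
      ((nodeLaw ρ q).prod ((nodeLaw ρ q).prod (nodeLaw ρ q))) := by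
    intro β' hβ'
    have hm1 : Measurable α := .of_discrete
    have hm2 : Measurable β' := .of_discrete
    have hm3 := hg.measurable
    refine integrable_of_bounded (C := 1 * (1 * (1 * C))) (by fun_prop) fun p => ?_
    simp only [abs_mul]
    have h1 : ∀ ε, |α ε| ≤ 1 := by rintro (_ | _) <;> simp [hα]
    have h2 : ∀ ε, |β' ε| ≤ 1 := fun ε => by rw [abs_of_nonneg (hβ' ε).1]; exact (hβ' ε).2
    gcongr
    exacts [h1 _, h2 _, h2 _, hg.abs_le _]
  constructor
  · calc _ = ∫ p, Klo * (α p.1.2 * (β p.2.1.2 * (β p.2.2.2 * g (p.1.1, p.2.1.1, p.2.2.1))))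
          ∂((nodeLaw ρ q).prod ((nodeLaw ρ q).prod (nodeLaw ρ q))) := by
          rw [integral_const_mul, integral_nodeLaw_three hρ q α β β hg.measurable hg.abs_le]
          simp [hα, hβ]; ring
      _ ≤ ∫ p, J p ∂((nodeLaw ρ q).prod ((nodeLaw ρ q).prod (nodeLaw ρ q))) := by
          refine integral_mono ((hprod β ?_).const_mul _) hJi fun p => ?_
          · rintro (_ | _) <;> simp [hβ]
          · dsimp only
            rw [hJe]
            by_cases hp : g (p.1.1, p.2.1.1, p.2.2.1) = 0
            · simp [hp]
            · have h1 := (hK p hp).1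
              have h2 : α p.1.2 * (β p.2.1.2 * β p.2.2.2) ≤ coinFactor RI p := by
                by_cases e1 : p.1.2 = true <;> by_cases e2 : p.2.1.2 = true <;>
                  by_cases e3 : p.2.2.2 = true <;>
                  simp [hα, hβ, coinFactor, e1, e2, e3]
                split_ifs <;> norm_num
              have h3 := hg.nonneg (p.1.1, p.2.1.1, p.2.2.1)
              have h4 : 0 ≤ α p.1.2 * (β p.2.1.2 * β p.2.2.2) := by
                simp only [hα, hβ]; split_ifs <;> norm_num
              calc _ = α p.1.2 * (β p.2.1.2 * β p.2.2.2) * g (p.1.1, p.2.1.1, p.2.2.1) * Klo := by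
                    ring
                _ ≤ _ := by
                  have h5 := mul_nonneg (coinFactor_nonneg (RI := RI) p) h3
                  gcongr
  · calc _ ≤ ∫ p, Khi * (α p.1.2 * ((fun _ : Bool => (1 : ℝ)) p.2.1.2 * ((fun _ => 1) p.2.2.2 *
            g (p.1.1, p.2.1.1, p.2.2.1))))
          ∂((nodeLaw ρ q).prod ((nodeLaw ρ q).prod (nodeLaw ρ q))) := by
          refine integral_mono hJi ((hprod (fun _ => 1) (by simp)).const_mul _) fun p => ?_
          refine (hJe p).trans_le ?_
          by_cases hp : g (p.1.1, p.2.1.1, p.2.2.1) = 0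
          · simp [hp]
          · obtain ⟨h0, h1⟩ := hK p hp
            have h2 : coinFactor RI p ≤ α p.1.2 := by
              by_cases e1 : p.1.2 = true
              · simpa [hα, e1] using coinFactor_le_one p
              · simp [hα, coinFactor, e1]
            have h3 := hg.nonneg (p.1.1, p.2.1.1, p.2.2.1)
            have h4 : 0 ≤ α p.1.2 := by simp only [hα]; split_ifs <;> norm_num
            calc _ ≤ α p.1.2 * g (p.1.1, p.2.1.1, p.2.2.1) * Khi := by
                  have := hKlo0.trans h0
                  gcongr
              _ = _ := by ring
      _ = _ := by
          rw [integral_const_mul,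
            integral_nodeLaw_three hρ q α (fun _ => 1) (fun _ => 1) hg.measurable hg.abs_le]
          simp [hα]; ring

/-- Where g does not vanish, the destination is out of range and the relay j lies in the half-disk.
The relays are then j and the nodes of `s` in the half-disk, and the destination is not among them.
Hence the averaging weight is the reciprocal of 1 + N with N independent of the triple's own
indices. -/
lemma GoodWeight.hopSum_eq (hg : GoodWeight ρ R RI h b C g) (hRI : 0 ≤ RI) (k : ℕ)
    (ω : ℕ → Plane × Bool) :
    hopSum R ((k, ω) : Network) (hopWeight RI g (k, ω))
      = ∑ i ∈ Finset.range k, (((Finset.range k).erase i).card : ℝ)⁻¹ *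
        ∑ d ∈ (Finset.range k).erase i, ∑ j ∈ ((Finset.range k).erase i).erase d,
          tripleTerm R RI g ((((Finset.range k).erase i).erase d).erase j) (ω i, ω d, ω j) ω := by
  classical
  unfold hopSum
  simp only [Network.nodes]
  refine Finset.sum_congr rfl fun i hi => ?_
  congr 1
  refine Finset.sum_congr rfl fun d hd => ?_
  rw [Finset.mul_sum]
  have hd' := Finset.mem_erase.1 hd
  set φ : Network := (k, ω) with hφ
  have hnodes : ∀ m, m ∈ φ.nodes ↔ m < k := fun m => Finset.mem_range
  -- The two index sets differ, but outside their intersection the terms vanish by the support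
  -- conditions on g.
  refine Finset.sum_congr_of_eq_on_inter ?_ ?_ ?_
  · intro j hj hjT
    have h1 : j ≠ i := ne_of_mem_relays hd'.1 hj
    have h2 : j ∈ φ.nodes := mem_nodes_of_mem_relays hd'.2 hj
    have h3 : j = d := by
      by_contra hne
      exact hjT (Finset.mem_erase.2 ⟨hne, Finset.mem_erase.2 ⟨h1, h2⟩⟩)
    have h4 : g (φ.loc i, φ.loc d, φ.loc j) = 0 := by
      by_contra hne
      have h5 := hg.lt_dist hne
      have h6 := (hg.mem_halfDisk hne).1
      rw [h3, dist_comm] at h6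
      linarith
    simp [hopWeight, h4]
  · intro j hjT hj
    have h1 := Finset.mem_erase.1 hjT
    have h2 := Finset.mem_erase.1 h1.2
    have h4 : g (φ.loc i, φ.loc d, φ.loc j) = 0 := by
      by_contra hne
      exact hj (mem_relays.2 (Or.inr ⟨not_le.2 (hg.lt_dist hne), ⟨h2.1, Finset.mem_range.1 h2.2⟩,
        hg.mem_halfDisk hne⟩))
    have h5 : g ((ω i).1, (ω d).1, (ω j).1) = 0 := h4
    simp [tripleTerm, h5]
  · intro j hj hjT
    have h1 := Finset.mem_erase.1 hjT
    have h2 := Finset.mem_erase.1 h1.2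
    by_cases hg0 : g (φ.loc i, φ.loc d, φ.loc j) = 0
    · have h5 : g ((ω i).1, (ω d).1, (ω j).1) = 0 := hg0
      simp [tripleTerm, hopWeight, h5, hg0]
    set s := (((Finset.range k).erase i).erase d).erase j with hs
    have hdist := hg.lt_dist hg0
    have hrel : relays R φ i d = insert j (s.filter fun m => (ω m).1 ∈
        halfDisk R (ω i).1 (ω d).1) := by
      ext m
      rw [mem_relays, Finset.mem_insert, Finset.mem_filter, hs]
      simp only [Finset.mem_erase, Finset.mem_range]
      constructor
      · rintro (⟨h, -⟩ | ⟨-, ⟨h3, h4⟩, h5⟩)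
        · exact absurd h (not_le.2 hdist)
        · by_cases hmj : m = j
          · exact Or.inl hmj
          · refine Or.inr ⟨⟨hmj, ?_, h3, h4⟩, h5⟩
            rintro rfl
            have := h5.1
            rw [dist_comm] at this
            linarith
      · rintro (rfl | ⟨⟨h3, h4, h5, h6⟩, h7⟩)
        · exact Or.inr ⟨not_le.2 hdist, ⟨h2.1, Finset.mem_range.1 h2.2⟩, hg.mem_halfDisk hg0⟩
        · exact Or.inr ⟨not_le.2 hdist, ⟨h5, h6⟩, h7⟩
    have hcard : ((relays R φ i d).card : ℝ) = 1 + ((s.filter fun m => (ω m).1 ∈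
        halfDisk R (ω i).1 (ω d).1).card : ℝ) := by
      rw [hrel, Finset.card_insert_of_notMem (by simp [hs])]
      push_cast; ring
    have hS : HopSuccess RI φ (alohaTransmitters φ) i j ↔
        ((ω i).2 = true ∧ (dist (ω d).1 (ω j).1 ≤ RI → ¬ (ω d).2 = true) ∧ ¬ (ω j).2 = true) ∧
        ∀ m ∈ s, (ω m).1 ∈ Metric.closedBall (ω j).1 RI → ¬ (ω m).2 = true := by
      have hT : ∀ m, m ∈ alohaTransmitters φ ↔ m < k ∧ (ω m).2 = true := fun m =>
        and_congr (hnodes m) Iff.rfl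
      unfold HopSuccess
      simp only [hT, hnodes]
      constructor
      · rintro ⟨⟨-, h3⟩, h4⟩
        have h5 : ∀ m, m < k → m ≠ i → dist (ω m).1 (ω j).1 ≤ RI → ¬ (ω m).2 = true :=
          fun m hm hmi hd hc => h4 m hm hmi hd ⟨hm, hc⟩
        refine ⟨⟨h3, h5 d (Finset.mem_range.1 hd'.2) hd'.1, h5 j (Finset.mem_range.1 h2.2) h2.1
          (by simpa using hRI)⟩, fun m hm hmB => ?_⟩
        simp only [hs, Finset.mem_erase, Finset.mem_range] at hm
        exact h5 m hm.2.2.2 hm.2.2.1 hmB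
      · rintro ⟨⟨h3, h4, h5⟩, h6⟩
        refine ⟨⟨Finset.mem_range.1 hi, h3⟩, fun m hm hmi hmd hmT => ?_⟩
        by_cases hmj : m = j
        · exact h5 (hmj ▸ hmT.2)
        by_cases hmd' : m = d
        · exact h4 (hmd' ▸ hmd) (hmd' ▸ hmT.2)
        refine h6 m ?_ hmd hmT.2
        simp only [hs, Finset.mem_erase, Finset.mem_range]
        exact ⟨hmj, hmd', hmi, hm⟩
    rw [hcard, hopWeight, tripleTerm, relayFactor, coinFactor]
    change _ * (if _ then g ((ω i).1, (ω d).1, (ω j).1) else 0) = _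
    simp only [hS]
    by_cases c1 : (ω i).2 = true ∧ (dist (ω d).1 (ω j).1 ≤ RI → ¬ (ω d).2 = true) ∧
        ¬ (ω j).2 = true
    · by_cases c2 : ∀ m ∈ s, (ω m).1 ∈ Metric.closedBall (ω j).1 RI → ¬ (ω m).2 = true
      · rw [if_pos ⟨c1, c2⟩, if_pos c1, if_pos c2]; ring
      · rw [if_neg fun h => c2 h.2, if_neg c2]; ring
    · rw [if_neg fun h => c1 h.1, if_neg c1]; ring

end GoodWeight

/-! ## Summation over the number of nodes -/

lemma abs_hopSum_le_mul {R : ℝ} {φ : Network} {w : ℕ → ℕ → ℕ → ℝ} {C : ℝ} (hC : 0 ≤ C)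
    (h : ∀ i d, d ≠ i → ∀ j ∈ relays R φ i d, |w i d j| ≤ C) : |hopSum R φ w| ≤ C * φ.1 :=
  (abs_hopSum_le (e := fun _ _ => C) (fun _ _ => hC)
    fun i _ d hd j hj => h i d (Finset.ne_of_mem_erase hd) j hj).trans
    (pairSum_le hC fun _ _ => le_rfl)

section GoodWeight

variable {ρ R RI h b C : ℝ} {g : Plane × Plane × Plane → ℝ}

lemma measurable_hopWeight (RI : ℝ) (hg : Measurable g) (i d j : ℕ) :
    Measurable fun φ : Network => hopWeight RI g φ i d j := by
  classical
  exact Measurable.ite (measurableSet_hopSuccess measurable_id RI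
    (fun k => measurableSet_alohaTransmitters measurable_id k) i j) (by fun_prop) measurable_const

lemma GoodWeight.abs_hopWeight_le (hg : GoodWeight ρ R RI h b C g) (φ : Network) (i d j : ℕ) :
    |hopWeight RI g φ i d j| ≤ C := by
  unfold hopWeight
  split_ifs
  · exact hg.abs_le _
  · simpa using (hg.nonneg 0).trans (hg.le 0)

lemma GoodWeight.integrable_hopSum (hg : GoodWeight ρ R RI h b C g) (hρ : 0 < ρ) (l : ℝ)
    (q : unitInterval) :
    Integrable (fun φ => hopSum R φ (hopWeight RI g φ)) (networkLaw ρ l q) :=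
  integrable_networkLaw q hρ l (measurable_hopSum measurable_id R
    fun i d j => measurable_hopWeight RI hg.measurable i d j) fun φ =>
    abs_hopSum_le_mul ((hg.nonneg 0).trans (hg.le 0)) fun i d _ j _ => hg.abs_hopWeight_le φ i d j

lemma triple_sum_bounds {k : ℕ} {lo hi : ℝ} {t : ℕ → ℕ → ℕ → ℝ} (hk : 3 ≤ k)
    (ht : ∀ i d j, i < k → d < k → j < k → i ≠ d → i ≠ j → d ≠ j → lo ≤ t i d j ∧ t i d j ≤ hi) :
    k * ((k - 2) * lo) ≤ ∑ i ∈ Finset.range k, (((Finset.range k).erase i).card : ℝ)⁻¹ *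
        ∑ d ∈ (Finset.range k).erase i, ∑ j ∈ ((Finset.range k).erase i).erase d, t i d j ∧
    ∑ i ∈ Finset.range k, (((Finset.range k).erase i).card : ℝ)⁻¹ *
        ∑ d ∈ (Finset.range k).erase i, ∑ j ∈ ((Finset.range k).erase i).erase d, t i d j
      ≤ k * ((k - 2) * hi) := by
  have hk' : (3 : ℝ) ≤ k := by exact_mod_cast hk
  have hk1 : (0 : ℝ) < k - 1 := by linarith
  have hcard : ∀ i ∈ Finset.range k, ∀ d ∈ (Finset.range k).erase i,
      ((((Finset.range k).erase i).erase d).card : ℝ) = k - 2 := by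
    intro i hi d hd
    rw [Finset.card_erase_of_mem hd, Finset.card_erase_of_mem hi, Finset.card_range,
      Nat.cast_sub (by omega), Nat.cast_sub (by omega)]
    push_cast; ring
  have hconst : ∀ c : ℝ, ∑ i ∈ Finset.range k, (((Finset.range k).erase i).card : ℝ)⁻¹ *
        ∑ d ∈ (Finset.range k).erase i, ∑ j ∈ ((Finset.range k).erase i).erase d, c
      = k * ((k - 2) * c) := by
    intro c
    have : ∀ i ∈ Finset.range k, (((Finset.range k).erase i).card : ℝ)⁻¹ *
        ∑ d ∈ (Finset.range k).erase i, ∑ j ∈ ((Finset.range k).erase i).erase d, c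
        = (k - 2) * c := by
      intro i hi
      have h1 : ∀ d ∈ (Finset.range k).erase i, ∑ j ∈ ((Finset.range k).erase i).erase d, c
          = (k - 2) * c := fun d hd => by
        rw [Finset.sum_const, nsmul_eq_mul, hcard i hi d hd]
      rw [Finset.sum_congr rfl h1, Finset.sum_const, nsmul_eq_mul, nodes_card_erase hi,
        inv_mul_cancel_left₀ hk1.ne']
    rw [Finset.sum_congr rfl this, Finset.sum_const, nsmul_eq_mul, Finset.card_range]
  have hmem : ∀ i ∈ Finset.range k, ∀ d ∈ (Finset.range k).erase i,
      ∀ j ∈ ((Finset.range k).erase i).erase d, lo ≤ t i d j ∧ t i d j ≤ hi := by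
    intro i hi d hd j hj
    simp only [Finset.mem_erase, Finset.mem_range] at hi hd hj
    exact ht i d j hi hd.2 hj.2.2 hd.1.symm hj.2.1.symm hj.1.symm
  constructor
  · rw [← hconst]
    exact Finset.sum_le_sum fun i hi => mul_le_mul_of_nonneg_left (Finset.sum_le_sum fun d hd =>
      Finset.sum_le_sum fun j hj => (hmem i hi d hd j hj).1) (by positivity)
  · rw [← hconst]
    exact Finset.sum_le_sum fun i hi => mul_le_mul_of_nonneg_left (Finset.sum_le_sum fun d hd =>
      Finset.sum_le_sum fun j hj => (hmem i hi d hd j hj).2) (by positivity)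

/-- The k - 2 choices of a relay cancel the denominator `s.card + 1` = k - 2 of the expected
reciprocal, so k times a power remains. Everything is brought to the form k·u^(k-1), whose Poisson
mean is explicit. -/
lemma GoodWeight.integral_hopSum_nat (hg : GoodWeight ρ R RI h b C g) (hρ : 0 < ρ) (hRI : 0 ≤ RI)
    (q : unitInterval) (hq : (q : ℝ) < 1) (h0 : 0 < h) (hb : 0 ≤ b) (hu : 0 < 1 - q * b - h) (k : ℕ) :
    q * (1 - q) ^ 2 / h * (∫ x, ∫ y, ∫ z, g (x, y, z) ∂(unif ρ) ∂(unif ρ) ∂(unif ρ)) *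
        (k * (1 - q * b) ^ (k - 1) - (1 - q * b - h)⁻¹ * (k * (1 - q * b - h) ^ (k - 1)))
      ≤ ∫ ω, hopSum R ((k, ω) : Network) (hopWeight RI g (k, ω))
        ∂(Measure.infinitePi fun _ : ℕ => nodeLaw ρ q) ∧
    ∫ ω, hopSum R ((k, ω) : Network) (hopWeight RI g (k, ω))
        ∂(Measure.infinitePi fun _ : ℕ => nodeLaw ρ q)
      ≤ q / ((1 - q) * h * (1 - q * b)) *
        (∫ x, ∫ y, ∫ z, g (x, y, z) ∂(unif ρ) ∂(unif ρ) ∂(unif ρ)) *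
        (k * (1 - q * b) ^ (k - 1)) := by
  have := isProbabilityMeasure_nodeLaw q hρ
  set G := ∫ x, ∫ y, ∫ z, g (x, y, z) ∂(unif ρ) ∂(unif ρ) ∂(unif ρ) with hG
  have hG0 : 0 ≤ G := integral_nonneg fun x => integral_nonneg fun y => integral_nonneg fun z =>
    hg.nonneg _
  have hq0 : (0 : ℝ) ≤ q := q.2.1
  have hq1 : (0 : ℝ) < 1 - q := by linarith
  set u := 1 - q * b with hu_def
  set v := u - h with hv_def
  have hu0 : 0 < u := by linarith
  have hu1 : u ≤ 1 := by have := mul_nonneg hq0 hb; linarith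
  have hv1 : v ≤ 1 := by linarith
  have hint : ∀ i d j s, Integrable (fun ω : ℕ → Plane × Bool =>
      tripleTerm R RI g s (ω i, ω d, ω j) ω) (Measure.infinitePi fun _ : ℕ => nodeLaw ρ q) :=
    fun i d j s => integrable_of_bounded ((measurable_tripleTerm R RI s hg.measurable).comp
      (by fun_prop : Measurable fun ω : ℕ → Plane × Bool => ((ω i, ω d, ω j), ω)))
      fun ω => hg.abs_tripleTerm_le s _ ω
  simp only [hg.hopSum_eq hRI]
  rw [integral_finsetSum _ fun i _ => Integrable.const_mul (integrable_finsetSum _ fun d _ =>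
    integrable_finsetSum _ fun j _ => hint _ _ _ _) _]
  simp only [integral_const_mul]
  have e1 : ∀ i ∈ Finset.range k, (((Finset.range k).erase i).card : ℝ)⁻¹ *
      ∫ ω : ℕ → Plane × Bool, ∑ d ∈ (Finset.range k).erase i,
        ∑ j ∈ ((Finset.range k).erase i).erase d,
        tripleTerm R RI g ((((Finset.range k).erase i).erase d).erase j) (ω i, ω d, ω j) ω
        ∂(Measure.infinitePi fun _ : ℕ => nodeLaw ρ q) =
      (((Finset.range k).erase i).card : ℝ)⁻¹ * ∑ d ∈ (Finset.range k).erase i,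
        ∑ j ∈ ((Finset.range k).erase i).erase d,
        ∫ ω : ℕ → Plane × Bool,
        tripleTerm R RI g ((((Finset.range k).erase i).erase d).erase j) (ω i, ω d, ω j) ω
        ∂(Measure.infinitePi fun _ : ℕ => nodeLaw ρ q) := by
    intro i _
    rw [integral_finsetSum _ fun d _ => integrable_finsetSum _ fun j _ => hint _ _ _ _]
    congr 1
    exact Finset.sum_congr rfl fun d _ => integral_finsetSum _ fun j _ => hint _ _ _ _
  rw [Finset.sum_congr rfl e1]
  have hc1 : 0 ≤ q * (1 - q) ^ 2 / h * G := by positivity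
  have hc2 : 0 ≤ q / ((1 - q) * h * u) * G := by positivity
  -- With fewer than three nodes there is no triple and the sum is 0. The lower bound is then
  -- nonpositive because u ≤ 1 ≤ v⁻¹.
  rcases le_or_gt 3 k with hk | hk
  · have hk' : (3 : ℝ) ≤ k := by exact_mod_cast hk
    obtain ⟨hlo, hhi⟩ := triple_sum_bounds
      (lo := q * (1 - q) ^ 2 * ((u ^ (k - 2) - v ^ (k - 2)) / ((k - 2) * h)) * G)
      (hi := q * (u ^ (k - 2) / ((k - 2) * ((1 - q) * h))) * G)
      (t := fun i d j => ∫ ω : ℕ → Plane × Bool,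
        tripleTerm R RI g ((((Finset.range k).erase i).erase d).erase j) (ω i, ω d, ω j) ω
        ∂(Measure.infinitePi fun _ : ℕ => nodeLaw ρ q)) hk (by
      intro i d j hi hd hj hid hij hdj
      have hcard : ((((Finset.range k).erase i).erase d).erase j).card + 1 = k - 2 := by
        rw [Finset.card_erase_of_mem, Finset.card_erase_of_mem, Finset.card_erase_of_mem,
          Finset.card_range]
        · omega
        all_goals simp [hi, hd, hj, hid.symm, hij.symm, hdj.symm]
      have hcard' : (((((Finset.range k).erase i).erase d).erase j).card : ℝ) + 1 = k - 2 := by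
        have := congrArg (Nat.cast : ℕ → ℝ) hcard
        rw [Nat.cast_sub (by omega)] at this
        simpa using this
      have := hg.integral_tripleTerm hρ q (s := (((Finset.range k).erase i).erase d).erase j)
        hid hij hdj (by simp) (by simp) (by simp) hq h0 hu.le
      rwa [hcard, hcard'] at this)
    have hk2 : (0 : ℝ) < k - 2 := by linarith
    obtain ⟨m, rfl⟩ : ∃ m, k = m + 2 := ⟨k - 2, by omega⟩
    simp only [Nat.add_sub_cancel, show m + 2 - 1 = m + 1 from rfl] at hlo hhi ⊢
    constructor
    · refine le_trans ?_ hlo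
      have e : ((m + 2 : ℕ) : ℝ) * ((((m + 2 : ℕ) : ℝ) - 2) * (q * (1 - q) ^ 2 *
          ((u ^ m - v ^ m) / ((((m + 2 : ℕ) : ℝ) - 2) * h)) * G))
          = q * (1 - q) ^ 2 / h * G * (((m + 2 : ℕ) : ℝ) * (u ^ m - v ^ m)) := by
        field_simp
      rw [e]
      refine mul_le_mul_of_nonneg_left ?_ hc1
      -- The exponent is k - 2 but k - 1 is wanted. For u it is raised at the cost of an inequality,
      -- for v it is compensated by the factor v⁻¹.
      have h1 : u ^ (m + 1) ≤ u ^ m := pow_le_pow_of_le_one hu0.le hu1 (by omega)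
      have h2 : v⁻¹ * (((m + 2 : ℕ) : ℝ) * v ^ (m + 1)) = ((m + 2 : ℕ) : ℝ) * v ^ m := by
        rw [pow_succ]; field_simp
      rw [h2, mul_sub]
      have := mul_le_mul_of_nonneg_left h1 (by positivity : (0 : ℝ) ≤ ((m + 2 : ℕ) : ℝ))
      linarith
    · refine hhi.trans (le_of_eq ?_)
      rw [pow_succ]
      field_simp
  · have hz : ∑ i ∈ Finset.range k, (((Finset.range k).erase i).card : ℝ)⁻¹ *
        ∑ d ∈ (Finset.range k).erase i, ∑ j ∈ ((Finset.range k).erase i).erase d,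
        ∫ ω : ℕ → Plane × Bool,
        tripleTerm R RI g ((((Finset.range k).erase i).erase d).erase j) (ω i, ω d, ω j) ω
        ∂(Measure.infinitePi fun _ : ℕ => nodeLaw ρ q) = 0 := by
      refine Finset.sum_eq_zero fun i hi => ?_
      rw [Finset.sum_eq_zero, mul_zero]
      intro d hd
      have : ((Finset.range k).erase i).erase d = ∅ := by
        rw [← Finset.card_eq_zero, Finset.card_erase_of_mem hd, Finset.card_erase_of_mem hi,
          Finset.card_range]
        omega
      rw [this, Finset.sum_empty]
    rw [hz]
    refine ⟨mul_nonpos_of_nonneg_of_nonpos hc1 ?_, mul_nonneg hc2 (by positivity)⟩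
    have hv : 1 ≤ v⁻¹ := (one_le_inv₀ hu).2 hv1
    interval_cases k
    · simp
    · simpa using hv
    · have : v⁻¹ * (2 * v) = 2 := by field_simp
      simp only [Nat.reduceSub, pow_one, Nat.cast_ofNat]
      linarith

lemma GoodWeight.integral_hopSum_bounds (hg : GoodWeight ρ R RI h b C g) (hρ : 0 < ρ)
    (hRI : 0 ≤ RI) {l : ℝ} (hl : 0 ≤ l) (q : unitInterval) (hq : (q : ℝ) < 1) (h0 : 0 < h)
    (hb : 0 ≤ b) (hu : 0 < 1 - q * b - h) {μ : ℝ} (hμ : μ = l * volume.real (area ρ)) :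
    q * (1 - q) ^ 2 / h * (∫ x, ∫ y, ∫ z, g (x, y, z) ∂(unif ρ) ∂(unif ρ) ∂(unif ρ)) *
        (μ * Real.exp (-(μ * (q * b))) -
          (1 - q * b - h)⁻¹ * (μ * Real.exp (-(μ * (q * b + h)))))
      ≤ ∫ φ, hopSum R φ (hopWeight RI g φ) ∂(networkLaw ρ l q) ∧
    ∫ φ, hopSum R φ (hopWeight RI g φ) ∂(networkLaw ρ l q)
      ≤ q / ((1 - q) * h * (1 - q * b)) *
        (∫ x, ∫ y, ∫ z, g (x, y, z) ∂(unif ρ) ∂(unif ρ) ∂(unif ρ)) *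
        (μ * Real.exp (-(μ * (q * b)))) := by
  have := isProbabilityMeasure_nodeLaw q hρ
  have hI := hg.integrable_hopSum hρ l q
  rw [integral_networkLaw q hρ l hI]
  have hr : ((l * volume.real (area ρ)).toNNReal : ℝ) = μ := by
    rw [hμ]; exact Real.coe_toNNReal _ (mul_nonneg hl measureReal_nonneg)
  have hint := hI
  unfold networkLaw at hint
  have hint := hint.integral_prod_left
  have hq0 : (0 : ℝ) ≤ q := q.2.1
  have hqb := mul_nonneg hq0 hb
  have hpow : ∀ u : ℝ, 0 ≤ u → u ≤ 1 → Integrable (fun k : ℕ => (k * u ^ (k - 1) : ℝ))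
      (poissonMeasure (l * volume.real (area ρ)).toNNReal) := fun u h1 h2 =>
    integrable_poisson_of_le (C := 1) fun k => by
      rw [abs_of_nonneg (by positivity), one_mul]
      exact mul_le_of_le_one_right (by positivity) (pow_le_one₀ h1 h2)
  have i1 := hpow (1 - q * b) (by linarith) (by linarith)
  have i2 := hpow (1 - q * b - h) hu.le (by linarith)
  have e1 := integral_poisson_mul_pow (l * volume.real (area ρ)).toNNReal (1 - q * b)
  have e2 := integral_poisson_mul_pow (l * volume.real (area ρ)).toNNReal (1 - q * b - h)
  rw [hr, show μ * (1 - (1 - q * b)) = μ * (q * b) by ring] at e1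
  rw [hr, show μ * (1 - (1 - q * b - h)) = μ * (q * b + h) by ring] at e2
  constructor
  · rw [← e1, ← e2, ← integral_const_mul _ (fun k : ℕ => (k * (1 - q * b - h) ^ (k - 1) : ℝ)),
      ← integral_sub i1 (i2.const_mul _), ← integral_const_mul]
    exact integral_mono ((i1.sub (i2.const_mul _)).const_mul _) hint fun k =>
      (hg.integral_hopSum_nat hρ hRI q hq h0 hb hu k).1
  · rw [← e1, ← integral_const_mul]
    exact integral_mono hint (i1.const_mul _) fun k =>
      (hg.integral_hopSum_nat hρ hRI q hq h0 hb hu k).2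

end GoodWeight

/-! ## Geometry of half-disks -/

/-- The integral of the absolute value of the first coordinate over the unit disk. -/
def kappa : ℝ := ∫ v in Metric.closedBall (0 : Plane) 1, |inner ℝ v (EuclideanSpace.single 0 1)|

lemma volume_inner_eq_zero {e : Plane} (he : e ≠ 0) :
    volume {v : Plane | inner ℝ v e = 0} = 0 := by
  have h := Measure.addHaar_submodule (volume : Measure Plane) (ℝ ∙ e)ᗮ (by
    intro h
    have : e ∈ (ℝ ∙ e)ᗮ := by rw [h]; trivial
    rw [Submodule.mem_orthogonal_singleton_iff_inner_right] at this
    exact he (inner_self_eq_zero.1 this))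
  convert! h using 2
  ext v
  rw [SetLike.mem_coe, Submodule.mem_orthogonal_singleton_iff_inner_left]
  rfl

/-- The integrand is nonnegative and vanishes only on a line, which is a null set. -/
lemma kappa_pos : 0 < kappa := by
  have he : (EuclideanSpace.single 0 1 : Plane) ≠ 0 := by simp
  have hcont : Continuous fun v : Plane => |inner ℝ v (EuclideanSpace.single 0 1 : Plane)| := by
    fun_prop
  refine (setIntegral_pos_iff_support_of_nonneg_ae (ae_of_all _ fun v => abs_nonneg _)
    (hcont.continuousOn.integrableOn_compact (isCompact_closedBall 0 1))).2 ?_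
  have h1 : 0 < volume (Metric.closedBall (0 : Plane) 1) := Metric.measure_closedBall_pos _ _ one_pos
  refine h1.trans_le ?_
  calc volume (Metric.closedBall (0 : Plane) 1)
      ≤ volume ((Function.support (fun v : Plane =>
          |inner ℝ v (EuclideanSpace.single 0 1 : Plane)|) ∩ Metric.closedBall 0 1) ∪
          {v : Plane | inner ℝ v (EuclideanSpace.single 0 1 : Plane) = 0}) := by
        refine measure_mono fun v hv => ?_
        by_cases h : inner ℝ v (EuclideanSpace.single 0 1 : Plane) = 0
        · exact Or.inr h
        · exact Or.inl ⟨by simpa using h, hv⟩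
    _ ≤ _ := by
        refine (measure_union_le _ _).trans ?_
        rw [volume_inner_eq_zero he, add_zero]

/-- Rotation invariance: the reflection in the line orthogonal to the difference of two unit vectors
exchanges them and preserves both the disk and Lebesgue measure. -/
lemma setIntegral_abs_inner_of_norm_eq_one {e : Plane} (he : ‖e‖ = 1) :
    ∫ v in Metric.closedBall (0 : Plane) 1, |inner ℝ v e| = kappa := by
  have hn : ‖e‖ = ‖(EuclideanSpace.single 0 1 : Plane)‖ := by simp [he]
  set T := Submodule.reflection (ℝ ∙ (e - (EuclideanSpace.single 0 1 : Plane)))ᗮ with hT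
  have hTe : T e = EuclideanSpace.single 0 1 := Submodule.reflection_sub hn
  have h := (T.measurePreserving).setIntegral_preimage_emb
    T.toHomeomorph.measurableEmbedding
    (fun v => |inner ℝ v (EuclideanSpace.single 0 1 : Plane)|) (Metric.closedBall 0 1)
  rw [LinearIsometryEquiv.preimage_closedBall, map_zero] at h
  rw [kappa, ← h, ← hTe]
  simp only [LinearIsometryEquiv.inner_map_map]

/-- Scaling: R² comes from the area element, one further R and ‖e‖ from homogeneity of the
integrand. -/
lemma setIntegral_abs_inner {e : Plane} (he : e ≠ 0) {R : ℝ} (hR : 0 < R) :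
    ∫ v in Metric.closedBall (0 : Plane) R, |inner ℝ v e| = R ^ 3 * ‖e‖ * kappa := by
  have hn : ‖e‖ ≠ 0 := norm_ne_zero_iff.2 he
  have h1 := setIntegral_abs_inner_of_norm_eq_one (e := ‖e‖⁻¹ • e) (by
    rw [norm_smul, norm_inv, norm_norm, inv_mul_cancel₀ hn])
  have h2 := Measure.setIntegral_comp_smul_of_pos (volume : Measure Plane)
    (fun v => |inner ℝ v e|) (Metric.closedBall 0 1) hR
  simp only [inner_smul_left, inner_smul_right, abs_mul, integral_const_mul, abs_inv, abs_norm] at h1 h2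
  rw [smul_unitClosedBall_of_nonneg hR.le] at h2
  simp only [conj_trivial, finrank_euclideanSpace, Fintype.card_fin, smul_eq_mul, abs_of_pos hR] at h2
  rw [eq_inv_mul_iff_mul_eq₀ (by positivity)] at h2
  rw [← h2, ← h1]
  field_simp

/-- The half-disk and its mirror image through the centre cover the disk and meet in a subset of a
line. An even integrand has the same integral over both. -/
lemma setIntegral_halfDisk (R : ℝ) {x y : Plane} (hxy : x ≠ y) {F : Plane → ℝ}
    (hF : Continuous F) (heven : ∀ v, F (-v) = F v) :
    ∫ z in halfDisk R x y, F (z - x) = (∫ v in Metric.closedBall (0 : Plane) R, F v) / 2 := by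
  set e := y - x with he_def
  have he : e ≠ 0 := sub_ne_zero.2 hxy.symm
  set S : Set Plane := Metric.closedBall 0 R ∩ {v | 0 ≤ inner ℝ v e} with hS
  set S' : Set Plane := Metric.closedBall 0 R ∩ {v | inner ℝ v e ≤ 0} with hS'
  have hSc : IsClosed S := Metric.isClosed_closedBall.inter (isClosed_le (by fun_prop) (by fun_prop))
  have hSc' : IsClosed S' :=
    Metric.isClosed_closedBall.inter (isClosed_le (by fun_prop) (by fun_prop))
  have hint : IntegrableOn F (Metric.closedBall 0 R) :=
    hF.continuousOn.integrableOn_compact (isCompact_closedBall 0 R)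
  have h1 : ∫ z in halfDisk R x y, F (z - x) = ∫ v in S, F v := by
    have h := (measurePreserving_sub_right (volume : Measure Plane) x).setIntegral_preimage_emb
      (Homeomorph.subRight x).measurableEmbedding F S
    rw [← h]
    congr 2
    ext z
    simp [halfDisk, hS, dist_eq_norm, he_def]
  have h2 : ∫ v in S', F v = ∫ v in S, F v := by
    have h := (Measure.measurePreserving_neg (volume : Measure Plane)).setIntegral_preimage_emb
      (Homeomorph.neg Plane).measurableEmbedding F S
    rw [← h]
    simp only [heven]
    congr 2
    ext z
    simp [hS, hS']
  have h3 : S ∪ S' = Metric.closedBall 0 R := by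
    rw [hS, hS', ← Set.inter_union_distrib_left, Set.inter_eq_left]
    intro v _
    exact le_total 0 (inner ℝ v e)
  have h4 : AEDisjoint volume S S' := by
    refine measure_mono_null ?_ (volume_inner_eq_zero he)
    rintro v ⟨⟨-, h⟩, ⟨-, h'⟩⟩
    exact le_antisymm h' h
  have h5 := setIntegral_union₀ h4 hSc'.measurableSet.nullMeasurableSet
    (hint.mono_set Set.inter_subset_left) (hint.mono_set Set.inter_subset_left)
  rw [h3, h2, ← h1] at h5
  linarith

lemma volume_real_halfDisk {R : ℝ} (hR : 0 ≤ R) {x y : Plane} (hxy : x ≠ y) :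
    volume.real (halfDisk R x y) = Real.pi * R ^ 2 / 2 := by
  have h := setIntegral_halfDisk R hxy (F := fun _ => 1) continuous_const fun _ => rfl
  simpa [volume_real_closedBall 0 hR] using h

lemma setIntegral_halfDisk_inner {R : ℝ} (hR : 0 < R) {x y : Plane} (hxy : x ≠ y) :
    ∫ z in halfDisk R x y, inner ℝ (z - x) (y - x) = R ^ 3 * dist x y * kappa / 2 := by
  have h := setIntegral_halfDisk R hxy (F := fun v => |inner ℝ v (y - x)|) (by fun_prop)
    fun v => by simp
  rw [setIntegral_abs_inner (sub_ne_zero.2 hxy.symm) hR] at h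
  rw [dist_comm, dist_eq_norm, ← h]
  refine setIntegral_congr_fun (measurableSet_halfDisk R x y) fun z hz => ?_
  exact (abs_of_nonneg hz.2).symm

/-- To first order the progress is the projection of the hop on the direction of the destination.
The law of cosines bounds the error by the squared hop length over the distance. -/
lemma abs_progress_sub_le {R : ℝ} {x y z : Plane} (hxy : 0 < dist x y) (hz : dist z x ≤ R) :
    |dist x y - dist z y - inner ℝ (z - x) (y - x) / dist x y| ≤ 2 * R ^ 2 / dist x y := by
  set D := dist x y with hD
  set E := dist z y with hE
  set t := inner ℝ (z - x) (y - x) with ht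
  have hE0 : 0 ≤ E := dist_nonneg
  have hR : 0 ≤ R := dist_nonneg.trans hz
  have hsq : E ^ 2 = D ^ 2 - 2 * t + dist z x ^ 2 := by
    have h := norm_sub_sq_real (z - x) (y - x)
    rw [sub_sub_sub_cancel_right, ← dist_eq_norm, ← dist_eq_norm, ← dist_eq_norm, dist_comm y x] at h
    rw [hE, h, ← ht, ← hD]; ring
  have htb : |t| ≤ R * D := by
    refine (abs_real_inner_le_norm _ _).trans ?_
    rw [← dist_eq_norm, ← dist_eq_norm, dist_comm y x]
    exact mul_le_mul_of_nonneg_right hz hxy.le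
  have hDE : |D - E| ≤ R := by
    rw [dist_comm] at hz
    exact (abs_dist_sub_le x z y).trans hz
  -- From E² = D² - 2t + |z - x|², after factoring D² - E² = (D - E)(D + E). Each of the two terms
  -- of the numerator is at most R², and the denominator is at least D.
  have key : (D - E - t / D) = ((t / D) * (D - E) - dist z x ^ 2) / (D + E) := by
    field_simp
    nlinarith
  rw [key, abs_div, abs_of_pos (by positivity : 0 < D + E)]
  have htD : |t / D| ≤ R := by
    rw [abs_div, abs_of_pos hxy, div_le_iff₀ hxy]; exact htb
  have hnum : |t / D * (D - E) - dist z x ^ 2| ≤ 2 * R ^ 2 := by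
    refine (abs_sub _ _).trans ?_
    rw [abs_mul, abs_of_nonneg (sq_nonneg (dist z x))]
    have h1 : |t / D| * |D - E| ≤ R * R := mul_le_mul htD hDE (abs_nonneg _) hR
    have h2 : dist z x ^ 2 ≤ R ^ 2 := pow_le_pow_left₀ dist_nonneg hz 2
    nlinarith
  exact div_le_div₀ (by positivity) hnum hxy (by linarith)

/-! ## The uniform law on the area -/

section Unif

variable {ρ : ℝ}

lemma integral_unif (hρ : 0 < ρ) (f : Plane → ℝ) :
    ∫ z, f z ∂(unif ρ) = (Real.pi * ρ ^ 2)⁻¹ * ∫ z in area ρ, f z := by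
  rw [← volume_real_area hρ, unif, ProbabilityTheory.cond, integral_smul_measure, ENNReal.toReal_inv]
  rfl

lemma unif_real_of_subset (hρ : 0 < ρ) {s : Set Plane} (hs : s ⊆ area ρ) :
    (unif ρ).real s = (Real.pi * ρ ^ 2)⁻¹ * volume.real s := by
  rw [cond_area_real, volume_real_area hρ, Set.inter_eq_right.2 hs]

lemma closedBall_subset_area {z : Plane} {r : ℝ} (hz : ‖z‖ ≤ ρ - r) :
    Metric.closedBall z r ⊆ area ρ :=
  Metric.closedBall_subset_closedBall' (by rw [dist_zero_right]; linarith)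

lemma unif_real_closedBall (hρ : 0 < ρ) {z : Plane} {r : ℝ} (hr : 0 ≤ r) (hz : ‖z‖ ≤ ρ - r) :
    (unif ρ).real (Metric.closedBall z r) = r ^ 2 / ρ ^ 2 := by
  rw [unif_real_of_subset hρ (closedBall_subset_area hz), volume_real_closedBall z hr]
  have := Real.pi_pos
  field_simp

lemma unif_real_closedBall_le (hρ : 0 < ρ) (z : Plane) {r : ℝ} (hr : 0 ≤ r) :
    (unif ρ).real (Metric.closedBall z r) ≤ r ^ 2 / ρ ^ 2 := by
  rw [cond_area_real, volume_real_area hρ]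
  calc _ ≤ (Real.pi * ρ ^ 2)⁻¹ * volume.real (Metric.closedBall z r) := by
        refine mul_le_mul_of_nonneg_left ?_ (by positivity)
        exact measureReal_mono Set.inter_subset_right measure_closedBall_lt_top.ne
    _ = _ := by
        rw [volume_real_closedBall z hr]
        have := Real.pi_pos
        field_simp

lemma unif_real_norm_gt_le (hρ : 0 < ρ) {s : ℝ} (hs : s ≤ ρ) :
    (unif ρ).real {x | s < ‖x‖} ≤ 2 * (ρ - s) / ρ := by
  have := isProbabilityMeasure_cond_area hρ
  rcases le_or_gt s 0 with h0 | h0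
  · refine measureReal_le_one.trans ?_
    rw [le_div_iff₀ hρ]; linarith
  have hcompl : {x : Plane | s < ‖x‖} = (Metric.closedBall 0 s)ᶜ := by
    ext x; simp
  rw [hcompl, measureReal_compl Metric.isClosed_closedBall.measurableSet, probReal_univ,
    unif_real_closedBall hρ h0.le (by simpa using hs)]
  rw [sub_le_iff_le_add, ← sub_nonneg]
  -- The bound exceeds the exact measure 1 - s²/ρ² of the boundary strip by a perfect square.
  have : 2 * (ρ - s) / ρ + s ^ 2 / ρ ^ 2 - 1 = ((ρ - s) / ρ) ^ 2 := by field_simp; ring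
  rw [this]; positivity

lemma integral_nodeLaw_pair (hρ : 0 < ρ) (q : unitInterval) {E : Plane × Plane → ℝ}
    (hE : Measurable E) {C : ℝ} (hC : ∀ p, |E p| ≤ C) :
    ∫ p : (Plane × Bool) × (Plane × Bool), (if p.1.2 = true then 1 else 0) * E (p.1.1, p.2.1)
      ∂((nodeLaw ρ q).prod (nodeLaw ρ q)) = q * ∫ p, E p ∂((unif ρ).prod (unif ρ)) := by
  have := isProbabilityMeasure_nodeLaw q hρ
  have := isProbabilityMeasure_cond_area hρ
  have hα : Measurable fun ε : Bool => (if ε = true then 1 else 0 : ℝ) := .of_discrete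
  have hm : Measurable fun p : (Plane × Bool) × (Plane × Bool) =>
      (if p.1.2 = true then 1 else 0) * E (p.1.1, p.2.1) :=
    (hα.comp (by fun_prop : Measurable fun p : (Plane × Bool) × (Plane × Bool) => p.1.2)).mul
      (hE.comp (by fun_prop))
  rw [integral_prod _ (integrable_of_bounded hm (C := C) fun p => ?_),
    integral_prod _ (integrable_of_bounded hE hC)]
  · have h1 : ∀ a : Plane × Bool, ∫ b : Plane × Bool, (if a.2 = true then 1 else 0) * E (a.1, b.1)
        ∂(nodeLaw ρ q) = (if a.2 = true then 1 else 0) * ∫ y, E (a.1, y) ∂(unif ρ) := by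
      intro a
      rw [integral_const_mul]
      have := integral_nodeLaw_mul hρ q (fun _ => 1) fun y => E (a.1, y)
      simp only [one_mul, mul_one] at this
      rw [this]; ring
    simp only [h1]
    rw [integral_nodeLaw_mul hρ q (fun ε => if ε = true then 1 else 0)
      fun x => ∫ y, E (x, y) ∂(unif ρ)]
    simp
  · have := (abs_nonneg _).trans (hC (p.1.1, p.2.1))
    split_ifs
    · simpa using hC _
    · simpa using this

end Unif

/-- A general error estimate for weights that vanish unless the sender is allowed to transmit. The
factor q is what makes it useful: the throughput itself is of order l·q·R, so an error bound without
q would be worthless as q → 0. -/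
lemma abs_integral_hopSum_le {ρ : ℝ} (hρ : 0 < ρ) {l : ℝ} (hl : 0 ≤ l) (q : unitInterval) (R : ℝ)
    {w : Network → ℕ → ℕ → ℕ → ℝ} {E : Plane × Plane → ℝ} (hE : Measurable E) (hE0 : ∀ p, 0 ≤ E p)
    {C : ℝ} (hC : ∀ p, E p ≤ C)
    (h0 : ∀ φ : Network, ∀ i d j, i ∈ φ.nodes → ¬ φ.coin i → w φ i d j = 0)
    (hw : ∀ φ : Network, ∀ i d j, i ∈ φ.nodes → d ∈ φ.nodes → d ≠ i → j ∈ relays R φ i d →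
      |w φ i d j| ≤ E (φ.loc i, φ.loc d)) :
    |∫ φ, hopSum R φ (w φ) ∂(networkLaw ρ l q)|
      ≤ l * volume.real (area ρ) * (q * ∫ p, E p ∂((unif ρ).prod (unif ρ))) := by
  have hα : Measurable fun ε : Bool => (if ε = true then 1 else 0 : ℝ) := .of_discrete
  have hEC : ∀ p, |E p| ≤ C := fun p => by rw [abs_of_nonneg (hE0 p)]; exact hC p
  set e : (Plane × Bool) × (Plane × Bool) → ℝ := fun p =>
    (if p.1.2 = true then 1 else 0) * E (p.1.1, p.2.1) with he_def
  have he : Measurable e :=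
    (hα.comp (by fun_prop : Measurable fun p : (Plane × Bool) × (Plane × Bool) => p.1.2)).mul
      (hE.comp (by fun_prop))
  have he0 : ∀ p, 0 ≤ e p := fun p => mul_nonneg (by split_ifs <;> norm_num) (hE0 _)
  have heC : ∀ p, e p ≤ C := fun p => by
    refine (mul_le_of_le_one_left (hE0 _) ?_).trans (hC _)
    split_ifs <;> norm_num
  rw [← integral_nodeLaw_pair hρ q hE hEC]
  refine le_trans ?_ (integral_pairSum_le hρ hl q he he0 heC)
  have hint : Integrable (fun φ : Network => pairSum φ (fun i d => e (φ.2 i, φ.2 d)))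
      (networkLaw ρ l q) := by
    refine integrable_networkLaw q hρ l (measurable_pairSum measurable_id fun i d => by fun_prop)
      (C := C) fun φ => ?_
    rw [abs_of_nonneg (pairSum_nonneg fun i d => he0 _)]
    exact pairSum_le ((he0 ((0, true), (0, true))).trans (heC _)) fun i d => heC _
  refine (abs_integral_le_integral_abs).trans (integral_mono_of_nonneg
    (ae_of_all _ fun φ => abs_nonneg _) hint (ae_of_all _ fun φ => ?_))
  refine abs_hopSum_le (fun i d => he0 _) fun i hi d hd j hj => ?_
  by_cases hc : φ.coin i
  · have hc' : (φ.2 i).2 = true := hc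
    have h := hw φ i d j hi (Finset.mem_of_mem_erase hd) (Finset.ne_of_mem_erase hd) hj
    simp only [hc', if_true, one_mul]
    exact h
  · rw [h0 φ i d j hi hc, abs_zero]
    exact he0 _

/-! ## Forward progress of hops in the bulk -/

/-- The node is far from the boundary and the destination is far from the node. -/
def GoodPair (ρ R RI : ℝ) (p : Plane × Plane) : Prop :=
  ‖p.1‖ ≤ ρ - R - RI ∧ √R < dist p.1 p.2

open scoped Classical in
/-- The length of the projection of a hop to the direction of the destination. -/
def forwardProgress (ρ R RI : ℝ) (p : Plane × Plane × Plane) : ℝ :=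
  if GoodPair ρ R RI (p.1, p.2.1) ∧ p.2.2 ∈ halfDisk R p.1 p.2.1 then
    inner ℝ (p.2.2 - p.1) (p.2.1 - p.1) / dist p.1 p.2.1 else 0

section Forward

variable {ρ R RI : ℝ}

lemma measurableSet_goodPair (ρ R RI : ℝ) : MeasurableSet {p | GoodPair ρ R RI p} := by
  have h1 : MeasurableSet {p : Plane × Plane | ‖p.1‖ ≤ ρ - R - RI} :=
    measurableSet_le (by fun_prop) measurable_const
  have h2 : MeasurableSet {p : Plane × Plane | √R < dist p.1 p.2} :=
    measurableSet_lt measurable_const (by fun_prop)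
  exact h1.inter h2

lemma halfDisk_subset_closedBall (R : ℝ) (x y : Plane) :
    halfDisk R x y ⊆ Metric.closedBall x R := fun _ hz => hz.1

/-- The margin R + RI to the boundary keeps both the half-disk of the node and the interference disk
of its relay inside the area, so their uniform probabilities h and b are exact constants. -/
lemma goodWeight_forwardProgress (hρ : 0 < ρ) (hR : 0 < R) (hR1 : R ≤ 1) (hRI : R ≤ RI) :
    GoodWeight ρ R RI (R ^ 2 / (2 * ρ ^ 2)) (RI ^ 2 / ρ ^ 2) R (forwardProgress ρ R RI) := by
  -- Since R ≤ 1, a distance above √R also exceeds the transmission range, and the destination is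
  -- not reached in one hop.
  have hsq : R ≤ √R := Real.le_sqrt_of_sq_le (by nlinarith)
  have key : ∀ {x y z}, forwardProgress ρ R RI (x, y, z) ≠ 0 →
      GoodPair ρ R RI (x, y) ∧ z ∈ halfDisk R x y := fun h => by
    by_contra h'
    exact h (if_neg h')
  have hdist : ∀ {x y}, GoodPair ρ R RI (x, y) → R < dist x y := fun h => hsq.trans_lt h.2
  refine ⟨?_, ?_, ?_, fun h => hdist (key h).1, fun h => (key h).2, ?_, ?_⟩
  · unfold forwardProgress
    refine Measurable.ite (MeasurableSet.inter ?_ (measurableSet_mem_halfDisk R)) ?_ measurable_const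
    · exact (by fun_prop : Measurable fun p : Plane × Plane × Plane => (p.1, p.2.1))
        (measurableSet_goodPair ρ R RI)
    · fun_prop
  · rintro ⟨x, y, z⟩
    unfold forwardProgress
    split_ifs with h
    · exact div_nonneg h.2.2 dist_nonneg
    · exact le_rfl
  · rintro ⟨x, y, z⟩
    unfold forwardProgress
    split_ifs with h
    · have h1 := hdist h.1
      have h2 : 0 < dist x y := hR.trans h1
      rw [div_le_iff₀ h2]
      refine (real_inner_le_norm _ _).trans ?_
      rw [← dist_eq_norm, ← dist_eq_norm, dist_comm y x]
      exact mul_le_mul_of_nonneg_right h.2.1 h2.le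
    · exact hR.le
  · intro x y z h
    have h1 := (key h).1
    have hne : x ≠ y := dist_pos.1 (hR.trans (hdist h1))
    rw [unif_real_of_subset hρ ((halfDisk_subset_closedBall R x y).trans
      (closedBall_subset_area (by have := h1.1; dsimp only at this; linarith))),
      volume_real_halfDisk hR.le hne]
    have := Real.pi_pos
    field_simp
  · intro x y z h
    have h1 := (key h).1.1
    have h2 := (key h).2.1
    dsimp only at h1
    refine unif_real_closedBall hρ (hR.le.trans hRI) ?_
    have h3 : ‖z‖ ≤ ‖x‖ + dist z x := by
      rw [dist_eq_norm]
      calc ‖z‖ = ‖x + (z - x)‖ := by congr 1; abel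
        _ ≤ _ := norm_add_le _ _
    linarith

/-- For a good pair the relay integral is the first moment of a full half-disk, which does not
depend on the pair. Only the probability of a good pair is left. -/
lemma integral_forwardProgress (hρ : 0 < ρ) (hR : 0 < R) (hR1 : R ≤ 1) (hRI : R ≤ RI) :
    ∫ x, ∫ y, ∫ z, forwardProgress ρ R RI (x, y, z) ∂(unif ρ) ∂(unif ρ) ∂(unif ρ)
      = R ^ 3 * kappa / (2 * Real.pi * ρ ^ 2) *
        ((unif ρ).prod (unif ρ)).real {p | GoodPair ρ R RI p} := by
  classical
  have := isProbabilityMeasure_cond_area hρ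
  have hsq : R ≤ √R := Real.le_sqrt_of_sq_le (by nlinarith)
  have h1 : ∀ x y, ∫ z, forwardProgress ρ R RI (x, y, z) ∂(unif ρ)
      = R ^ 3 * kappa / (2 * Real.pi * ρ ^ 2) *
        {p | GoodPair ρ R RI p}.indicator 1 (x, y) := by
    intro x y
    by_cases hg : GoodPair ρ R RI (x, y)
    · have h2 : 0 < dist x y := (Real.sqrt_nonneg R).trans_lt hg.2
      have h3 : halfDisk R x y ⊆ area ρ := (halfDisk_subset_closedBall R x y).trans
        (closedBall_subset_area (by have := hg.1; dsimp only at this; linarith))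
      have h4 : ∀ z, forwardProgress ρ R RI (x, y, z) =
          (halfDisk R x y).indicator (fun z => inner ℝ (z - x) (y - x) / dist x y) z := by
        intro z
        simp [forwardProgress, hg, Set.indicator_apply]
      simp only [h4]
      rw [integral_unif hρ, setIntegral_indicator (measurableSet_halfDisk R x y),
        Set.inter_eq_right.2 h3, integral_div, setIntegral_halfDisk_inner hR (dist_pos.1 h2),
        Set.indicator_of_mem (by exact hg)]
      have := Real.pi_pos
      simp only [Pi.one_apply]
      field_simp
    · have h4 : ∀ z, forwardProgress ρ R RI (x, y, z) = 0 := fun z => if_neg fun h => hg h.1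
      rw [Set.indicator_of_notMem (by exact hg)]
      simp [h4]
  simp only [h1]
  have h5 : Integrable ({p | GoodPair ρ R RI p}.indicator (1 : Plane × Plane → ℝ))
      ((unif ρ).prod (unif ρ)) :=
    (integrable_const (1 : ℝ)).indicator (measurableSet_goodPair ρ R RI)
  rw [← integral_prod (fun p : Plane × Plane => R ^ 3 * kappa / (2 * Real.pi * ρ ^ 2) *
    {p | GoodPair ρ R RI p}.indicator 1 (p.1, p.2)) (h5.const_mul _), integral_const_mul]
  congr 1
  exact integral_indicator_one (measurableSet_goodPair ρ R RI)

/-- A bad pair has its node in a boundary strip of width R + RI or its destination in a disk of area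
πR. The threshold √R balances this against the projection error 2R²/dist ≤ 2R√R = o(R) of good
pairs. -/
lemma prod_real_not_goodPair_le (hρ : 0 < ρ) (hR : 0 ≤ R) (hRI : 0 ≤ RI) :
    ((unif ρ).prod (unif ρ)).real {p | ¬ GoodPair ρ R RI p} ≤ 2 * (R + RI) / ρ + R / ρ ^ 2 := by
  have := isProbabilityMeasure_cond_area hρ
  have hsub : {p : Plane × Plane | ¬ GoodPair ρ R RI p} ⊆
      ({x | ρ - R - RI < ‖x‖} ×ˢ Set.univ) ∪ {p | dist p.1 p.2 ≤ √R} := by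
    rintro ⟨x, y⟩ h
    by_cases h1 : ‖x‖ ≤ ρ - R - RI
    · exact Or.inr (not_lt.1 fun h2 => h ⟨h1, h2⟩)
    · exact Or.inl ⟨not_le.1 h1, trivial⟩
  refine (measureReal_mono hsub).trans ((measureReal_union_le _ _).trans (add_le_add ?_ ?_))
  · rw [measureReal_prod_prod, probReal_univ, mul_one]
    have := unif_real_norm_gt_le hρ (s := ρ - R - RI) (by linarith)
    rwa [show ρ - (ρ - R - RI) = R + RI by ring] at this
  · have hm : MeasurableSet {p : Plane × Plane | dist p.1 p.2 ≤ √R} :=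
      measurableSet_le (by fun_prop) measurable_const
    rw [measureReal_def, Measure.prod_apply hm]
    have h1 : ∀ x, (unif ρ) (Prod.mk x ⁻¹' {p : Plane × Plane | dist p.1 p.2 ≤ √R})
        ≤ ENNReal.ofReal (R / ρ ^ 2) := by
      intro x
      have h2 : Prod.mk x ⁻¹' {p : Plane × Plane | dist p.1 p.2 ≤ √R} =
          Metric.closedBall x (√R) := by
        ext y; simp [dist_comm]
      rw [h2, ← ofReal_measureReal]
      refine ENNReal.ofReal_le_ofReal ?_
      have := unif_real_closedBall_le hρ x (Real.sqrt_nonneg R)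
      rwa [Real.sq_sqrt hR] at this
    refine ENNReal.toReal_le_of_le_ofReal (by positivity) ((lintegral_mono h1).trans ?_)
    simp

end Forward

/-! ## Throughput of a single network -/

/-- The throughput of a network without primary network. -/
def aloneThroughput (ρ l R RI : ℝ) (q : unitInterval) : ℝ :=
  ∫ φ, totalProgress R φ (HopSuccess RI φ (alohaTransmitters φ)) ∂(networkLaw ρ l q)

open scoped Classical in
/-- The progress of a hop, if it is successful. -/
def successProgress (S : ℕ → ℕ → Prop) (φ : Network) (i d j : ℕ) : ℝ :=
  if S i j then progress φ i d j else 0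

lemma totalProgress_eq (R : ℝ) (φ : Network) (S : ℕ → ℕ → Prop) :
    totalProgress R φ S = hopSum R φ (successProgress S φ) := rfl

lemma abs_successProgress_le {R : ℝ} (hR : 0 ≤ R) (S : ℕ → ℕ → Prop) {φ : Network} {i d j : ℕ}
    (h : j ∈ relays R φ i d) : |successProgress S φ i d j| ≤ R := by
  unfold successProgress
  split_ifs
  · exact abs_progress_le h
  · simpa using hR

lemma abs_totalProgress_le {R : ℝ} (hR : 0 ≤ R) (φ : Network) (S : ℕ → ℕ → Prop) :
    |totalProgress R φ S| ≤ R * φ.1 :=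
  abs_hopSum_le_mul hR fun _ _ _ _ hj => abs_successProgress_le hR S hj

lemma measurable_totalProgress {Ω : Type*} [MeasurableSpace Ω] {f : Ω → Network}
    (hf : Measurable f) (R : ℝ) {S : Ω → ℕ → ℕ → Prop}
    (hS : ∀ i j, MeasurableSet {ω | S ω i j}) :
    Measurable fun ω => totalProgress R (f ω) (S ω) := by
  classical
  exact measurable_hopSum hf R fun i d j =>
    Measurable.ite (hS i j) (measurable_progress hf i d j) measurable_const

lemma measurable_alone (R RI : ℝ) : Measurable fun φ : Network =>
    totalProgress R φ (HopSuccess RI φ (alohaTransmitters φ)) :=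
  measurable_totalProgress measurable_id R fun i j => measurableSet_hopSuccess measurable_id RI
    (fun k => measurableSet_alohaTransmitters measurable_id k) i j

lemma integrable_alone {ρ : ℝ} (hρ : 0 < ρ) (l : ℝ) {R : ℝ} (hR : 0 ≤ R) (RI : ℝ)
    (q : unitInterval) : Integrable (fun φ : Network =>
      totalProgress R φ (HopSuccess RI φ (alohaTransmitters φ))) (networkLaw ρ l q) :=
  integrable_networkLaw q hρ l (measurable_alone R RI) fun φ => abs_totalProgress_le hR φ _

section Alone

variable {ρ l R RI : ℝ} {q : unitInterval}

/-- Replacing progress by projected progress costs at most 2R√R for a good pair and at most R for a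
bad one. Both are o(R) on average, to be compared with a main term of order R per allowed sender. -/
lemma abs_aloneThroughput_sub_le (hρ : 0 < ρ) (hl : 0 ≤ l) (hR : 0 < R) (hR1 : R ≤ 1)
    (hRI : R ≤ RI) :
    |aloneThroughput ρ l R RI q -
        ∫ φ, hopSum R φ (hopWeight RI (forwardProgress ρ R RI) φ) ∂(networkLaw ρ l q)|
      ≤ l * (Real.pi * ρ ^ 2) * q * R * (2 * √R + (2 * (R + RI) / ρ + R / ρ ^ 2)) := by
  classical
  have := isProbabilityMeasure_cond_area hρ
  have hsq : R ≤ √R := Real.le_sqrt_of_sq_le (by nlinarith)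
  have hsq0 : 0 < √R := Real.sqrt_pos.2 hR
  have hss : √R * √R = R := Real.mul_self_sqrt hR.le
  have hg := goodWeight_forwardProgress hρ hR hR1 hRI
  unfold aloneThroughput
  rw [← integral_sub (integrable_alone hρ l hR.le RI q) (hg.integrable_hopSum hρ l q)]
  simp only [totalProgress_eq, hopSum_sub]
  set E : Plane × Plane → ℝ := fun p => 2 * R * √R +
    R * {p | ¬ GoodPair ρ R RI p}.indicator 1 p with hE
  have hgm : MeasurableSet {p | ¬ GoodPair ρ R RI p} := (measurableSet_goodPair ρ R RI).compl
  have hEm : Measurable E :=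
    measurable_const.add ((measurable_one.indicator hgm).const_mul _)
  have hind : ∀ p, 0 ≤ {p | ¬ GoodPair ρ R RI p}.indicator (1 : Plane × Plane → ℝ) p ∧
      {p | ¬ GoodPair ρ R RI p}.indicator (1 : Plane × Plane → ℝ) p ≤ 1 := fun p => by
    by_cases h : p ∈ {p | ¬ GoodPair ρ R RI p}
    · simp [Set.indicator_of_mem h]
    · simp [Set.indicator_of_notMem h]
  have hE0 : ∀ p, 0 ≤ E p := fun p => by have := (hind p).1; positivity
  have hEC : ∀ p, E p ≤ 2 * R * √R + R := fun p => by
    have := mul_le_of_le_one_right hR.le (hind p).2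
    simp only [hE]; linarith
  refine (abs_integral_hopSum_le hρ hl q R hEm hE0 hEC ?_ ?_).trans ?_
  · intro φ i d j hi hc
    have : ¬ HopSuccess RI φ (alohaTransmitters φ) i j := fun h => hc h.1.2
    simp [successProgress, hopWeight, this]
  · intro φ i d j hi hd hdi hj
    unfold successProgress hopWeight
    by_cases hS : HopSuccess RI φ (alohaTransmitters φ) i j
    swap
    · simpa [hS] using hE0 _
    simp only [hS, if_true]
    by_cases hgp : GoodPair ρ R RI (φ.loc i, φ.loc d)
    · have hdist : √R < dist (φ.loc i) (φ.loc d) := hgp.2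
      have hd0 := hsq0.trans hdist
      have hjH : φ.loc j ∈ halfDisk R (φ.loc i) (φ.loc d) := by
        rcases mem_relays.1 hj with ⟨h, -⟩ | ⟨-, -, h⟩
        · exact absurd (hsq.trans_lt hdist) (not_lt.2 h)
        · exact h
      have h1 := abs_progress_sub_le hd0 hjH.1
      have h2 : forwardProgress ρ R RI (φ.loc i, φ.loc d, φ.loc j) =
          inner ℝ (φ.loc j - φ.loc i) (φ.loc d - φ.loc i) / dist (φ.loc i) (φ.loc d) :=
        if_pos ⟨hgp, hjH⟩
      rw [h2]
      refine h1.trans ?_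
      have h3 : 2 * R ^ 2 / dist (φ.loc i) (φ.loc d) ≤ 2 * R * √R := by
        rw [div_le_iff₀ hd0]
        have : 2 * R ^ 2 = 2 * R * √R * √R := by rw [mul_assoc, hss]; ring
        rw [this]
        exact mul_le_mul_of_nonneg_left hdist.le (by positivity)
      refine h3.trans ?_
      have := (hind (φ.loc i, φ.loc d)).1
      simp only [hE]
      have := mul_nonneg hR.le this
      linarith
    · have h2 : forwardProgress ρ R RI (φ.loc i, φ.loc d, φ.loc j) = 0 := if_neg fun h => hgp h.1
      rw [h2, sub_zero]
      refine (abs_progress_le hj).trans ?_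
      simp only [hE]
      rw [Set.indicator_of_mem (by exact hgp)]
      simp only [Pi.one_apply, mul_one]
      have : 0 ≤ 2 * R * √R := by positivity
      linarith
  · have hint : ∫ p, E p ∂((unif ρ).prod (unif ρ)) =
        2 * R * √R + R * ((unif ρ).prod (unif ρ)).real {p | ¬ GoodPair ρ R RI p} := by
      have h1 : Integrable ({p | ¬ GoodPair ρ R RI p}.indicator (1 : Plane × Plane → ℝ))
          ((unif ρ).prod (unif ρ)) := (integrable_const (1 : ℝ)).indicator hgm
      simp only [hE]
      rw [integral_add (integrable_const _) (h1.const_mul _),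
        integral_const_mul R ({p | ¬ GoodPair ρ R RI p}.indicator (1 : Plane × Plane → ℝ)),
        integral_indicator_one hgm]
      simp
    rw [hint, volume_real_area hρ]
    have h1 := prod_real_not_goodPair_le hρ hR.le (hR.le.trans hRI)
    have hq0 : (0 : ℝ) ≤ q := q.2.1
    have h2 : 2 * R * √R + R * ((unif ρ).prod (unif ρ)).real {p | ¬ GoodPair ρ R RI p}
        ≤ R * (2 * √R + (2 * (R + RI) / ρ + R / ρ ^ 2)) := by nlinarith
    calc _ ≤ l * (Real.pi * ρ ^ 2) * (q * (R * (2 * √R + (2 * (R + RI) / ρ + R / ρ ^ 2)))) := by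
          gcongr
      _ = _ := by ring

/-- Two-sided bounds for the throughput of a single network. -/
lemma aloneThroughput_bounds (hρ : 0 < ρ) (hl : 0 ≤ l) (hR : 0 < R) (hR1 : R ≤ 1) (hRI : R ≤ RI)
    (hq : (q : ℝ) < 1) {b h μ η : ℝ} (hb : b = RI ^ 2 / ρ ^ 2) (hh : h = R ^ 2 / (2 * ρ ^ 2))
    (hμ : μ = l * (Real.pi * ρ ^ 2)) (hη : η = 2 * √R + (2 * (R + RI) / ρ + R / ρ ^ 2))
    (hv : 0 < 1 - q * b - h) (hpos : (1 - q * b - h)⁻¹ * Real.exp (-(μ * h)) ≤ 1) :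
    μ * q * R * (kappa / Real.pi * Real.exp (-(μ * (q * b))) * (1 - q) ^ 2 * (1 - η) *
        (1 - (1 - q * b - h)⁻¹ * Real.exp (-(μ * h))) - η) ≤ aloneThroughput ρ l R RI q ∧
      aloneThroughput ρ l R RI q ≤ μ * q * R *
        (kappa / Real.pi * Real.exp (-(μ * (q * b))) / ((1 - q) * (1 - q * b)) + η) := by
  have := isProbabilityMeasure_cond_area hρ
  have hRI0 : 0 ≤ RI := hR.le.trans hRI
  have hq0 : (0 : ℝ) ≤ q := q.2.1
  have hq1 : (0 : ℝ) < 1 - q := by linarith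
  have h0 : 0 < h := by rw [hh]; positivity
  have hb0 : 0 ≤ b := by rw [hb]; positivity
  have hμ0 : 0 ≤ μ := by rw [hμ]; positivity
  have hu : 0 < 1 - q * b := by linarith
  have hκ := kappa_pos
  have hpi := Real.pi_pos
  have hg := goodWeight_forwardProgress hρ hR hR1 hRI
  rw [← hh, ← hb] at hg
  have habs := abs_le.1 (abs_aloneThroughput_sub_le (q := q) hρ hl hR hR1 hRI)
  rw [← hμ, ← hη] at habs
  obtain ⟨hlo, hhi⟩ := hg.integral_hopSum_bounds hρ hRI0 hl q hq h0 hb0 hv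
    (μ := μ) (by rw [hμ, volume_real_area hρ])
  rw [integral_forwardProgress hρ hR hR1 hRI] at hlo hhi
  set p := ((unif ρ).prod (unif ρ)).real {p | GoodPair ρ R RI p} with hp
  have hp1 : p ≤ 1 := measureReal_le_one
  have hpη : 1 - η ≤ p := by
    have h1 := prod_real_not_goodPair_le hρ hR.le hRI0
    have h2 := measureReal_compl (μ := (unif ρ).prod (unif ρ)) (measurableSet_goodPair ρ R RI)
    rw [probReal_univ] at h2
    have h3 : ((unif ρ).prod (unif ρ)).real {p | ¬ GoodPair ρ R RI p} = 1 - p := h2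
    rw [h3] at h1
    have := Real.sqrt_nonneg R
    rw [hη]; linarith
  set v := 1 - q * b - h with hv_def
  have hexp : Real.exp (-(μ * (q * b + h))) = Real.exp (-(μ * (q * b))) * Real.exp (-(μ * h)) := by
    rw [← Real.exp_add]; congr 1; ring
  constructor
  · have e1 : q * (1 - q) ^ 2 / h * (R ^ 3 * kappa / (2 * Real.pi * ρ ^ 2) * p) *
        (μ * Real.exp (-(μ * (q * b))) - v⁻¹ * (μ * Real.exp (-(μ * (q * b + h)))))
        = μ * q * R * (kappa / Real.pi * Real.exp (-(μ * (q * b))) * (1 - q) ^ 2 * p *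
          (1 - v⁻¹ * Real.exp (-(μ * h)))) := by
      rw [hexp, hh]
      field_simp
    rw [e1] at hlo
    have h2 : μ * q * R * (kappa / Real.pi * Real.exp (-(μ * (q * b))) * (1 - q) ^ 2 * (1 - η) *
        (1 - v⁻¹ * Real.exp (-(μ * h)))) ≤
        μ * q * R * (kappa / Real.pi * Real.exp (-(μ * (q * b))) * (1 - q) ^ 2 * p *
          (1 - v⁻¹ * Real.exp (-(μ * h)))) := by
      have := sub_nonneg.2 hpos
      gcongr
    have h3 := habs.1
    rw [mul_sub]
    linarith
  · have e1 : q / ((1 - q) * h * (1 - q * b)) * (R ^ 3 * kappa / (2 * Real.pi * ρ ^ 2) * p) *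
        (μ * Real.exp (-(μ * (q * b))))
        = μ * q * R * (kappa / Real.pi * Real.exp (-(μ * (q * b))) / ((1 - q) * (1 - q * b)) * p) := by
      rw [hh]
      field_simp
    rw [e1] at hhi
    have h2 : μ * q * R * (kappa / Real.pi * Real.exp (-(μ * (q * b))) / ((1 - q) * (1 - q * b)) * p)
        ≤ μ * q * R * (kappa / Real.pi * Real.exp (-(μ * (q * b))) / ((1 - q) * (1 - q * b))) := by
      refine mul_le_mul_of_nonneg_left (mul_le_of_le_one_right (by positivity) hp1) (by positivity)
    have h3 := habs.2
    rw [mul_add]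
    linarith

end Alone

/-! ## Void probabilities -/

lemma void_mono {ψ : Network} {B B' : Set Plane} (h : B ⊆ B') (hv : VoidOfTransmitters ψ B') :
    VoidOfTransmitters ψ B := fun k hk hB => hv k hk (h hB)

lemma measurableSet_void_of_measurableSet {B : Set Plane} (hB : MeasurableSet B) :
    MeasurableSet {ψ : Network | VoidOfTransmitters ψ B} := by
  simp only [VoidOfTransmitters, Set.ofPred_forall]
  refine MeasurableSet.iInter fun k => ?_
  simp only [imp_iff_not_or, Set.ofPred_or]
  exact (measurableSet_alohaTransmitters measurable_id k).compl.union
    ((measurable_loc k) hB).compl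

/-- The void probability of the Poisson process of transmitters. It is a special case of the
generating function: with H empty and t = 1 the two bounds of `integral_pgfFactor_bounds` coincide.
-/
lemma measureReal_void {ρ : ℝ} (hρ : 0 < ρ) {l : ℝ} (hl : 0 ≤ l) (q : unitInterval) {B : Set Plane}
    (hB : MeasurableSet B) :
    (networkLaw ρ l q).real {ψ | VoidOfTransmitters ψ B}
      = Real.exp (-(l * (Real.pi * ρ ^ 2) * (q * (unif ρ).real B))) := by
  classical
  have := isProbabilityMeasure_nodeLaw q hρ
  have := isProbabilityMeasure_networkLaw q hρ l
  have hm := measurableSet_void_of_measurableSet hB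
  have hint : Integrable ({ψ : Network | VoidOfTransmitters ψ B}.indicator (1 : Network → ℝ))
      (networkLaw ρ l q) := (integrable_const (1 : ℝ)).indicator hm
  rw [← integral_indicator_one hm, integral_networkLaw q hρ l hint]
  have h1 : ∀ (k : ℕ) (ω : ℕ → Plane × Bool),
      {ψ : Network | VoidOfTransmitters ψ B}.indicator (1 : Network → ℝ) (k, ω)
        = ∏ m ∈ Finset.range k, pgfFactor ∅ B 1 (ω m) := by
    intro k ω
    by_cases h : VoidOfTransmitters ((k, ω) : Network) B
    · rw [Set.indicator_of_mem (by exact h)]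
      refine (Finset.prod_eq_one fun m hm => ?_).symm
      have : ¬ ((ω m).1 ∈ B ∧ (ω m).2 = true) := fun h' => h m ⟨hm, h'.2⟩ h'.1
      simp [pgfFactor, this]
    · rw [Set.indicator_of_notMem (by exact h)]
      unfold VoidOfTransmitters at h
      push Not at h
      obtain ⟨m, hm, hmB⟩ := h
      refine (Finset.prod_eq_zero hm.1 ?_).symm
      have : (ω m).1 ∈ B ∧ (ω m).2 = true := ⟨hmB, hm.2⟩
      simp [pgfFactor, this]
  have h2 : ∫ a, pgfFactor ∅ B 1 a ∂(nodeLaw ρ q) = 1 - q * (unif ρ).real B := by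
    have h := integral_pgfFactor_bounds q hρ (H := ∅) MeasurableSet.empty hB (t := 1) (by simp)
      (h := 0) (by simp) rfl
    refine le_antisymm ?_ ?_
    · simpa using h.2
    · simpa using h.1
  have h3 : ∀ k : ℕ, ∫ ω, {ψ : Network | VoidOfTransmitters ψ B}.indicator (1 : Network → ℝ) (k, ω)
      ∂(Measure.infinitePi fun _ : ℕ => nodeLaw ρ q) = (1 - q * (unif ρ).real B) ^ k := by
    intro k
    simp only [h1]
    have hpgf : Measurable (pgfFactor ∅ B 1) := (measurable_pgfFactor MeasurableSet.empty hB).comp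
      (measurable_const.prodMk measurable_id)
    rw [integral_prod_infinitePi _ _ hpgf, Finset.card_range, h2]
  simp only [h3]
  rw [integral_poisson_pow, Real.coe_toNNReal _ (mul_nonneg hl measureReal_nonneg),
    volume_real_area hρ]
  congr 2
  ring

/-! ## Comparison of the overlaid network with a single network -/

/-- The throughput of a secondary network of density `n` in the presence of a primary network of
density `l`. -/
def sharedThroughput (ρ l : ℝ) (qp : unitInterval) (n : ℝ) (q : unitInterval) (R RI RIps RD : ℝ) : ℝ :=
  ∫ ω, totalProgress R ω.2 (OverlaidSuccess RI RIps RD ω.1 ω.2)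
    ∂((networkLaw ρ l qp).prod (networkLaw ρ n q))

lemma integral_hopSum {Ω : Type*} [MeasurableSpace Ω] {P : Measure Ω} (R : ℝ) (φ : Network)
    {w : Ω → ℕ → ℕ → ℕ → ℝ}
    (hw : ∀ i d, ∀ j ∈ relays R φ i d, Integrable (fun ω => w ω i d j) P) :
    ∫ ω, hopSum R φ (w ω) ∂P = hopSum R φ fun i d j => ∫ ω, w ω i d j ∂P := by
  unfold hopSum
  have h1 : ∀ i d, Integrable (fun ω => ((relays R φ i d).card : ℝ)⁻¹ *
      ∑ j ∈ relays R φ i d, w ω i d j) P := fun i d =>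
    (integrable_finsetSum _ fun j hj => hw i d j hj).const_mul _
  rw [integral_finsetSum _ fun i _ => (integrable_finsetSum _ fun d _ => h1 i d).const_mul _]
  refine Finset.sum_congr rfl fun i _ => ?_
  rw [integral_const_mul, integral_finsetSum _ fun d _ => h1 i d]
  congr 1
  refine Finset.sum_congr rfl fun d _ => ?_
  rw [integral_const_mul, integral_finsetSum _ fun j hj => hw i d j hj]

section Overlaid

variable {R RI RIps RD : ℝ} {ψ φ : Network} {i j : ℕ}

/-- The disk of radius RD + RI around the receiver contains the detection disks of all nodes within
RI of it, in particular that of the sender. If it is free of primary transmitters, sensing silences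
none of the nodes on which the hop depends. -/
lemma overlaidSuccess_of_void (hd : dist (φ.loc i) (φ.loc j) ≤ R) (hRI : R ≤ RI)
    (hv : VoidOfTransmitters ψ (Metric.closedBall (φ.loc j) (max RIps (RD + RI))))
    (hS : HopSuccess RI φ (alohaTransmitters φ) i j) : OverlaidSuccess RI RIps RD ψ φ i j := by
  refine ⟨⟨⟨hS.1, void_mono (Metric.closedBall_subset_closedBall' ?_) hv⟩,
    fun k hk hki hkd hkT => hS.2 k hk hki hkd hkT.1⟩,
    void_mono (Metric.closedBall_subset_closedBall (le_max_left _ _)) hv⟩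
  have := le_max_right RIps (RD + RI)
  linarith

lemma hopSuccess_of_void
    (hv : VoidOfTransmitters ψ (Metric.closedBall (φ.loc j) (max RIps (RD + RI))))
    (hO : OverlaidSuccess RI RIps RD ψ φ i j) : HopSuccess RI φ (alohaTransmitters φ) i j := by
  refine ⟨hO.1.1.1, fun k hk hki hkd hkT => hO.1.2 k hk hki hkd ⟨hkT, ?_⟩⟩
  refine void_mono (Metric.closedBall_subset_closedBall' ?_) hv
  have := le_max_right RIps (RD + RI)
  linarith

/-- The converse at a smaller radius: the sender detects nothing, and its detection disk contains
the disk of radius RD - R around the receiver. -/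
lemma void_of_overlaidSuccess (hd : dist (φ.loc i) (φ.loc j) ≤ R)
    (hO : OverlaidSuccess RI RIps RD ψ φ i j) :
    VoidOfTransmitters ψ (Metric.closedBall (φ.loc j) (max RIps (RD - R))) := by
  rcases max_cases RIps (RD - R) with ⟨h, -⟩ | ⟨h, -⟩ <;> rw [h]
  · exact hO.2
  · refine void_mono (Metric.closedBall_subset_closedBall' ?_) hO.1.1.2
    rw [dist_comm]; linarith

end Overlaid

section Compare

variable {ρ l n R RI RIps RD : ℝ} {qp q : unitInterval}

lemma unif_real_le (hρ : 0 < ρ) {s : Set Plane} (hs : volume s ≠ ⊤) :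
    (unif ρ).real s ≤ (Real.pi * ρ ^ 2)⁻¹ * volume.real s := by
  rw [cond_area_real, volume_real_area hρ]
  exact mul_le_mul_of_nonneg_left (measureReal_mono Set.inter_subset_right hs) (by positivity)

/-- The function e^{-x} is 1-Lipschitz on x ≥ 0, and the part of the annulus inside the area is at
most the whole annulus, even near the boundary. -/
lemma measureReal_void_sub_le (hρ : 0 < ρ) (hl : 0 ≤ l) (x : Plane) {r₁ r₂ : ℝ} (h1 : 0 ≤ r₁)
    (h12 : r₁ ≤ r₂) :
    (networkLaw ρ l qp).real {ψ | VoidOfTransmitters ψ (Metric.closedBall x r₁)} -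
      (networkLaw ρ l qp).real {ψ | VoidOfTransmitters ψ (Metric.closedBall x r₂)}
      ≤ l * qp * Real.pi * (r₂ ^ 2 - r₁ ^ 2) := by
  have := isProbabilityMeasure_cond_area hρ
  have hm : ∀ r, MeasurableSet (Metric.closedBall x r) := fun r =>
    Metric.isClosed_closedBall.measurableSet
  have hsub : Metric.closedBall x r₁ ⊆ Metric.closedBall x r₂ :=
    Metric.closedBall_subset_closedBall h12
  rw [measureReal_void hρ hl qp (hm r₁), measureReal_void hρ hl qp (hm r₂)]
  set A₁ := (unif ρ).real (Metric.closedBall x r₁)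
  set A₂ := (unif ρ).real (Metric.closedBall x r₂)
  have hq0 : (0 : ℝ) ≤ qp := qp.2.1
  have hpi := Real.pi_pos
  have hA1 : 0 ≤ A₁ := measureReal_nonneg
  have hA : A₂ - A₁ ≤ (Real.pi * ρ ^ 2)⁻¹ * (Real.pi * (r₂ ^ 2 - r₁ ^ 2)) := by
    have h2 : (unif ρ).real (Metric.closedBall x r₂ \ Metric.closedBall x r₁) = A₂ - A₁ :=
      measureReal_sdiff hsub (hm r₁)
    have h3 : volume.real (Metric.closedBall x r₂ \ Metric.closedBall x r₁) =
        Real.pi * (r₂ ^ 2 - r₁ ^ 2) := by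
      rw [measureReal_sdiff hsub (hm r₁) measure_closedBall_lt_top.ne, volume_real_closedBall x h1,
        volume_real_closedBall x (h1.trans h12)]
      ring
    rw [← h2, ← h3]
    exact unif_real_le hρ (measure_ne_top_of_subset Set.sdiff_subset measure_closedBall_lt_top.ne)
  set c := l * (Real.pi * ρ ^ 2) * qp with hc
  have hc0 : 0 ≤ c := by positivity
  have e1 : ∀ A : ℝ, l * (Real.pi * ρ ^ 2) * (qp * A) = c * A := fun A => by rw [hc]; ring
  rw [e1, e1]
  have h4 : Real.exp (-(c * A₁)) - Real.exp (-(c * A₂)) ≤ c * A₂ - c * A₁ := by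
    have h5 := Real.add_one_le_exp (-(c * A₂ - c * A₁))
    have h6 : Real.exp (-(c * A₂)) = Real.exp (-(c * A₁)) * Real.exp (-(c * A₂ - c * A₁)) := by
      rw [← Real.exp_add]; congr 1; ring
    have h7 : Real.exp (-(c * A₁)) ≤ 1 := Real.exp_le_one_iff.2 (by
      have := mul_nonneg hc0 hA1; linarith)
    have h8 : A₁ ≤ A₂ := measureReal_mono hsub
    have h9 := mul_le_mul_of_nonneg_left h8 hc0
    have h10 := Real.exp_pos (-(c * A₁))
    rw [h6]
    nlinarith
  refine h4.trans ?_
  calc c * A₂ - c * A₁ = c * (A₂ - A₁) := by ring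
    _ ≤ c * ((Real.pi * ρ ^ 2)⁻¹ * (Real.pi * (r₂ ^ 2 - r₁ ^ 2))) :=
        mul_le_mul_of_nonneg_left hA hc0
    _ = _ := by rw [hc]; field_simp

-- Let W₁ ⊇ W₂ be the events that the smaller and the larger disk are void. If the hop succeeds in
-- the stand-alone network, the event of overlaid success lies between W₂ and W₁; otherwise it is
-- contained in W₁ \ W₂. Away from the boundary W₂ has probability exactly V, and the indicator on
-- the right pays for the rest.
open scoped Classical in
lemma abs_measureReal_overlaidSuccess_sub_le (hρ : 0 < ρ) (hl : 0 ≤ l) (hR : 0 ≤ R) (hRI : R ≤ RI)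
    (hps : 0 ≤ RIps) {φ : Network} {i j : ℕ}
    (hd : dist (φ.loc i) (φ.loc j) ≤ R) (s : ℝ)
    (hs : s = if HopSuccess RI φ (alohaTransmitters φ) i j then 1 else 0) :
    |(networkLaw ρ l qp).real {ψ | OverlaidSuccess RI RIps RD ψ φ i j} -
        Real.exp (-(l * qp * Real.pi * max RIps (RD + RI) ^ 2)) * s|
      ≤ l * qp * Real.pi * (max RIps (RD + RI) ^ 2 - max RIps (RD - R) ^ 2) +
        {x : Plane | ρ - (max RIps (RD + RI) + R) < ‖x‖}.indicator 1 (φ.loc i) := by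
  have := isProbabilityMeasure_networkLaw qp hρ l
  set r₂ := max RIps (RD + RI) with hr2
  set r₁ := max RIps (RD - R) with hr1
  have hr1_0 : 0 ≤ r₁ := hps.trans (le_max_left _ _)
  have hr12 : r₁ ≤ r₂ := max_le_max le_rfl (by linarith)
  have hr2_0 := hr1_0.trans hr12
  set V := Real.exp (-(l * qp * Real.pi * r₂ ^ 2)) with hV
  set pO := (networkLaw ρ l qp).real {ψ | OverlaidSuccess RI RIps RD ψ φ i j} with hpO
  set W₁ := {ψ : Network | VoidOfTransmitters ψ (Metric.closedBall (φ.loc j) r₁)}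
  set W₂ := {ψ : Network | VoidOfTransmitters ψ (Metric.closedBall (φ.loc j) r₂)}
  have hdiff := measureReal_void_sub_le (qp := qp) hρ hl (φ.loc j) hr1_0 hr12
  have hO1 : {ψ | OverlaidSuccess RI RIps RD ψ φ i j} ⊆ W₁ := fun ψ h => void_of_overlaidSuccess hd h
  have hW2 : (networkLaw ρ l qp).real W₂ ≤ 1 := measureReal_le_one
  have hW2' : 0 ≤ (networkLaw ρ l qp).real W₂ := measureReal_nonneg
  have hV0 : 0 < V := Real.exp_pos _
  have hq0 : (0 : ℝ) ≤ qp := qp.2.1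
  have hpi := Real.pi_pos
  have hV1 : V ≤ 1 := Real.exp_le_one_iff.2 (by
    have : 0 ≤ l * qp * Real.pi * r₂ ^ 2 := by positivity
    linarith)
  have hind : |(networkLaw ρ l qp).real W₂ - V| ≤
      {x : Plane | ρ - (r₂ + R) < ‖x‖}.indicator 1 (φ.loc i) := by
    by_cases h : ρ - (r₂ + R) < ‖φ.loc i‖
    · rw [Set.indicator_of_mem (by exact h)]
      simp only [Pi.one_apply]
      rw [abs_le]; constructor <;> linarith
    · rw [Set.indicator_of_notMem (by exact h)]
      have h1 : ‖φ.loc j‖ ≤ ρ - r₂ := by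
        have h2 : ‖φ.loc j‖ ≤ ‖φ.loc i‖ + dist (φ.loc i) (φ.loc j) := by
          rw [dist_comm, dist_eq_norm]
          calc ‖φ.loc j‖ = ‖φ.loc i + (φ.loc j - φ.loc i)‖ := by congr 1; abel
            _ ≤ _ := norm_add_le _ _
        linarith
      rw [measureReal_void hρ hl qp Metric.isClosed_closedBall.measurableSet,
        unif_real_closedBall hρ hr2_0 h1]
      have : l * (Real.pi * ρ ^ 2) * (qp * (r₂ ^ 2 / ρ ^ 2)) = l * qp * Real.pi * r₂ ^ 2 := by
        field_simp
      rw [this, hV, sub_self, abs_zero]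
  have hle := abs_le.1 hind
  by_cases hS : HopSuccess RI φ (alohaTransmitters φ) i j
  · rw [hs, if_pos hS, mul_one]
    have h1 : (networkLaw ρ l qp).real W₂ ≤ pO := measureReal_mono fun ψ hψ =>
      overlaidSuccess_of_void hd hRI hψ hS
    have h2 : pO ≤ (networkLaw ρ l qp).real W₁ := measureReal_mono hO1
    rw [abs_le]
    constructor <;> linarith [hle.1, hle.2]
  · rw [hs, if_neg hS, mul_zero, sub_zero, abs_of_nonneg measureReal_nonneg]
    have h1 : pO ≤ (networkLaw ρ l qp).real (W₁ \ W₂) := measureReal_mono fun ψ hψ =>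
      ⟨hO1 hψ, fun h => hS (hopSuccess_of_void h hψ)⟩
    have h2 : W₂ ⊆ W₁ := fun ψ hψ => void_mono (Metric.closedBall_subset_closedBall hr12) hψ
    rw [measureReal_sdiff h2 (measurableSet_void_of_measurableSet
      Metric.isClosed_closedBall.measurableSet)] at h1
    linarith [abs_nonneg ((networkLaw ρ l qp).real W₂ - V)]

/-- In a secondary network, a primary network acts asymptotically as an independent thinning of the
successful transmissions. -/
lemma abs_sharedThroughput_sub_le (hρ : 0 < ρ) (hl : 0 ≤ l) (hn : 0 ≤ n) (hR : 0 ≤ R) (hRI : R ≤ RI)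
    (hps : 0 ≤ RIps) :
    |sharedThroughput ρ l qp n q R RI RIps RD -
        Real.exp (-(l * qp * Real.pi * max RIps (RD + RI) ^ 2)) * aloneThroughput ρ n R RI q|
      ≤ n * (Real.pi * ρ ^ 2) * q * R *
        (l * qp * Real.pi * (max RIps (RD + RI) ^ 2 - max RIps (RD - R) ^ 2) +
          2 * (max RIps (RD + RI) + R) / ρ) := by
  classical
  have := isProbabilityMeasure_cond_area hρ
  have := isProbabilityMeasure_networkLaw qp hρ l
  have := isProbabilityMeasure_networkLaw q hρ n
  set V := Real.exp (-(l * qp * Real.pi * max RIps (RD + RI) ^ 2)) with hV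
  set δ := l * qp * Real.pi * (max RIps (RD + RI) ^ 2 - max RIps (RD - R) ^ 2) with hδ
  set r := max RIps (RD + RI) + R with hr
  have hq0 : (0 : ℝ) ≤ q := q.2.1
  have hqp0 : (0 : ℝ) ≤ qp := qp.2.1
  have hpi := Real.pi_pos
  have hr0 : 0 ≤ r := add_nonneg (hps.trans (le_max_left _ _)) hR
  have hδ0 : 0 ≤ δ := by
    refine mul_nonneg (by positivity) (sub_nonneg.2 (pow_le_pow_left₀ (hps.trans (le_max_left _ _))
      (max_le_max le_rfl (by linarith)) 2))
  have hm : Measurable fun ω : Network × Network =>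
      totalProgress R ω.2 (OverlaidSuccess RI RIps RD ω.1 ω.2) :=
    measurable_totalProgress measurable_snd R fun i j =>
      measurableSet_overlaidSuccess measurable_fst measurable_snd RI RIps RD i j
  have hint : Integrable (fun ω : Network × Network =>
      totalProgress R ω.2 (OverlaidSuccess RI RIps RD ω.1 ω.2))
      ((networkLaw ρ l qp).prod (networkLaw ρ n q)) := by
    have h1 : Integrable (fun φ : Network => R * (φ.1 : ℝ)) (networkLaw ρ n q) :=
      integrable_networkLaw q hρ n (C := R) (by
        have : Measurable fun k : ℕ => R * (k : ℝ) := .of_discrete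
        exact this.comp measurable_fst)
        fun φ => by rw [abs_of_nonneg (by positivity)]
    exact (h1.comp_snd (networkLaw ρ l qp)).mono' hm.aestronglyMeasurable
      (ae_of_all _ fun ω => abs_totalProgress_le hR _ _)
  have hmO : ∀ (φ : Network) i j, MeasurableSet {ψ | OverlaidSuccess RI RIps RD ψ φ i j} :=
    fun φ i j => measurableSet_overlaidSuccess measurable_id measurable_const RI RIps RD i j
  have hpO : ∀ (φ : Network) i d j, (fun ψ => successProgress (OverlaidSuccess RI RIps RD ψ φ) φ i d j)
      = {ψ | OverlaidSuccess RI RIps RD ψ φ i j}.indicator fun _ => progress φ i d j := by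
    intro φ i d j
    ext ψ
    simp [successProgress, Set.indicator_apply]
  have hinner : ∀ φ : Network, ∫ ψ, totalProgress R φ (OverlaidSuccess RI RIps RD ψ φ)
      ∂(networkLaw ρ l qp) = hopSum R φ fun i d j =>
        (networkLaw ρ l qp).real {ψ | OverlaidSuccess RI RIps RD ψ φ i j} * progress φ i d j := by
    intro φ
    simp only [totalProgress_eq]
    rw [integral_hopSum]
    · congr with i d j
      rw [hpO, integral_indicator (hmO φ i j), setIntegral_const, smul_eq_mul]
    · intro i d j _
      rw [hpO]
      exact (integrable_const _).indicator (hmO φ i j)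
  unfold sharedThroughput aloneThroughput
  -- The secondary realization is frozen and the primary network integrated first, so that the
  -- preceding estimate applies hop by hop.
  rw [integral_prod_symm _ hint, ← integral_const_mul, ← integral_sub hint.integral_prod_right
    ((integrable_alone hρ n hR RI q).const_mul V)]
  simp only [hinner]
  simp only [totalProgress_eq, ← hopSum_const_mul, hopSum_sub]
  set E : Plane × Plane → ℝ := fun p => R * (δ + {x : Plane | ρ - r < ‖x‖}.indicator 1 p.1) with hE
  have hgm : MeasurableSet {x : Plane | ρ - r < ‖x‖} :=
    measurableSet_lt measurable_const (by fun_prop)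
  have hind : ∀ x, 0 ≤ {x : Plane | ρ - r < ‖x‖}.indicator (1 : Plane → ℝ) x ∧
      {x : Plane | ρ - r < ‖x‖}.indicator (1 : Plane → ℝ) x ≤ 1 := fun x => by
    by_cases h : x ∈ {x : Plane | ρ - r < ‖x‖}
    · simp [Set.indicator_of_mem h]
    · simp [Set.indicator_of_notMem h]
  have hEm : Measurable E :=
    (measurable_const.add ((measurable_one.indicator hgm).comp measurable_fst)).const_mul _
  have hE0 : ∀ p, 0 ≤ E p := fun p => by have := (hind p.1).1; positivity
  have hEC : ∀ p, E p ≤ R * (δ + 1) := fun p => by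
    have := (hind p.1).2
    simp only [hE]; gcongr
  refine (abs_integral_hopSum_le hρ hn q R hEm hE0 hEC ?_ ?_).trans ?_
  · intro φ i d j hi hc
    have h1 : ¬ HopSuccess RI φ (alohaTransmitters φ) i j := fun h => hc h.1.2
    have h2 : {ψ | OverlaidSuccess RI RIps RD ψ φ i j} = ∅ := by
      ext ψ
      simp only [Set.mem_ofPred_eq, Set.mem_empty_iff_false, iff_false]
      exact fun h => hc h.1.1.1.2
    simp [successProgress, h1, h2]
  · intro φ i d j hi hd hdi hj
    have h1 := abs_measureReal_overlaidSuccess_sub_le (qp := qp) (RD := RD) hρ hl hR hRI hps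
      (dist_le_of_mem_relays hj) _ rfl
    rw [← hV, ← hδ, ← hr] at h1
    have h2 : successProgress (HopSuccess RI φ (alohaTransmitters φ)) φ i d j =
        (if HopSuccess RI φ (alohaTransmitters φ) i j then 1 else 0) * progress φ i d j := by
      unfold successProgress; split_ifs <;> simp
    rw [h2, ← mul_assoc, ← sub_mul, abs_mul, mul_comm]
    exact mul_le_mul (abs_progress_le hj) h1 (abs_nonneg _) hR
  · have hint : ∫ p, E p ∂((unif ρ).prod (unif ρ)) =
        R * (δ + (unif ρ).real {x : Plane | ρ - r < ‖x‖}) := by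
      have h1 : Integrable ({x : Plane | ρ - r < ‖x‖}.indicator (1 : Plane → ℝ)) (unif ρ) :=
        (integrable_const (1 : ℝ)).indicator hgm
      have h2 : ∫ p : Plane × Plane, {x : Plane | ρ - r < ‖x‖}.indicator (1 : Plane → ℝ) p.1
          ∂((unif ρ).prod (unif ρ)) = (unif ρ).real {x : Plane | ρ - r < ‖x‖} := by
        rw [integral_fun_fst, integral_indicator_one hgm]; simp
      simp only [hE]
      rw [integral_const_mul, integral_add (integrable_const _) (h1.comp_fst _), h2]
      simp
    rw [hint, volume_real_area hρ]
    have h1 := unif_real_norm_gt_le hρ (s := ρ - r) (by linarith)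
    rw [sub_sub_cancel] at h1
    calc _ ≤ n * (Real.pi * ρ ^ 2) * (q * (R * (δ + 2 * r / ρ))) := by gcongr
      _ = _ := by ring

end Compare

namespace OverlaidNetworks

variable (M : OverlaidNetworks)

/-! ## Asymptotics of the parameters -/

lemma tendsto_densS : Tendsto M.densS atTop atTop := tendsto_rpow_atTop M.β_pos

lemma tendsto_log_densS : Tendsto (fun l => Real.log (M.densS l)) atTop atTop :=
  Real.tendsto_log_atTop.comp M.tendsto_densS

lemma tendsto_sqrt_log_div : Tendsto (fun x : ℝ => √(Real.log x / x)) atTop (𝓝 0) := by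
  have h : Tendsto (fun x : ℝ => Real.log x / x) atTop (𝓝 0) :=
    Real.isLittleO_log_id_atTop.tendsto_div_nhds_zero
  simpa [Function.comp_def] using (Real.continuous_sqrt.tendsto 0).comp h

lemma tendsto_RrS : Tendsto M.RrS atTop (𝓝 0) := by
  have := (tendsto_sqrt_log_div.comp M.tendsto_densS).const_mul M.Ks
  rw [mul_zero] at this
  exact this

lemma tendsto_RIs : Tendsto M.RIs atTop (𝓝 0) := by
  have := M.tendsto_RrS.const_mul (√(1 + M.marginS))
  rw [mul_zero] at this
  exact this

lemma tendsto_RIp : Tendsto M.RIp atTop (𝓝 0) := by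
  have := (tendsto_sqrt_log_div.const_mul M.Kp).const_mul (√(1 + M.marginP))
  rw [mul_zero, mul_zero] at this
  exact this

lemma one_le_sqrt_marginS : 1 ≤ √(1 + M.marginS) :=
  Real.one_le_sqrt.2 (by linarith [M.marginS_nonneg])

lemma one_le_sqrt_marginP : 1 ≤ √(1 + M.marginP) :=
  Real.one_le_sqrt.2 (by linarith [M.marginP_nonneg])

lemma RrS_nonneg (l : ℝ) : 0 ≤ M.RrS l := mul_nonneg M.Ks_pos.le (Real.sqrt_nonneg _)

lemma RrP_nonneg (l : ℝ) : 0 ≤ M.RrP l := mul_nonneg M.Kp_pos.le (Real.sqrt_nonneg _)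

lemma RrS_le_RIs (l : ℝ) : M.RrS l ≤ M.RIs l :=
  le_mul_of_one_le_left (M.RrS_nonneg l) M.one_le_sqrt_marginS

lemma RrP_le_RIp (l : ℝ) : M.RrP l ≤ M.RIp l :=
  le_mul_of_one_le_left (M.RrP_nonneg l) M.one_le_sqrt_marginP

lemma eventually_RrS_pos : ∀ᶠ l in atTop, 0 < M.RrS l := by
  filter_upwards [M.tendsto_densS.eventually_gt_atTop 0, M.tendsto_log_densS.eventually_gt_atTop 0]
    with l h1 h2
  exact mul_pos M.Ks_pos (Real.sqrt_pos.2 (div_pos h2 h1))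

lemma eventually_RIp_pos : ∀ᶠ l in atTop, 0 < M.RIp l := by
  filter_upwards [eventually_gt_atTop 0, Real.tendsto_log_atTop.eventually_gt_atTop 0] with l h1 h2
  exact mul_pos (by linarith [M.one_le_sqrt_marginP])
    (mul_pos M.Kp_pos (Real.sqrt_pos.2 (div_pos h2 h1)))

lemma eventually_densS_mul_RrS_sq :
    ∀ᶠ l in atTop, M.densS l * M.RrS l ^ 2 = M.Ks ^ 2 * Real.log (M.densS l) := by
  filter_upwards [M.tendsto_densS.eventually_gt_atTop 0, M.tendsto_log_densS.eventually_gt_atTop 0]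
    with l h1 h2
  rw [RrS, mul_pow, Real.sq_sqrt (div_pos h2 h1).le]
  field_simp

lemma RIs_sq (l : ℝ) : M.RIs l ^ 2 = (1 + M.marginS) * M.RrS l ^ 2 := by
  rw [RIs, mul_pow, Real.sq_sqrt (by linarith [M.marginS_nonneg])]

lemma eventually_mul_RIp_sq :
    ∀ᶠ l in atTop, l * M.RIp l ^ 2 = (1 + M.marginP) * M.Kp ^ 2 * Real.log l := by
  filter_upwards [eventually_gt_atTop 0, Real.tendsto_log_atTop.eventually_gt_atTop 0] with l h1 h2
  rw [RIp, RrP, mul_pow, mul_pow, Real.sq_sqrt (div_pos h2 h1).le,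
    Real.sq_sqrt (by linarith [M.marginP_nonneg])]
  field_simp

/-- The separation of scales, and the place where β > 1 is needed: the squared ratio is a constant
times l^(1-β), the logarithms contributing only the factor β. -/
lemma tendsto_RrS_div_RIp (hβ : 1 < M.β) : Tendsto (fun l => M.RrS l / M.RIp l) atTop (𝓝 0) := by
  have h1 : Tendsto (fun l : ℝ => M.Ks / (√(1 + M.marginP) * M.Kp) * √(M.β * l ^ (-(M.β - 1))))
      atTop (𝓝 0) := by
    have h2 := ((Real.continuous_sqrt.tendsto _).comp
      ((tendsto_rpow_neg_atTop (sub_pos.2 hβ)).const_mul M.β)).const_mul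
      (M.Ks / (√(1 + M.marginP) * M.Kp))
    simpa using h2
  refine h1.congr' ?_
  filter_upwards [eventually_gt_atTop 0, Real.tendsto_log_atTop.eventually_gt_atTop 0] with l h1 h2
  have h3 : M.β * l ^ (-(M.β - 1)) = (Real.log (M.densS l) / M.densS l) / (Real.log l / l) := by
    rw [densS, Real.log_rpow h1, show -(M.β - 1) = 1 - M.β by ring, Real.rpow_sub h1, Real.rpow_one]
    have : 0 < l ^ M.β := Real.rpow_pos_of_pos h1 _
    field_simp
  rw [h3, Real.sqrt_div' _ (div_pos h2 h1).le, RrS, RIp, RrP]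
  ring

lemma tendsto_RIs_div_RIp (hβ : 1 < M.β) : Tendsto (fun l => M.RIs l / M.RIp l) atTop (𝓝 0) := by
  have := (M.tendsto_RrS_div_RIp hβ).const_mul (√(1 + M.marginS))
  rw [mul_zero] at this
  refine this.congr fun l => ?_
  rw [RIs, mul_div_assoc]

/-- Admissibility is used only through this bound. Both alternatives give it, the first by RIps ≤
RIp and the second by RrP ≤ RIp. -/
lemma eventually_RD_div_RIp_le (hRD : M.Admissible) :
    ∀ᶠ l in atTop, M.RD l / M.RIp l ≤ 1 + M.csp * (M.RIs l / M.RIp l) := by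
  filter_upwards [hRD, M.eventually_RIp_pos] with l h hp
  have h0 : 0 ≤ M.RIs l := (M.RrS_nonneg l).trans (M.RrS_le_RIs l)
  have h1 : 0 ≤ M.csp * M.RIs l := mul_nonneg (zero_le_one.trans M.one_le_csp) h0
  rw [← mul_div_assoc, div_le_iff₀ hp, add_mul, div_mul_cancel₀ _ hp.ne', one_mul]
  rcases h with h | h
  · have : M.RIps l ≤ M.RIp l := mul_le_of_le_one_left hp.le M.cps_le_one
    linarith
  · have := M.RrP_le_RIp l
    have h2 : M.RIsp l = M.csp * M.RIs l := rfl
    linarith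

/-- Expected number of primary transmitters in a disk of radius `RIp`. -/
def primaryLoad (l : ℝ) : ℝ := l * M.qp l * Real.pi * M.RIp l ^ 2

/-- The disk of radius RIp contains of order log l primary nodes in the mean, so an access
probability O(1 / log l) leaves boundedly many transmitters. -/
lemma exists_primaryLoad_le (hqp : (fun l => (M.qp l : ℝ)) =O[atTop] fun l => 1 / Real.log l) :
    ∃ C, 0 ≤ C ∧ ∀ᶠ l in atTop, 0 ≤ M.primaryLoad l ∧ M.primaryLoad l ≤ C := by
  obtain ⟨c, hc⟩ := hqp.bound
  refine ⟨|c| * ((1 + M.marginP) * M.Kp ^ 2 * Real.pi), ?_, ?_⟩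
  · have := M.marginP_nonneg
    have := Real.pi_pos
    positivity
  filter_upwards [hc, M.eventually_mul_RIp_sq, eventually_gt_atTop 0,
    Real.tendsto_log_atTop.eventually_gt_atTop 0] with l h1 h2 h3 h4
  have hq0 : (0 : ℝ) ≤ M.qp l := (M.qp l).2.1
  have hpi := Real.pi_pos
  refine ⟨by unfold primaryLoad; positivity, ?_⟩
  rw [Real.norm_of_nonneg hq0, Real.norm_of_nonneg (by positivity)] at h1
  have h5 : M.qp l * Real.log l ≤ |c| := by
    have := mul_le_mul_of_nonneg_right h1 h4.le
    have h6 : c * (1 / Real.log l) * Real.log l = c := by field_simp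
    rw [h6] at this
    exact this.trans (le_abs_self c)
  have h7 : M.primaryLoad l = (M.qp l * Real.log l) * ((1 + M.marginP) * M.Kp ^ 2 * Real.pi) := by
    unfold primaryLoad
    calc _ = (l * M.RIp l ^ 2) * M.qp l * Real.pi := by ring
      _ = _ := by rw [h2]; ring
  rw [h7]
  have := M.marginP_nonneg
  exact mul_le_mul_of_nonneg_right h5 (by positivity)

lemma tendsto_primaryLoad
    (hqp : (fun l => (M.qp l : ℝ)) ~[atTop] (fun l => 1 / (l * Real.pi * M.RIp l ^ 2))) :
    Tendsto M.primaryLoad atTop (𝓝 1) := by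
  have hne : ∀ᶠ l in atTop, 1 / (l * Real.pi * M.RIp l ^ 2) ≠ 0 := by
    filter_upwards [M.eventually_RIp_pos, eventually_gt_atTop 0] with l h1 h2
    have := Real.pi_pos
    positivity
  refine ((isEquivalent_iff_tendsto_one hne).1 hqp).congr fun l => ?_
  simp only [Pi.div_apply, primaryLoad]
  rw [div_div_eq_mul_div, div_one]
  ring

/-! ## The throughput of the secondary network alone -/

/-- Up to a constant, the throughput if all transmissions were successful. -/
def ideal (l : ℝ) : ℝ :=
  M.densS l * (Real.pi * M.ρ ^ 2) * M.qs l * M.RrS l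

/-- Expected number of secondary transmitters in a disk of radius `RIs`. -/
def secondaryLoad (l : ℝ) : ℝ :=
  (M.qs l * Real.log (M.densS l)) * (Real.pi * (1 + M.marginS) * M.Ks ^ 2)

/-- Rests on n·√(log n / n) = log n·√(n / log n). Hence `ideal` has the order of `scale` exactly
when qs·log n is bounded above and away from 0. -/
lemma eventually_ideal_eq : ∀ᶠ l in atTop, M.ideal l =
    Real.pi * M.ρ ^ 2 * M.Ks * (M.qs l * Real.log (M.densS l)) * M.scale l := by
  filter_upwards [M.tendsto_densS.eventually_gt_atTop 0, M.tendsto_log_densS.eventually_gt_atTop 0]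
    with l h1 h2
  have h3 : M.densS l * √(Real.log (M.densS l) / M.densS l) =
      Real.log (M.densS l) * √(M.densS l / Real.log (M.densS l)) := by
    rw [Real.sqrt_div h2.le, Real.sqrt_div h1.le]
    have e1 := Real.mul_self_sqrt h1.le
    have e2 := Real.mul_self_sqrt h2.le
    have := Real.sqrt_pos.2 h1
    have := Real.sqrt_pos.2 h2
    rw [mul_div_assoc', mul_div_assoc', div_eq_div_iff (by positivity) (by positivity)]
    calc _ = M.densS l * (√(Real.log (M.densS l)) * √(Real.log (M.densS l))) := by ring
      _ = Real.log (M.densS l) * (√(M.densS l) * √(M.densS l)) := by rw [e1, e2]; ring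
      _ = _ := by ring
  rw [ideal, RrS, scale]
  calc _ = Real.pi * M.ρ ^ 2 * M.Ks * M.qs l *
        (M.densS l * √(Real.log (M.densS l) / M.densS l)) := by ring
    _ = _ := by rw [h3]; ring

lemma exists_qs_mul_log_bounds
    (hqs : (fun l => (M.qs l : ℝ)) =Θ[atTop] fun l => 1 / Real.log (M.densS l)) :
    ∃ c C : ℝ, 0 < c ∧ ∀ᶠ l in atTop, c ≤ M.qs l * Real.log (M.densS l) ∧
      M.qs l * Real.log (M.densS l) ≤ C := by
  obtain ⟨C, hC⟩ := hqs.1.bound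
  obtain ⟨c, hc0, hc⟩ := hqs.2.exists_pos
  refine ⟨c⁻¹, C, inv_pos.2 hc0, ?_⟩
  filter_upwards [hC, hc.bound, M.tendsto_log_densS.eventually_gt_atTop 0] with l h1 h2 h3
  have hq0 : (0 : ℝ) ≤ M.qs l := (M.qs l).2.1
  rw [Real.norm_of_nonneg hq0, Real.norm_of_nonneg (by positivity)] at h1 h2
  constructor
  · rw [inv_le_iff_one_le_mul₀' hc0]
    have := mul_le_mul_of_nonneg_right h2 h3.le
    rw [one_div, inv_mul_cancel₀ h3.ne'] at this
    linarith
  · have := mul_le_mul_of_nonneg_right h1 h3.le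
    rwa [mul_assoc, one_div, inv_mul_cancel₀ h3.ne', mul_one] at this

lemma tendsto_qs
    (hqs : (fun l => (M.qs l : ℝ)) =Θ[atTop] fun l => 1 / Real.log (M.densS l)) :
    Tendsto (fun l => (M.qs l : ℝ)) atTop (𝓝 0) := by
  refine hqs.1.trans_tendsto ?_
  simp only [one_div]
  exact M.tendsto_log_densS.inv_tendsto_atTop

lemma eventually_ideal_pos
    (hqs : (fun l => (M.qs l : ℝ)) =Θ[atTop] fun l => 1 / Real.log (M.densS l)) :
    ∀ᶠ l in atTop, 0 < M.ideal l := by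
  obtain ⟨c, C, hc, h⟩ := M.exists_qs_mul_log_bounds hqs
  filter_upwards [h, M.eventually_ideal_eq, M.tendsto_densS.eventually_gt_atTop 0,
    M.tendsto_log_densS.eventually_gt_atTop 0] with l h1 h2 h3 h4
  rw [h2]
  have h5 : 0 < M.qs l * Real.log (M.densS l) := hc.trans_le h1.1
  have h6 : 0 < M.scale l := Real.sqrt_pos.2 (div_pos h3 h4)
  have := M.ρ_pos
  have := M.Ks_pos
  have := Real.pi_pos
  positivity

/-- In the two-sided bounds every correction vanishes: q, η and b tend to 0, and w is essentially
e^{-μh}, the chance that the half-disk is empty, with μh = (π Ks²/2) log n → ∞. The exponent μqb is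
exactly the secondary load. The statement is about a difference because the load is only known to be
bounded. -/
lemma tendsto_single_div_ideal
    (hqs : (fun l => (M.qs l : ℝ)) =Θ[atTop] fun l => 1 / Real.log (M.densS l)) :
    Tendsto (fun l => M.singleThroughput l / M.ideal l -
      kappa / Real.pi * Real.exp (-M.secondaryLoad l)) atTop (𝓝 0) := by
  have hρ := M.ρ_pos
  have hκ := kappa_pos
  have hpi := Real.pi_pos
  set b : ℝ → ℝ := fun l => M.RIs l ^ 2 / M.ρ ^ 2 with hb
  set h : ℝ → ℝ := fun l => M.RrS l ^ 2 / (2 * M.ρ ^ 2) with hh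
  set μ : ℝ → ℝ := fun l => M.densS l * (Real.pi * M.ρ ^ 2) with hμ
  set η : ℝ → ℝ := fun l => 2 * √(M.RrS l) +
    (2 * (M.RrS l + M.RIs l) / M.ρ + M.RrS l / M.ρ ^ 2) with hη
  set w : ℝ → ℝ := fun l => (1 - M.qs l * b l - h l)⁻¹ * Real.exp (-(μ l * h l)) with hw
  have tq := M.tendsto_qs hqs
  have tR := M.tendsto_RrS
  have tRI := M.tendsto_RIs
  have tb : Tendsto b atTop (𝓝 0) := by
    have := (tRI.pow 2).div_const (M.ρ ^ 2)
    simpa using this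
  have th : Tendsto h atTop (𝓝 0) := by
    have := (tR.pow 2).div_const (2 * M.ρ ^ 2)
    simpa using this
  have tη : Tendsto η atTop (𝓝 0) := by
    have h1 := (((Real.continuous_sqrt.tendsto 0).comp tR).const_mul 2).add
      ((((tR.add tRI).const_mul 2).div_const M.ρ).add (tR.div_const (M.ρ ^ 2)))
    simpa using h1
  have tqb : Tendsto (fun l => 1 - M.qs l * b l) atTop (𝓝 1) := by
    simpa using (tq.mul tb).const_sub 1
  have tv : Tendsto (fun l => 1 - M.qs l * b l - h l) atTop (𝓝 1) := by
    simpa using tqb.sub th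
  have eμh : ∀ᶠ l in atTop, μ l * h l = Real.pi * M.Ks ^ 2 / 2 * Real.log (M.densS l) := by
    filter_upwards [M.eventually_densS_mul_RrS_sq] with l hl
    calc μ l * h l = Real.pi / 2 * (M.densS l * M.RrS l ^ 2) := by
          simp only [hμ, hh]; field_simp
      _ = _ := by rw [hl]; ring
  have tμh : Tendsto (fun l => μ l * h l) atTop atTop := by
    have : 0 < Real.pi * M.Ks ^ 2 / 2 := by have := M.Ks_pos; positivity
    exact (M.tendsto_log_densS.const_mul_atTop this).congr' (eμh.mono fun l hl => hl.symm)
  have tw : Tendsto w atTop (𝓝 0) := by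
    have := (tv.inv₀ one_ne_zero).mul
      (Real.tendsto_exp_atBot.comp (tendsto_neg_atTop_atBot.comp tμh))
    simpa using this
  have eload : ∀ᶠ l in atTop, μ l * (M.qs l * b l) = M.secondaryLoad l := by
    filter_upwards [M.eventually_densS_mul_RrS_sq] with l hl
    calc μ l * (M.qs l * b l)
        = Real.pi * M.qs l * (1 + M.marginS) * (M.densS l * M.RrS l ^ 2) := by
          simp only [hμ, hb, M.RIs_sq]; field_simp
      _ = _ := by rw [hl, secondaryLoad]; ring
  set f₁ : ℝ → ℝ := fun l => (1 - M.qs l) ^ 2 * (1 - η l) * (1 - w l) with hf1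
  set f₂ : ℝ → ℝ := fun l => ((1 - M.qs l) * (1 - M.qs l * b l))⁻¹ with hf2
  have tf1 : Tendsto f₁ atTop (𝓝 1) := by
    simpa using (((tq.const_sub 1).pow 2).mul (tη.const_sub 1)).mul (tw.const_sub 1)
  have tf2 : Tendsto f₂ atTop (𝓝 1) := by
    have := ((tq.const_sub 1).mul tqb).inv₀ (by norm_num)
    simpa [hf2] using this
  have tbound : Tendsto (fun l => kappa / Real.pi * (|f₁ l - 1| + |f₂ l - 1|) + η l) atTop (𝓝 0) := by
    have := ((((tf1.sub_const 1).abs).add ((tf2.sub_const 1).abs)).const_mul (kappa / Real.pi)).add tη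
    simpa using this
  refine squeeze_zero_norm' ?_ tbound
  filter_upwards [eload, M.eventually_ideal_pos hqs, M.eventually_RrS_pos,
    tR.eventually_lt_const one_pos, tq.eventually_lt_const one_pos, tv.eventually_const_lt one_pos,
    tw.eventually_lt_const one_pos, M.tendsto_densS.eventually_gt_atTop 0]
    with l h1 h2 h3 h4 h5 h6 h7 h8
  obtain ⟨hlo, hhi⟩ := aloneThroughput_bounds (q := M.qs l) hρ h8.le h3 h4.le (M.RrS_le_RIs l)
    h5 (b := b l) (h := h l) (μ := μ l) (η := η l) rfl rfl rfl rfl h6 h7.le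
  rw [h1] at hlo hhi
  have hid : μ l * M.qs l * M.RrS l = M.ideal l := rfl
  rw [hid] at hlo hhi
  have hs : aloneThroughput M.ρ (M.densS l) (M.RrS l) (M.RIs l) (M.qs l) = M.singleThroughput l := rfl
  rw [hs] at hlo hhi
  set Y := Real.exp (-M.secondaryLoad l) with hY
  have hY0 : 0 < Y := Real.exp_pos _
  have hY1 : Y ≤ 1 := Real.exp_le_one_iff.2 (by
    have h9 : 0 ≤ μ l * (M.qs l * b l) := by
      have : (0 : ℝ) ≤ M.qs l := (M.qs l).2.1
      simp only [hμ, hb]; positivity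
    rw [h1] at h9; linarith)
  set k := kappa / Real.pi with hk
  have hk0 : 0 < k := div_pos hκ hpi
  have e1 : k * Y * (1 - M.qs l) ^ 2 * (1 - η l) * (1 - w l) = k * Y * f₁ l := by
    simp only [hf1]; ring
  have e2 : k * Y / ((1 - M.qs l) * (1 - M.qs l * b l)) = k * Y * f₂ l := by
    simp only [hf2]; rw [div_eq_mul_inv]
  have hw' : (1 - (1 - M.qs l * b l - h l)⁻¹ * Real.exp (-(μ l * h l))) = 1 - w l := rfl
  rw [hw', e1, ← le_div_iff₀' h2] at hlo
  rw [e2, ← div_le_iff₀' h2] at hhi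
  have hkY : k * Y ≤ k := mul_le_of_le_one_right hk0.le hY1
  have hkY0 : 0 < k * Y := mul_pos hk0 hY0
  have a1 : |k * Y * (f₁ l - 1)| ≤ k * |f₁ l - 1| := by
    rw [abs_mul, abs_of_pos hkY0]; exact mul_le_mul_of_nonneg_right hkY (abs_nonneg _)
  have a2 : |k * Y * (f₂ l - 1)| ≤ k * |f₂ l - 1| := by
    rw [abs_mul, abs_of_pos hkY0]; exact mul_le_mul_of_nonneg_right hkY (abs_nonneg _)
  have b1 := (abs_le.1 a1).1
  have b2 := (abs_le.1 a2).2
  have n1 := mul_nonneg hk0.le (abs_nonneg (f₁ l - 1))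
  have n2 := mul_nonneg hk0.le (abs_nonneg (f₂ l - 1))
  rw [mul_sub, mul_one] at b1 b2
  rw [Real.norm_eq_abs, abs_le, mul_add]
  constructor <;> linarith

end OverlaidNetworks

/-! ### Elementary estimates for asymptotic comparison -/

lemma isAMG_of_tendsto {C f : ℝ → ℝ} {χ : ℝ} (h : Tendsto (fun l => C l / f l) atTop (𝓝 χ))
    (hχ : χ ≠ 0) : IsAMG C f χ :=
  ⟨(isTheta_of_div_tendsto_nhds_ne_zero h hχ).symm, h⟩

lemma isTheta_of_eventually_bounds {f g : ℝ → ℝ} {c C : ℝ} (hc : 0 < c)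
    (h : ∀ᶠ l in atTop, 0 ≤ g l ∧ c * g l ≤ f l ∧ f l ≤ C * g l) : f =Θ[atTop] g := by
  constructor
  · refine IsBigO.of_bound C ?_
    filter_upwards [h] with l hl
    have h1 : 0 ≤ f l := (mul_nonneg hc.le hl.1).trans hl.2.1
    rw [Real.norm_of_nonneg h1, Real.norm_of_nonneg hl.1]
    exact hl.2.2
  · refine IsBigO.of_bound c⁻¹ ?_
    filter_upwards [h] with l hl
    have h1 : 0 ≤ f l := (mul_nonneg hc.le hl.1).trans hl.2.1
    rw [Real.norm_of_nonneg h1, Real.norm_of_nonneg hl.1, ← div_eq_inv_mul, le_div_iff₀' hc]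
    exact hl.2.1

lemma abs_exp_neg_sub_le {a b : ℝ} (ha : 0 ≤ a) (hb : 0 ≤ b) :
    |Real.exp (-a) - Real.exp (-b)| ≤ |a - b| := by
  have key : ∀ {a b : ℝ}, 0 ≤ a → a ≤ b → Real.exp (-a) - Real.exp (-b) ≤ b - a := by
    intro a b ha hab
    have h5 := Real.add_one_le_exp (-(b - a))
    have h6 : Real.exp (-b) = Real.exp (-a) * Real.exp (-(b - a)) := by
      rw [← Real.exp_add]; congr 1; ring
    have h7 : Real.exp (-a) ≤ 1 := Real.exp_le_one_iff.2 (by linarith)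
    have h10 := Real.exp_pos (-a)
    rw [h6]
    nlinarith
  rcases le_total a b with h | h
  · rw [abs_of_nonneg (sub_nonneg.2 (Real.exp_le_exp.2 (by linarith))), abs_sub_comm,
      abs_of_nonneg (sub_nonneg.2 h)]
    exact key ha h
  · rw [abs_sub_comm, abs_of_nonneg (sub_nonneg.2 (Real.exp_le_exp.2 (by linarith))),
      abs_of_nonneg (sub_nonneg.2 h)]
    exact key hb h

lemma max_sq_sub_max_sq_le {c x y m : ℝ} (hc : 0 ≤ c) (hxy : x ≤ y) (hm : max c y ≤ m) :
    max c y ^ 2 - max c x ^ 2 ≤ (y - x) * (2 * m) := by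
  have h1 : max c y - max c x ≤ y - x := by
    rcases max_cases c y with ⟨h, -⟩ | ⟨h, -⟩ <;> rw [h]
    · linarith [le_max_left c x]
    · linarith [le_max_right c x]
  have h2 : max c x ≤ max c y := max_le_max le_rfl hxy
  have h3 : c ≤ max c x := le_max_left c x
  calc max c y ^ 2 - max c x ^ 2 = (max c y - max c x) * (max c y + max c x) := by ring
    _ ≤ (y - x) * (2 * m) :=
        mul_le_mul h1 (by linarith) (by linarith) (by linarith)

namespace OverlaidNetworks

variable (M : OverlaidNetworks)

/-! ## The throughput of the secondary network in the presence of the primary network -/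

lemma eventually_ratio_bounds (hβ : 1 < M.β) (hRD : M.Admissible) : ∀ᶠ l in atTop,
    0 ≤ M.RD l / M.RIp l ∧ 0 ≤ M.RIs l / M.RIp l ∧ 0 ≤ M.RrS l / M.RIp l ∧
      M.RD l / M.RIp l + M.RIs l / M.RIp l ≤ 2 := by
  have h1 : Tendsto (fun l => 1 + M.csp * (M.RIs l / M.RIp l) + M.RIs l / M.RIp l) atTop (𝓝 1) := by
    have hs := M.tendsto_RIs_div_RIp hβ
    simpa using ((hs.const_mul M.csp).const_add 1).add hs
  filter_upwards [M.eventually_RIp_pos, M.eventually_RD_div_RIp_le hRD,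
    h1.eventually_lt_const (by norm_num : (1 : ℝ) < 2)] with l hp h2 h3
  have h4 := M.RrS_nonneg l
  have h5 := h4.trans (M.RrS_le_RIs l)
  exact ⟨div_nonneg (M.RD_nonneg l) hp.le, div_nonneg h5 hp.le, div_nonneg h4 hp.le, by linarith⟩

/-- The probability that a hop is not disturbed by the primary network. -/
def thinning (l : ℝ) : ℝ :=
  Real.exp (-(M.primaryLoad l * max M.cps (M.RD l / M.RIp l + M.RIs l / M.RIp l) ^ 2))

/-- Measured in units of RIp, the two void radii differ by at most (RIs + RrS)/RIp → 0 and stay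
bounded by 2, while the primary load is bounded. The boundary strip contributes O(RIp + RrS). -/
lemma tendsto_overlaid_sub (hβ : 1 < M.β) (hRD : M.Admissible)
    (hqs : (fun l => (M.qs l : ℝ)) =Θ[atTop] fun l => 1 / Real.log (M.densS l))
    (hqp : (fun l => (M.qp l : ℝ)) =O[atTop] fun l => 1 / Real.log l) :
    Tendsto (fun l => M.overlaidThroughput l / M.ideal l -
      M.thinning l * (M.singleThroughput l / M.ideal l)) atTop (𝓝 0) := by
  have hρ := M.ρ_pos
  obtain ⟨C, hC0, hC⟩ := M.exists_primaryLoad_le hqp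
  have tbound : Tendsto (fun l => C * ((M.RIs l / M.RIp l + M.RrS l / M.RIp l) * (2 * 2)) +
      2 * (M.RIp l * 2 + M.RrS l) / M.ρ) atTop (𝓝 0) := by
    have h1 := ((((M.tendsto_RIs_div_RIp hβ).add (M.tendsto_RrS_div_RIp hβ)).mul_const
      (2 * 2)).const_mul C).add
      ((((M.tendsto_RIp.mul_const 2).add M.tendsto_RrS).const_mul 2).div_const M.ρ)
    simpa using h1
  refine squeeze_zero_norm' ?_ tbound
  filter_upwards [hC, M.eventually_RIp_pos, M.eventually_ratio_bounds hβ hRD,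
    M.eventually_ideal_pos hqs, M.tendsto_densS.eventually_gt_atTop 0, eventually_ge_atTop 0]
    with l h1 hp h2 hI hn hl
  obtain ⟨hd, hs, ht, hds⟩ := h2
  set d := M.RD l / M.RIp l with hd_def
  set s := M.RIs l / M.RIp l with hs_def
  set t := M.RrS l / M.RIp l with ht_def
  have eD : M.RD l = M.RIp l * d := by rw [hd_def]; field_simp
  have eS : M.RIs l = M.RIp l * s := by rw [hs_def]; field_simp
  have eT : M.RrS l = M.RIp l * t := by rw [ht_def]; field_simp
  have e2 : max (M.RIps l) (M.RD l + M.RIs l) = M.RIp l * max M.cps (d + s) := by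
    rw [mul_max_of_nonneg _ _ hp.le, eD, eS, mul_add, RIps, mul_comm]
  have e1 : max (M.RIps l) (M.RD l - M.RrS l) = M.RIp l * max M.cps (d - t) := by
    rw [mul_max_of_nonneg _ _ hp.le, eD, eT, mul_sub, RIps, mul_comm]
  have hcps := M.cps_le_one
  have hm : max M.cps (d + s) ≤ 2 := max_le (by linarith) hds
  have h := abs_sharedThroughput_sub_le (qp := M.qp l) (q := M.qs l) (RD := M.RD l) hρ hl hn.le
    (M.RrS_nonneg l) (M.RrS_le_RIs l) (RIps := M.RIps l) (mul_nonneg M.cps_pos.le hp.le)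
  rw [e1, e2] at h
  have e3 : l * M.qp l * Real.pi * (M.RIp l * max M.cps (d + s)) ^ 2 =
      M.primaryLoad l * max M.cps (d + s) ^ 2 := by rw [primaryLoad]; ring
  have e4 : l * M.qp l * Real.pi * ((M.RIp l * max M.cps (d + s)) ^ 2 -
      (M.RIp l * max M.cps (d - t)) ^ 2) =
      M.primaryLoad l * (max M.cps (d + s) ^ 2 - max M.cps (d - t) ^ 2) := by
    rw [primaryLoad]; ring
  rw [e3, e4] at h
  have hsh : sharedThroughput M.ρ l (M.qp l) (M.densS l) (M.qs l) (M.RrS l) (M.RIs l) (M.RIps l)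
    (M.RD l) = M.overlaidThroughput l := rfl
  have hal : aloneThroughput M.ρ (M.densS l) (M.RrS l) (M.RIs l) (M.qs l) = M.singleThroughput l := rfl
  have hth : Real.exp (-(M.primaryLoad l * max M.cps (d + s) ^ 2)) = M.thinning l := rfl
  have hid : M.densS l * (Real.pi * M.ρ ^ 2) * M.qs l * M.RrS l = M.ideal l := rfl
  rw [hsh, hal, hth, hid] at h
  rw [← mul_div_assoc, ← sub_div, norm_div, Real.norm_eq_abs, Real.norm_of_nonneg hI.le,
    div_le_iff₀' hI]
  refine h.trans (mul_le_mul_of_nonneg_left ?_ hI.le)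
  have h5 := max_sq_sub_max_sq_le M.cps_pos.le (by linarith : d - t ≤ d + s) hm
  rw [show d + s - (d - t) = s + t by ring] at h5
  have h6 : 0 ≤ max M.cps (d + s) ^ 2 - max M.cps (d - t) ^ 2 :=
    sub_nonneg.2 (pow_le_pow_left₀ (M.cps_pos.le.trans (le_max_left _ _))
      (max_le_max le_rfl (by linarith)) 2)
  gcongr
  exact h1.2

lemma exists_single_bounds
    (hqs : (fun l => (M.qs l : ℝ)) =Θ[atTop] fun l => 1 / Real.log (M.densS l)) :
    ∃ c C : ℝ, 0 < c ∧ ∀ᶠ l in atTop, c ≤ M.singleThroughput l / M.ideal l ∧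
      M.singleThroughput l / M.ideal l ≤ C := by
  obtain ⟨c, C, hc, h⟩ := M.exists_qs_mul_log_bounds hqs
  have hk : 0 < kappa / Real.pi := div_pos kappa_pos Real.pi_pos
  set m := Real.pi * (1 + M.marginS) * M.Ks ^ 2 with hm
  have hm0 : 0 < m := by
    have := M.marginS_nonneg
    have := M.Ks_pos
    have := Real.pi_pos
    positivity
  have hlow : 0 < kappa / Real.pi * Real.exp (-(C * m)) := mul_pos hk (Real.exp_pos _)
  refine ⟨kappa / Real.pi * Real.exp (-(C * m)) / 2, kappa / Real.pi + 1, by positivity, ?_⟩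
  have ht := M.tendsto_single_div_ideal hqs
  filter_upwards [h, ht.eventually_const_lt (by linarith :
    -(kappa / Real.pi * Real.exp (-(C * m)) / 2) < 0), ht.eventually_lt_const one_pos]
    with l h1 h2 h3
  have h4 : M.secondaryLoad l ≤ C * m := mul_le_mul_of_nonneg_right h1.2 hm0.le
  have h5 : 0 ≤ M.secondaryLoad l := mul_nonneg (hc.le.trans h1.1) hm0.le
  have h6 : Real.exp (-(C * m)) ≤ Real.exp (-M.secondaryLoad l) := Real.exp_le_exp.2 (by linarith)
  have h7 : Real.exp (-M.secondaryLoad l) ≤ 1 := Real.exp_le_one_iff.2 (by linarith)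
  have h8 := mul_le_mul_of_nonneg_left h6 hk.le
  have h9 := mul_le_mul_of_nonneg_left h7 hk.le
  constructor <;> linarith

/-- The thinning factor never exceeds 1 and stays above e^{-4B}, where B bounds the primary load, so
the overlaid network inherits the order of the stand-alone one. -/
lemma exists_overlaid_bounds (hβ : 1 < M.β) (hRD : M.Admissible)
    (hqs : (fun l => (M.qs l : ℝ)) =Θ[atTop] fun l => 1 / Real.log (M.densS l))
    (hqp : (fun l => (M.qp l : ℝ)) =O[atTop] fun l => 1 / Real.log l) :
    ∃ c C : ℝ, 0 < c ∧ ∀ᶠ l in atTop, c ≤ M.overlaidThroughput l / M.ideal l ∧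
      M.overlaidThroughput l / M.ideal l ≤ C := by
  obtain ⟨c, C, hc, h⟩ := M.exists_single_bounds hqs
  obtain ⟨B, hB0, hB⟩ := M.exists_primaryLoad_le hqp
  have hlow : 0 < Real.exp (-(B * 2 ^ 2)) * c := mul_pos (Real.exp_pos _) hc
  refine ⟨Real.exp (-(B * 2 ^ 2)) * c / 2, C + 1, by positivity, ?_⟩
  have ht := M.tendsto_overlaid_sub hβ hRD hqs hqp
  filter_upwards [h, hB, M.eventually_ratio_bounds hβ hRD,
    ht.eventually_const_lt (neg_neg_of_pos (half_pos hlow)), ht.eventually_lt_const one_pos]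
    with l h1 h2 h3 h4 h5
  have hcps := M.cps_le_one
  have hcps0 := M.cps_pos
  have hm : max M.cps (M.RD l / M.RIp l + M.RIs l / M.RIp l) ≤ 2 := max_le (by linarith) h3.2.2.2
  have hm0 : 0 ≤ max M.cps (M.RD l / M.RIp l + M.RIs l / M.RIp l) := hcps0.le.trans (le_max_left _ _)
  have h6 : M.primaryLoad l * max M.cps (M.RD l / M.RIp l + M.RIs l / M.RIp l) ^ 2 ≤ B * 2 ^ 2 :=
    mul_le_mul h2.2 (pow_le_pow_left₀ hm0 hm 2) (by positivity) hB0
  have h7 : Real.exp (-(B * 2 ^ 2)) ≤ M.thinning l := Real.exp_le_exp.2 (by linarith)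
  have h8 : M.thinning l ≤ 1 := Real.exp_le_one_iff.2 (by
    have := mul_nonneg h2.1 (sq_nonneg (max M.cps (M.RD l / M.RIp l + M.RIs l / M.RIp l)))
    linarith)
  have h9 : Real.exp (-(B * 2 ^ 2)) * c ≤ M.thinning l * (M.singleThroughput l / M.ideal l) :=
    mul_le_mul h7 h1.1 hc.le ((Real.exp_pos _).le.trans h7)
  have h10 : M.thinning l * (M.singleThroughput l / M.ideal l) ≤ M.singleThroughput l / M.ideal l :=
    mul_le_of_le_one_left (hc.le.trans h1.1) h8
  constructor <;> linarith [h1.2]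

lemma overlaidThroughput_isTheta (hβ : 1 < M.β) (hRD : M.Admissible)
    (hqs : (fun l => (M.qs l : ℝ)) =Θ[atTop] fun l => 1 / Real.log (M.densS l))
    (hqp : (fun l => (M.qp l : ℝ)) =O[atTop] fun l => 1 / Real.log l) :
    M.overlaidThroughput =Θ[atTop] M.scale := by
  obtain ⟨c, C, hc, h⟩ := M.exists_overlaid_bounds hβ hRD hqs hqp
  obtain ⟨c', C', hc', h'⟩ := M.exists_qs_mul_log_bounds hqs
  set K := Real.pi * M.ρ ^ 2 * M.Ks with hK
  have hK0 : 0 < K := by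
    have := M.ρ_pos
    have := M.Ks_pos
    have := Real.pi_pos
    positivity
  have h1 : M.overlaidThroughput =Θ[atTop] M.ideal := by
    refine isTheta_of_eventually_bounds hc (C := C) ?_
    filter_upwards [h, M.eventually_ideal_pos hqs] with l hl hI
    exact ⟨hI.le, (le_div_iff₀ hI).1 hl.1, (div_le_iff₀ hI).1 hl.2⟩
  refine h1.trans (isTheta_of_eventually_bounds (mul_pos hK0 hc') (C := K * C') ?_)
  filter_upwards [h', M.eventually_ideal_eq] with l hl he
  have hs : 0 ≤ M.scale l := Real.sqrt_nonneg _
  rw [he]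
  refine ⟨hs, ?_, ?_⟩
  · exact mul_le_mul_of_nonneg_right (mul_le_mul_of_nonneg_left hl.1 hK0.le) hs
  · exact mul_le_mul_of_nonneg_right (mul_le_mul_of_nonneg_left hl.2 hK0.le) hs

/-! ## Relative throughput -/

lemma tendsto_thinning_sub (hβ : 1 < M.β) (hRD : M.Admissible)
    (hqp : (fun l => (M.qp l : ℝ)) ~[atTop] (fun l => 1 / (l * Real.pi * M.RIp l ^ 2))) :
    Tendsto (fun l => M.thinning l - Real.exp (-max M.cps (M.RD l / M.RIp l) ^ 2)) atTop (𝓝 0) := by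
  have tB := M.tendsto_primaryLoad hqp
  have tbound : Tendsto (fun l => |M.primaryLoad l - 1| * 2 ^ 2 + M.RIs l / M.RIp l * (2 * 2))
      atTop (𝓝 0) := by
    have := ((tB.sub_const 1).abs.mul_const (2 ^ 2)).add
      ((M.tendsto_RIs_div_RIp hβ).mul_const (2 * 2))
    simpa using this
  refine squeeze_zero_norm' ?_ tbound
  filter_upwards [M.eventually_ratio_bounds hβ hRD, tB.eventually_const_lt one_pos] with l h1 h2
  obtain ⟨hd, hs, -, hds⟩ := h1
  set d := M.RD l / M.RIp l
  set s := M.RIs l / M.RIp l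
  have hcps := M.cps_le_one
  have hcps0 := M.cps_pos
  have hm : max M.cps (d + s) ≤ 2 := max_le (by linarith) hds
  have hm0 : 0 ≤ max M.cps (d + s) := hcps0.le.trans (le_max_left _ _)
  have h3 := max_sq_sub_max_sq_le hcps0.le (by linarith : d ≤ d + s) hm
  rw [add_sub_cancel_left] at h3
  have h4 : max M.cps d ^ 2 ≤ max M.cps (d + s) ^ 2 :=
    pow_le_pow_left₀ (hcps0.le.trans (le_max_left _ _)) (max_le_max le_rfl (by linarith)) 2
  refine (abs_exp_neg_sub_le (mul_nonneg h2.le (sq_nonneg _)) (sq_nonneg _)).trans ?_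
  have e : M.primaryLoad l * max M.cps (d + s) ^ 2 - max M.cps d ^ 2 =
      (M.primaryLoad l - 1) * max M.cps (d + s) ^ 2 +
        (max M.cps (d + s) ^ 2 - max M.cps d ^ 2) := by ring
  rw [e]
  refine (abs_add_le _ _).trans (add_le_add ?_ ?_)
  · rw [abs_mul, abs_of_nonneg (sq_nonneg (max M.cps (d + s)))]
    exact mul_le_mul_of_nonneg_left (pow_le_pow_left₀ hm0 hm 2) (abs_nonneg _)
  · rw [abs_of_nonneg (sub_nonneg.2 h4)]
    exact h3

/-- Both throughputs are compared in units of `ideal`; dividing is harmless because the stand-alone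
one is bounded away from 0 in these units. -/
lemma tendsto_ratio_sub (hβ : 1 < M.β) (hRD : M.Admissible)
    (hqs : (fun l => (M.qs l : ℝ)) =Θ[atTop] fun l => 1 / Real.log (M.densS l))
    (hqp : (fun l => (M.qp l : ℝ)) =O[atTop] fun l => 1 / Real.log l)
    (hqp' : (fun l => (M.qp l : ℝ)) ~[atTop] (fun l => 1 / (l * Real.pi * M.RIp l ^ 2))) :
    Tendsto (fun l => M.overlaidThroughput l / M.singleThroughput l -
      Real.exp (-max M.cps (M.RD l / M.RIp l) ^ 2)) atTop (𝓝 0) := by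
  obtain ⟨c, C, hc, h⟩ := M.exists_single_bounds hqs
  have h1 : Tendsto (fun l => M.overlaidThroughput l / M.singleThroughput l - M.thinning l)
      atTop (𝓝 0) := by
    have h2 := (M.tendsto_overlaid_sub hβ hRD hqs hqp).abs.div_const c
    rw [abs_zero, zero_div] at h2
    refine squeeze_zero_norm' ?_ h2
    filter_upwards [h, M.eventually_ideal_pos hqs] with l h3 h4
    have h5 : 0 < M.singleThroughput l / M.ideal l := hc.trans_le h3.1
    have h6 : M.overlaidThroughput l / M.singleThroughput l - M.thinning l =
        (M.overlaidThroughput l / M.ideal l - M.thinning l * (M.singleThroughput l / M.ideal l)) /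
          (M.singleThroughput l / M.ideal l) := by
      rw [sub_div, mul_div_cancel_right₀ _ h5.ne', div_div_div_cancel_right₀ h4.ne']
    rw [h6, norm_div, Real.norm_of_nonneg h5.le, Real.norm_eq_abs]
    exact div_le_div_of_nonneg_left (abs_nonneg _) hc h3.1
  have h2 := h1.add (M.tendsto_thinning_sub hβ hRD hqp')
  simpa using h2

lemma tendsto_ratio_of_le (hβ : 1 < M.β) (hRD : M.Admissible)
    (hqs : (fun l => (M.qs l : ℝ)) =Θ[atTop] fun l => 1 / Real.log (M.densS l))
    (hqp : (fun l => (M.qp l : ℝ)) =O[atTop] fun l => 1 / Real.log l)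
    (hqp' : (fun l => (M.qp l : ℝ)) ~[atTop] (fun l => 1 / (l * Real.pi * M.RIp l ^ 2)))
    (hle : ∀ᶠ l in atTop, M.RD l ≤ M.RIps l - M.RIs l) :
    Tendsto (fun l => M.overlaidThroughput l / M.singleThroughput l) atTop
      (𝓝 (Real.exp (-M.cps ^ 2))) := by
  have h := (M.tendsto_ratio_sub hβ hRD hqs hqp hqp').add_const (Real.exp (-M.cps ^ 2))
  rw [zero_add] at h
  refine h.congr' ?_
  filter_upwards [hle, M.eventually_RIp_pos] with l h1 hp
  have h2 : M.RD l / M.RIp l ≤ M.cps := by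
    rw [div_le_iff₀ hp]
    have : 0 ≤ M.RIs l := (M.RrS_nonneg l).trans (M.RrS_le_RIs l)
    have : M.RIps l = M.cps * M.RIp l := rfl
    linarith
  rw [max_eq_left h2]
  ring

lemma eventually_cps_lt_of_lt (hlt : ∀ᶠ l in atTop, M.RIps l - M.RIs l < M.RD l) :
    ∀ᶠ l in atTop, M.cps < M.RD l / M.RIp l + M.RIs l / M.RIp l := by
  filter_upwards [hlt, M.eventually_RIp_pos] with l h1 hp
  rw [← add_div, lt_div_iff₀ hp]
  have : M.RIps l = M.cps * M.RIp l := rfl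
  linarith

/-- Here cps < RD/RIp + RIs/RIp, so the maximum of cps and RD/RIp exceeds RD/RIp by at most RIs/RIp
→ 0. -/
lemma tendsto_ratio_sub_of_lt (hβ : 1 < M.β) (hRD : M.Admissible)
    (hqs : (fun l => (M.qs l : ℝ)) =Θ[atTop] fun l => 1 / Real.log (M.densS l))
    (hqp : (fun l => (M.qp l : ℝ)) =O[atTop] fun l => 1 / Real.log l)
    (hqp' : (fun l => (M.qp l : ℝ)) ~[atTop] (fun l => 1 / (l * Real.pi * M.RIp l ^ 2)))
    (hlt : ∀ᶠ l in atTop, M.RIps l - M.RIs l < M.RD l) :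
    Tendsto (fun l => M.overlaidThroughput l / M.singleThroughput l -
      Real.exp (-(M.RD l / M.RIp l) ^ 2)) atTop (𝓝 0) := by
  have h1 : Tendsto (fun l => Real.exp (-max M.cps (M.RD l / M.RIp l) ^ 2) -
      Real.exp (-(M.RD l / M.RIp l) ^ 2)) atTop (𝓝 0) := by
    have tb := (M.tendsto_RIs_div_RIp hβ).mul_const (2 * 2)
    rw [zero_mul] at tb
    refine squeeze_zero_norm' ?_ tb
    filter_upwards [M.eventually_cps_lt_of_lt hlt, M.eventually_ratio_bounds hβ hRD] with l h2 h3
    obtain ⟨hd, hs, -, hds⟩ := h3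
    set d := M.RD l / M.RIp l
    set s := M.RIs l / M.RIp l
    have h4 : max M.cps d ≤ d + s := max_le h2.le (by linarith)
    have h5 : d ≤ max M.cps d := le_max_right _ _
    refine (abs_exp_neg_sub_le (sq_nonneg _) (sq_nonneg _)).trans ?_
    rw [abs_of_nonneg (sub_nonneg.2 (pow_le_pow_left₀ hd h5 2))]
    calc max M.cps d ^ 2 - d ^ 2 = (max M.cps d - d) * (max M.cps d + d) := by ring
      _ ≤ s * (2 * 2) := mul_le_mul (by linarith) (by linarith) (by linarith) hs
  have h2 := (M.tendsto_ratio_sub hβ hRD hqs hqp hqp').add h1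
  simpa using h2

/-! ## The upper bound -/

/-- The quotient in `upperBound` is at least 1, as q·e^{-a} ≤ q, and the first exponential of the
bracket may be dropped. What remains is e^{-P} e^{1-2a} = e^{-a} e^{(1-a)-P}, to which e^x ≥ 1 + x
applies. The order of quantifiers allows a to vary with l. -/
lemma eventually_le_upperBound
    (hqs : (fun l => (M.qs l : ℝ)) =Θ[atTop] fun l => 1 / Real.log (M.densS l)) :
    ∀ᶠ l in atTop, ∀ a : ℝ, 0 ≤ a →
      Real.exp (-a) * (1 + ((1 - a) - max (M.cps ^ 2 - a) 0)) ≤ M.upperBound l a := by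
  filter_upwards [M.eventually_RIp_pos, M.eventually_RrS_pos,
    (M.tendsto_qs hqs).eventually_lt_const one_pos, M.tendsto_densS.eventually_gt_atTop 0]
    with l hp hR hq hn a ha
  have hratio : M.RIps l / M.RIp l = M.cps := by
    rw [RIps, mul_div_assoc, div_self hp.ne', mul_one]
  have hq0 : (0 : ℝ) ≤ M.qs l := (M.qs l).2.1
  have hpi := Real.pi_pos
  set D := 1 - Real.exp (-(M.densS l * (1 - M.qs l) * Real.pi * M.RrS l ^ 2 / 2)) with hD
  set N := 1 - Real.exp (-(M.densS l * (1 - M.qs l * Real.exp (-a)) * Real.pi * M.RrS l ^ 2 / 2))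
    with hN
  have h1q : (0 : ℝ) < 1 - M.qs l := by linarith
  have hD0 : 0 < D := by
    have : 0 < M.densS l * (1 - M.qs l) * Real.pi * M.RrS l ^ 2 / 2 := by positivity
    rw [hD, sub_pos, Real.exp_lt_one_iff]
    linarith
  have hND : D ≤ N := by
    have h1 : Real.exp (-a) ≤ 1 := Real.exp_le_one_iff.2 (by linarith)
    have h2 : M.qs l * Real.exp (-a) ≤ M.qs l := mul_le_of_le_one_right hq0 h1
    have h3 : M.densS l * (1 - M.qs l) * Real.pi * M.RrS l ^ 2 / 2 ≤
        M.densS l * (1 - M.qs l * Real.exp (-a)) * Real.pi * M.RrS l ^ 2 / 2 := by gcongr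
    have h4 := Real.exp_le_exp.2 (neg_le_neg h3)
    rw [hD, hN]
    linarith
  have hF : 1 ≤ N / D := (one_le_div hD0).2 hND
  rw [upperBound, hratio]
  set P := max (M.cps ^ 2 - a) 0
  have h1 : Real.exp (-a) * (1 + ((1 - a) - P)) ≤ Real.exp (-P) * Real.exp (1 - 2 * a) := by
    have h2 := Real.add_one_le_exp ((1 - a) - P)
    have h3 : Real.exp (-P) * Real.exp (1 - 2 * a) = Real.exp (-a) * Real.exp ((1 - a) - P) := by
      rw [← Real.exp_add, ← Real.exp_add]; congr 1; ring
    rw [h3]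
    exact mul_le_mul_of_nonneg_left (by linarith) (Real.exp_pos _).le
  have h4 : Real.exp (-P) * Real.exp (1 - 2 * a) ≤
      (Real.exp (-M.cps ^ 2) + Real.exp (-P)) * Real.exp (1 - 2 * a) :=
    mul_le_mul_of_nonneg_right (by linarith [Real.exp_pos (-M.cps ^ 2)]) (Real.exp_pos _).le
  exact h1.trans (h4.trans (le_mul_of_one_le_right (by positivity) hF))

/-- For a = (RD/RIp)², admissibility gives a ≤ 1 + ε/2 and the second case gives P ≤ ε/2, so (1-a) -
P ≥ -ε; the prefactor e^{-a} is at most 1. -/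
lemma eventually_exp_sub_le_upperBound (hβ : 1 < M.β) (hRD : M.Admissible)
    (hqs : (fun l => (M.qs l : ℝ)) =Θ[atTop] fun l => 1 / Real.log (M.densS l))
    (hlt : ∀ᶠ l in atTop, M.RIps l - M.RIs l < M.RD l) {ε : ℝ} (hε : 0 < ε) :
    ∀ᶠ l in atTop, Real.exp (-(M.RD l / M.RIp l) ^ 2) - ε ≤
      M.upperBound l ((M.RD l / M.RIp l) ^ 2) := by
  have hs := M.tendsto_RIs_div_RIp hβ
  have h1 : Tendsto (fun l => (1 + M.csp * (M.RIs l / M.RIp l)) ^ 2) atTop (𝓝 1) := by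
    simpa using ((hs.const_mul M.csp).const_add 1).pow 2
  have h2 : Tendsto (fun l => M.RIs l / M.RIp l * (2 * 2)) atTop (𝓝 0) := by
    simpa using hs.mul_const (2 * 2)
  filter_upwards [M.eventually_le_upperBound hqs, M.eventually_cps_lt_of_lt hlt,
    M.eventually_ratio_bounds hβ hRD, M.eventually_RD_div_RIp_le hRD,
    h1.eventually_lt_const (by linarith : (1 : ℝ) < 1 + ε / 2),
    h2.eventually_lt_const (by linarith : (0 : ℝ) < ε / 2)] with l hU hc hb hd1 h3 h4
  obtain ⟨hd, hs0, -, hds⟩ := hb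
  set d := M.RD l / M.RIp l
  set s := M.RIs l / M.RIp l
  refine le_trans ?_ (hU (d ^ 2) (sq_nonneg d))
  have hcps0 := M.cps_pos
  have h5 : d ^ 2 ≤ 1 + ε / 2 := (pow_le_pow_left₀ hd hd1 2).trans h3.le
  have h6 : max (M.cps ^ 2 - d ^ 2) 0 ≤ ε / 2 := by
    refine max_le ?_ (by linarith)
    have h7 : M.cps ^ 2 ≤ (d + s) ^ 2 := pow_le_pow_left₀ hcps0.le hc.le 2
    have h8 : (d + s) ^ 2 - d ^ 2 ≤ s * (2 * 2) := by
      calc (d + s) ^ 2 - d ^ 2 = s * (d + (d + s)) := by ring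
        _ ≤ s * (2 * 2) := mul_le_mul_of_nonneg_left (by linarith) hs0
    linarith
  have h9 : Real.exp (-d ^ 2) ≤ 1 := Real.exp_le_one_iff.2 (by linarith [sq_nonneg d])
  have h10 := Real.exp_pos (-d ^ 2)
  have h11 : -ε ≤ (1 - d ^ 2) - max (M.cps ^ 2 - d ^ 2) 0 := by linarith
  nlinarith [mul_le_mul_of_nonneg_left h11 h10.le]

/-! ## Asymptotic multiplexing gains -/

/-- Once qs·log n converges to c, the load converges to c·m, and the quotient `ideal` / `scale`
converges as well; the gain is the product of the two limits. -/
lemma exists_tendsto_single_div_scale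
    (hqs : (fun l => (M.qs l : ℝ)) =Θ[atTop] fun l => 1 / Real.log (M.densS l)) {c : ℝ} (hc : 0 < c)
    (h : Tendsto (fun l => (M.qs l : ℝ) * Real.log (M.densS l)) atTop (𝓝 c)) :
    ∃ χ > 0, Tendsto (fun l => M.singleThroughput l / M.scale l) atTop (𝓝 χ) := by
  have hk : 0 < kappa / Real.pi := div_pos kappa_pos Real.pi_pos
  have hK0 : 0 < Real.pi * M.ρ ^ 2 * M.Ks := by
    have := M.ρ_pos
    have := M.Ks_pos
    have := Real.pi_pos
    positivity
  set m := Real.pi * (1 + M.marginS) * M.Ks ^ 2 with hm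
  refine ⟨kappa / Real.pi * Real.exp (-(c * m)) * (Real.pi * M.ρ ^ 2 * M.Ks * c), by positivity, ?_⟩
  have h1 : Tendsto (fun l => kappa / Real.pi * Real.exp (-M.secondaryLoad l)) atTop
      (𝓝 (kappa / Real.pi * Real.exp (-(c * m)))) :=
    ((Real.continuous_exp.tendsto _).comp (h.mul_const m).neg).const_mul _
  have h2 := ((M.tendsto_single_div_ideal hqs).add h1).mul
    (h.const_mul (Real.pi * M.ρ ^ 2 * M.Ks))
  rw [zero_add] at h2
  refine h2.congr' ?_
  filter_upwards [M.eventually_ideal_eq, M.eventually_ideal_pos hqs] with l h3 h4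
  rw [sub_add_cancel]
  have h5 : M.scale l ≠ 0 := by
    intro h0
    rw [h0, mul_zero] at h3
    linarith
  have h6 : Real.pi * M.ρ ^ 2 * M.Ks * (M.qs l * Real.log (M.densS l)) = M.ideal l / M.scale l := by
    rw [h3, mul_div_cancel_right₀ _ h5]
  rw [h6, div_mul_div_cancel₀ h4.ne']

lemma isAMG_overlaid {χ r : ℝ} (hχ : χ ≠ 0) (hr : r ≠ 0)
    (h1 : Tendsto (fun l => M.singleThroughput l / M.scale l) atTop (𝓝 χ))
    (h2 : Tendsto (fun l => M.overlaidThroughput l / M.singleThroughput l) atTop (𝓝 r)) :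
    IsAMG M.overlaidThroughput M.scale (r * χ) := by
  refine isAMG_of_tendsto ?_ (mul_ne_zero hr hχ)
  refine (h2.mul h1).congr' ?_
  filter_upwards [h1.eventually_ne hχ] with l hl
  have : M.singleThroughput l ≠ 0 := fun h => hl (by rw [h, zero_div])
  rw [div_mul_div_cancel₀ this]

end OverlaidNetworks

end AdHoc

end

/-! ### The main theorem -/

theorem mainTheorem4 (M : AdHoc.OverlaidNetworks) (hβ : 1 < M.β) (hRD : M.Admissible)
    (hqs : (fun l => (M.qs l : ℝ)) =Θ[atTop] fun l => 1 / Real.log (M.densS l))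
    (hqp : (fun l => (M.qp l : ℝ)) =O[atTop] fun l => 1 / Real.log l) :
    -- throughput scaling
    M.overlaidThroughput =Θ[atTop] M.scale ∧
    -- relative throughput and relative gain, for the optimal primary access probability
    ((fun l => (M.qp l : ℝ)) ~[atTop] (fun l => 1 / (l * Real.pi * M.RIp l ^ 2)) →
      -- relative throughput, first case
      ((∀ᶠ l in atTop, M.RD l ≤ M.RIps l - M.RIs l) →
        Tendsto (fun l => M.overlaidThroughput l / M.singleThroughput l) atTop
          (𝓝 (Real.exp (-M.cps ^ 2)))) ∧
      -- relative throughput, second case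
      ((∀ᶠ l in atTop, M.RIps l - M.RIs l < M.RD l) →
        ∀ ε > 0, ∀ᶠ l in atTop,
          Real.exp (-(M.RD l / M.RIp l) ^ 2) - ε
            ≤ M.overlaidThroughput l / M.singleThroughput l ∧
          M.overlaidThroughput l / M.singleThroughput l
            ≤ M.upperBound l ((M.RD l / M.RIp l) ^ 2) + ε) ∧
      -- asymptotic multiplexing gains
      (∀ c > 0, Tendsto (fun l => (M.qs l : ℝ) * Real.log (M.densS l)) atTop (𝓝 c) →
        ∃ χ > 0, AdHoc.IsAMG M.singleThroughput M.scale χ ∧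
          ((∀ᶠ l in atTop, M.RD l ≤ M.RIps l - M.RIs l) →
            ∃ χs, AdHoc.IsAMG M.overlaidThroughput M.scale χs ∧
              χs / χ = Real.exp (-M.cps ^ 2)) ∧
          ((∀ᶠ l in atTop, M.RIps l - M.RIs l < M.RD l) →
            ∀ α : ℝ, Tendsto (fun l => M.RD l / M.RIp l) atTop (𝓝 α) →
              ∃ χs, AdHoc.IsAMG M.overlaidThroughput M.scale χs ∧
                Real.exp (-α ^ 2) ≤ χs / χ ∧
                ∀ᶠ l in atTop, χs / χ ≤ M.upperBound l (α ^ 2)))) := by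
  refine ⟨M.overlaidThroughput_isTheta hβ hRD hqs hqp, fun hqp' =>
    ⟨M.tendsto_ratio_of_le hβ hRD hqs hqp hqp', fun hlt ε hε => ?_, fun c hc hqc => ?_⟩⟩
  · have ht := M.tendsto_ratio_sub_of_lt hβ hRD hqs hqp hqp' hlt
    -- The error ε is shared: one half for the deviation of the ratio from e^{-a}, the other for the
    -- comparison of e^{-a} with the upper bound.
    filter_upwards [ht.eventually_const_lt (neg_neg_of_pos hε),
      ht.eventually_lt_const (half_pos hε),
      M.eventually_exp_sub_le_upperBound hβ hRD hqs hlt (half_pos hε)] with l h1 h2 h3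
    constructor <;> linarith
  · obtain ⟨χ, hχ, h1⟩ := M.exists_tendsto_single_div_scale hqs hc hqc
    refine ⟨χ, hχ, AdHoc.isAMG_of_tendsto h1 hχ.ne', fun hle => ?_, fun hlt α hα => ?_⟩
    · exact ⟨Real.exp (-M.cps ^ 2) * χ,
        M.isAMG_overlaid hχ.ne' (Real.exp_ne_zero _) h1
          (M.tendsto_ratio_of_le hβ hRD hqs hqp hqp' hle), mul_div_cancel_right₀ _ hχ.ne'⟩
    · have hs := M.tendsto_RIs_div_RIp hβ
      -- In the limit both o(1) terms disappear: cps ≤ α makes the positive part vanish and α ≤ 1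
      -- makes 1 - α² nonnegative. The upper bound for the gains therefore holds without an ε.
      have hα0 : M.cps ≤ α := by
        have h2 := hα.add hs
        rw [add_zero] at h2
        exact ge_of_tendsto h2 ((M.eventually_cps_lt_of_lt hlt).mono fun _ h => h.le)
      have hα1 : α ≤ 1 := by
        have h2 := (hs.const_mul M.csp).const_add 1
        rw [mul_zero, add_zero] at h2
        exact le_of_tendsto_of_tendsto hα h2 (M.eventually_RD_div_RIp_le hRD)
      have hcps := M.cps_pos
      have h2 : Tendsto (fun l => M.overlaidThroughput l / M.singleThroughput l) atTop
          (𝓝 (Real.exp (-α ^ 2))) := by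
        have h3 := (M.tendsto_ratio_sub_of_lt hβ hRD hqs hqp hqp' hlt).add
          ((Real.continuous_exp.tendsto _).comp (hα.pow 2).neg)
        rw [zero_add] at h3
        exact h3.congr fun l => sub_add_cancel _ _
      refine ⟨Real.exp (-α ^ 2) * χ, M.isAMG_overlaid hχ.ne' (Real.exp_ne_zero _) h1 h2,
        (mul_div_cancel_right₀ _ hχ.ne').ge, ?_⟩
      filter_upwards [M.eventually_le_upperBound hqs] with l hl
      rw [mul_div_cancel_right₀ _ hχ.ne']
      refine le_trans ?_ (hl (α ^ 2) (sq_nonneg α))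
      have h4 : M.cps ^ 2 ≤ α ^ 2 := pow_le_pow_left₀ hcps.le hα0 2
      have h5 : α ^ 2 ≤ 1 := pow_le_one₀ (hcps.le.trans hα0) hα1
      rw [max_eq_right (sub_nonpos.2 h4)]
      exact le_mul_of_one_le_right (Real.exp_pos _).le (by linarith)
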